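/- Let $S^1=\mathbb R/2\pi\mathbb Z$, let $\mathcal H^1(S^1)$ be the space of real-valued $f\in L^2(S^1)$ whose weak derivative $f_x$ lies in $L^2(S^1)$, with norm $(\|f\|_{L^2}^2+\|f_x\|_{L^2}^2)^{1/2}$, and let $H$ be the periodic Hilbert transform $$Hf(x)=\frac1{2\pi}\,\mathrm{P.V.}\!\int_{-\pi}^{\pi} f(y)\cot\Big(\frac{x-y}{2}\Big)\,dy .$$ For a parameter $a\in\mathbb R$ consider the system $$\Omega_t+a\,m\,\Omega_x-\omega\,p_x=0,\qquad \omega_t+a\,p\,\omega_x-\Omega\,m_x=0,\qquad p_x=H\Omega,\quad m_x=H\omega,$$ where $p$ and $m$ are normalized by $\int_{-\pi}^{\pi}p(t,x)\,dx=\int_{-\pi}^{\pi}m(t,x)\,dx=0$. **Theorem.** Let $a\in\mathbb R$ and $\Omega_0,\omega_0\in\mathcal H^1(S^1)$. There is a time $T>0$, depending (for given $a$) only on $\|\Omega_{0,x}\|_{L^2}$ and $\|\omega_{0,x}\|_{L^2}$, such that the system has on $[0,T)$ a unique solution $(\Omega,\omega)$ with $\Omega(0,\cdot)=\Omega_0$,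 $\omega(0,\cdot)=\omega_0$ and $$\Omega,\ \omega\in C^0\big([0,T);\mathcal H^1(S^1)\big)\cap C^1\big([0,T);L^2(S^1)\big).$$ Here the two evolution equations hold in $L^2(S^1)$ for every $t\in[0,T)$, the time derivative being taken in $L^2(S^1)$ (one-sided at $t=0$), and uniqueness is meant within this class of functions. -/

import Mathlib

open MeasureTheory Set Filter Topology

noncomputable section

namespace MHD1D

instance fact_two_pi_pos : Fact (0 < 2 * Real.pi) := ⟨Real.two_pi_pos⟩

/-- The circle `S¹ = ℝ / 2πℤ`; its `volume` is Lebesgue measure on a period, of total mass `2π`. -/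
abbrev Circ : Type := AddCircle (2 * Real.pi)

/-- The real Hilbert space `L²(S¹)`. -/
abbrev L2 : Type := Lp ℝ 2 (volume : Measure Circ)

/-- `g` is the weak (distributional) derivative of `f` on the circle:
`∫ f φ' = - ∫ g φ` for every smooth `φ` on the circle, whose derivative is called `φ'` here. -/
def HasWeakDeriv (f g : L2) : Prop :=
  ∀ φ φ' : C(Circ, ℝ), ContDiff ℝ (⊤ : ℕ∞) (fun x : ℝ => φ (x : Circ)) →
    (∀ x : ℝ, HasDerivAt (fun y : ℝ => φ (y : Circ)) (φ' (x : Circ)) x) →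
    ∫ x, f x * φ' x = -∫ x, g x * φ x

theorem integrable_mul (f : L2) (φ : C(Circ, ℝ)) : Integrable (fun x => f x * φ x) := by
  have hf : Integrable (fun x => f x) := (Lp.memLp f).integrable (by norm_num)
  obtain ⟨C, hC⟩ := isCompact_univ.exists_bound_of_continuousOn φ.continuous.continuousOn
  exact hf.mul_bdd (c := C) φ.continuous.aestronglyMeasurable
    (Eventually.of_forall fun x => hC x (mem_univ x))

theorem integral_add_mul (f g : L2) (φ : C(Circ, ℝ)) :
    ∫ x, (f + g) x * φ x = (∫ x, f x * φ x) + ∫ x, g x * φ x := by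
  rw [← integral_add (integrable_mul f φ) (integrable_mul g φ)]
  refine integral_congr_ae ?_
  filter_upwards [Lp.coeFn_add f g] with x hx
  rw [hx, Pi.add_apply, add_mul]

theorem integral_smul_mul (c : ℝ) (f : L2) (φ : C(Circ, ℝ)) :
    ∫ x, (c • f) x * φ x = c * ∫ x, f x * φ x := by
  rw [← integral_const_mul]
  refine integral_congr_ae ?_
  filter_upwards [Lp.coeFn_smul c f] with x hx
  rw [hx, Pi.smul_apply, smul_eq_mul, mul_assoc]

/-- The subspace of `L² × L²` of pairs `(f, f_x)`. -/
def graphDx : Submodule ℝ (WithLp 2 (L2 × L2)) where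
  carrier := {u | HasWeakDeriv u.fst u.snd}
  add_mem' := by
    intro u v hu hv φ φ' hφ hd
    have h1 := hu φ φ' hφ hd
    have h2 := hv φ φ' hφ hd
    rw [WithLp.add_fst, WithLp.add_snd, integral_add_mul, integral_add_mul, h1, h2]
    ring
  zero_mem' := by
    intro φ φ' hφ hd
    have h : ∀ ψ : C(Circ, ℝ), ∫ x, (0 : L2) x * ψ x = 0 := by
      intro ψ
      simpa only [zero_smul, zero_mul] using integral_smul_mul 0 (0 : L2) ψ
    rw [WithLp.zero_fst, WithLp.zero_snd, h, h, neg_zero]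
  smul_mem' := by
    intro c u hu φ φ' hφ hd
    have h1 := hu φ φ' hφ hd
    rw [WithLp.smul_fst, WithLp.smul_snd, integral_smul_mul, integral_smul_mul, h1]
    ring

/-- The Sobolev space `H¹(S¹)`, realised as the space of pairs `(f, f_x)` in `L² × L²`,
with the norm `(‖f‖² + ‖f_x‖²)^(1/2)`. -/
abbrev H1 : Type := graphDx

/-- The function underlying an element of `H¹(S¹)`. -/
def H1.fn (u : H1) : L2 := (u : WithLp 2 (L2 × L2)).fst

/-- The derivative `u_x` of an element of `H¹(S¹)`. -/
def H1.dx (u : H1) : L2 := (u : WithLp 2 (L2 × L2)).snd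

/-- The Hilbert transform integral on the circle with `{|y| < ε}` removed:
`(1/2π) ∫_{ε ≤ |y| ≤ π} f(x - y) cot(y/2) dy`. -/
def truncHilbert (f : L2) (ε : ℝ) (x : Circ) : ℝ :=
  (1 / (2 * Real.pi)) *
    ∫ y in Icc (-Real.pi) Real.pi \ Ioo (-ε) ε, f (x - (y : Circ)) * Real.cot (y / 2)

/-- `g = H f`, where `H f (x) = (1/2π) P.V. ∫ f(y) cot((x - y)/2) dy` for almost every `x`. -/
def IsHilbertTransform (f g : L2) : Prop :=
  ∀ᵐ x : Circ, Tendsto (fun ε => truncHilbert f ε x) (𝓝[>] 0) (𝓝 (g x))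

/-- `p` is the potential of `f`: `p_x = H f` and `∫ p dx = 0`. -/
structure IsPotential (p : H1) (f : L2) : Prop where
  dx_eq : IsHilbertTransform f p.dx
  mean_zero : ∫ x, p.fn x = 0

/-- `(Ω, ω)` is a solution on `[0,T)` with data `(Ω₀, ω₀)` in
`C⁰([0,T); H¹) ∩ C¹([0,T); L²)` of
`Ω_t + a m Ω_x - ω p_x = 0`, `ω_t + a p ω_x - Ω m_x = 0`, `p_x = H Ω`, `m_x = H ω`,
`∫ p = ∫ m = 0`. The two evolution equations are identities in `L²(S¹)` for every time `t`;
time derivatives are taken in `L²(S¹)` (one-sided at `t = 0`). -/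
structure IsSolution (a T : ℝ) (Ω₀ ω₀ : H1) (Ω ω : ℝ → H1) : Prop where
  init_Ω : Ω 0 = Ω₀
  init_ω : ω 0 = ω₀
  cont_Ω : ContinuousOn Ω (Ico 0 T)
  cont_ω : ContinuousOn ω (Ico 0 T)
  contDiff_Ω : ContDiffOn ℝ 1 (fun t => (Ω t).fn) (Ico 0 T)
  contDiff_ω : ContDiffOn ℝ 1 (fun t => (ω t).fn) (Ico 0 T)
  equation : ∀ t ∈ Ico 0 T, ∃ p m : H1,
    IsPotential p (Ω t).fn ∧ IsPotential m (ω t).fn ∧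
    (∀ᵐ x : Circ, derivWithin (fun s => (Ω s).fn) (Ico 0 T) t x
      + a * m.fn x * (Ω t).dx x - (ω t).fn x * p.dx x = 0) ∧
    (∀ᵐ x : Circ, derivWithin (fun s => (ω s).fn) (Ico 0 T) t x
      + a * p.fn x * (ω t).dx x - (Ω t).fn x * m.dx x = 0)

end MHD1D

end

/-! Both equations have the form `u_t = N(u,v)`, `v_t = N(v,u)` with `N(u,v) = -a m u_x + v H u` and
`m_x = H v` (`nonlin`). `N` loses one derivative, but only in a transport term, where integration by
parts recovers it.

The decisive estimate is `|⟨u_x, N(u,v)_x⟩| ≤ K ‖v_x‖ ‖u_x‖²` (`abs_inner_dx_nonlin_le`), with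
homogeneous norms only. The transport term leaves `H v`, which has mean zero and hence sup norm at
most `S ‖v_x‖`. In `v H u_x` the mean of `v` contributes nothing, since `H` is skew-adjoint. So `y =
‖u_x‖² + ‖v_x‖²` satisfies `y' ≤ 2 K y^(3/2)`, and the existence time depends on `‖u_x‖`, `‖v_x‖` at
time `0` alone. The same cancellations bound differences of solutions in `L²`
(`inner_nonlin_sub_le`).

Existence is by Galerkin truncation (`exists_galerkin`). The notion `ApproxSol` at level `n` covers
truncated and genuine solutions at once: an `H¹` bound and the equations for the coefficients of
index at most `n`. Two of these with the same low-frequency data differ in squared `L²` norm by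
`O(1/n)` (`ApproxSol.stability`). This one estimate gives both convergence of the truncations and
uniqueness. Tested against a fixed basis function, `N` is continuous in `L²` (`coef_nonlin`), so the
limit is a weak solution, bounded in `H¹`.

Strong continuity in `H¹` comes from weak continuity together with upper semicontinuity of the
energy. By uniqueness, a weak solution restarted at any time, forwards or backwards, is the
constructed one, so it obeys the energy bound from that time (`ApproxSol.eventually_energy_le`).
Then `N(u,v)` is continuous in `L²` and the equation holds there. For data in `H¹` the principal
value equals the Fourier multiplier (`isHilbertTransform_iff`), which connects all this with the
stated system. -/

noncomputable section

namespace MHD1D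

/-! ### A real orthonormal basis of `L²` on the circle -/

/-- The Hartley functions `x ↦ (cos kx + sin kx) / √(2π)`. -/
def hartley (k : ℤ) : C(Circ, ℝ) where
  toFun x := ((fourier k x).re + (fourier k x).im) / √(2 * Real.pi)
  continuous_toFun := by fun_prop

theorem fourier_coe_re (k : ℤ) (x : ℝ) :
    (fourier k (x : Circ)).re = Real.cos (k * x) := by
  rw [fourier_coe_apply]
  have : 2 * (Real.pi : ℂ) * Complex.I * k * x / ((2 * Real.pi : ℝ) : ℂ)
      = ((k * x : ℝ) : ℂ) * Complex.I := by
    have : (Real.pi : ℂ) ≠ 0 := by exact_mod_cast Real.pi_ne_zero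
    push_cast; field_simp
  rw [this, Complex.exp_ofReal_mul_I_re]

theorem fourier_coe_im (k : ℤ) (x : ℝ) :
    (fourier k (x : Circ)).im = Real.sin (k * x) := by
  rw [fourier_coe_apply]
  have : 2 * (Real.pi : ℂ) * Complex.I * k * x / ((2 * Real.pi : ℝ) : ℂ)
      = ((k * x : ℝ) : ℂ) * Complex.I := by
    have : (Real.pi : ℂ) ≠ 0 := by exact_mod_cast Real.pi_ne_zero
    push_cast; field_simp
  rw [this, Complex.exp_ofReal_mul_I_im]

theorem hartley_coe (k : ℤ) (x : ℝ) :
    hartley k (x : Circ) = (Real.cos (k * x) + Real.sin (k * x)) / √(2 * Real.pi) := by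
  rw [← fourier_coe_re, ← fourier_coe_im]; rfl

theorem norm_hartley_le (k : ℤ) : ‖hartley k‖ ≤ 1 := by
  refine (ContinuousMap.norm_le _ zero_le_one).2 fun x => ?_
  induction x using QuotientAddGroup.induction_on with
  | H x =>
    have h := hartley_coe k x
    change ‖hartley k (x : Circ)‖ ≤ 1
    rw [h, Real.norm_eq_abs, abs_div, abs_of_nonneg (Real.sqrt_nonneg _),
      div_le_one (by positivity)]
    have h4 : 2 ≤ √(2 * Real.pi) := by
      apply Real.le_sqrt_of_sq_le
      nlinarith [Real.pi_gt_three]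
    have := Real.abs_cos_le_one (k * x)
    have := Real.abs_sin_le_one (k * x)
    have := abs_add_le (Real.cos (k * x)) (Real.sin (k * x))
    linarith

/-- The reason for this basis: it is real, indexed by `ℤ`, and both `d/dx` and `H` act on it as a
scalar times the reflection `k ↦ -k`. -/
theorem hasDerivAt_hartley (k : ℤ) (x : ℝ) :
    HasDerivAt (fun y : ℝ => hartley k (y : Circ)) (k * hartley (-k) (x : Circ)) x := by
  simp only [hartley_coe]
  have h : HasDerivAt (fun y : ℝ => (k : ℝ) * y) k x := by
    simpa using (hasDerivAt_id x).const_mul (k : ℝ)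
  refine ((h.cos.add h.sin).div_const _).congr_deriv ?_
  push_cast
  rw [neg_mul (k : ℝ), Real.cos_neg, Real.sin_neg]
  ring

theorem contDiff_hartley (k : ℤ) :
    ContDiff ℝ (⊤ : ℕ∞) (fun x : ℝ => hartley k (x : Circ)) := by
  simp only [hartley_coe]
  fun_prop

theorem continuous_integrable (φ : C(Circ, ℝ)) : Integrable (fun x => φ x) :=
  φ.continuous.integrable_of_hasCompactSupport (HasCompactSupport.of_compactSpace _)

theorem integral_circ_eq (φ : Circ → ℝ) :
    ∫ x, φ x = ∫ x in (-Real.pi)..Real.pi, φ (x : Circ) := by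
  have := AddCircle.intervalIntegral_preimage (2 * Real.pi) (-Real.pi) φ
  rw [← this]; congr 1; ring

/-- The integral over the circle of a derivative vanishes. -/
theorem integral_deriv_eq_zero (φ φ' : C(Circ, ℝ))
    (h : ∀ x : ℝ, HasDerivAt (fun y : ℝ => φ (y : Circ)) (φ' (x : Circ)) x) :
    ∫ x, φ' x = 0 := by
  rw [integral_circ_eq, intervalIntegral.integral_eq_sub_of_hasDerivAt (fun x _ => h x)]
  · have : ((Real.pi : ℝ) : Circ) = ((-Real.pi : ℝ) : Circ) := by
      rw [← AddCircle.coe_add_period (2 * Real.pi) (-Real.pi)]; congr 1; ring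
    rw [this, sub_self]
  · apply Continuous.intervalIntegrable
    exact φ'.continuous.comp (AddCircle.continuous_mk' _)

theorem integral_cos_int {k : ℤ} (hk : k ≠ 0) :
    ∫ x in (-Real.pi)..Real.pi, Real.cos (k * x) = 0 := by
  have hk' : (k : ℝ) ≠ 0 := by exact_mod_cast hk
  rw [intervalIntegral.integral_comp_mul_left (fun x => Real.cos x) hk', integral_cos,
    mul_neg, Real.sin_neg, Real.sin_int_mul_pi]
  simp

theorem integral_sin_int (k : ℤ) :
    ∫ x in (-Real.pi)..Real.pi, Real.sin (k * x) = 0 := by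
  by_cases hk : k = 0
  · simp [hk]
  have hk' : (k : ℝ) ≠ 0 := by exact_mod_cast hk
  rw [intervalIntegral.integral_comp_mul_left (fun x => Real.sin x) hk', integral_sin,
    mul_neg, Real.cos_neg]
  simp

theorem integral_hartley_mul (j k : ℤ) :
    ∫ x, hartley j x * hartley k x = if j = k then 1 else 0 := by
  rw [integral_circ_eq]
  have h : ∀ x : ℝ, hartley j (x : Circ) * hartley k (x : Circ)
      = (2 * Real.pi)⁻¹ * (Real.cos ((j - k : ℤ) * x) + Real.sin ((j + k : ℤ) * x)) := by
    intro x
    rw [hartley_coe, hartley_coe, div_mul_div_comm, Real.mul_self_sqrt Real.two_pi_pos.le]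
    push_cast
    rw [sub_mul, add_mul (j : ℝ), Real.cos_sub, Real.sin_add]
    field_simp; ring
  simp only [h]
  rw [intervalIntegral.integral_const_mul, intervalIntegral.integral_add
    (Continuous.intervalIntegrable (by fun_prop) _ _)
    (Continuous.intervalIntegrable (by fun_prop) _ _), integral_sin_int]
  split_ifs with hjk
  · subst hjk
    simp; field_simp; ring
  · rw [integral_cos_int (sub_ne_zero.2 hjk)]; simp

/-- The class in `L²` of a continuous function. -/
abbrev toL2 : C(Circ, ℝ) →L[ℝ] L2 := ContinuousMap.toLp 2 volume ℝ

theorem coeFn_toL2 (φ : C(Circ, ℝ)) : (toL2 φ : Circ → ℝ) =ᵐ[volume] φ :=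
  ContinuousMap.coeFn_toLp _ _

theorem inner_toL2_right (f : L2) (φ : C(Circ, ℝ)) : inner ℝ f (toL2 φ) = ∫ x, f x * φ x := by
  rw [L2.inner_def]
  refine integral_congr_ae ?_
  filter_upwards [coeFn_toL2 φ] with x hx
  rw [hx]; simp [mul_comm]

theorem inner_toL2_left (f : L2) (φ : C(Circ, ℝ)) : inner ℝ (toL2 φ) f = ∫ x, f x * φ x := by
  rw [real_inner_comm, inner_toL2_right]

theorem integral_toL2_mul (φ ψ : C(Circ, ℝ)) : ∫ x, toL2 φ x * ψ x = ∫ x, φ x * ψ x := by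
  refine integral_congr_ae ?_
  filter_upwards [coeFn_toL2 φ] with x hx
  rw [hx]

theorem orthonormal_hartley : Orthonormal ℝ (fun k => toL2 (hartley k)) := by
  rw [orthonormal_iff_ite]
  intro j k
  rw [inner_toL2_right, integral_toL2_mul, integral_hartley_mul]

/-- The real-linear map taking a complex function to its real part. -/
def reC : C(Circ, ℂ) →L[ℝ] C(Circ, ℝ) :=
  Complex.reCLM.compLeftContinuous ℝ Circ

def imC : C(Circ, ℂ) →L[ℝ] C(Circ, ℝ) :=
  Complex.imCLM.compLeftContinuous ℝ Circ

theorem fourier_re_im_eq (k : ℤ) :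
    reC (fourier k) = (√(2 * Real.pi) / 2) • (hartley k + hartley (-k)) ∧
    imC (fourier k) = (√(2 * Real.pi) / 2) • (hartley k - hartley (-k)) := by
  have hne : √(2 * Real.pi) ≠ 0 := by positivity
  have h2 : ∀ x : ℝ, hartley (-k) (x : Circ)
      = (Real.cos (k * x) - Real.sin (k * x)) / √(2 * Real.pi) := by
    intro x
    rw [hartley_coe]
    push_cast
    rw [neg_mul, Real.cos_neg, Real.sin_neg, sub_eq_add_neg]
  constructor
  · ext x
    induction x using QuotientAddGroup.induction_on with
    | H x =>
      change (fourier k (x : Circ)).re = (√(2 * Real.pi) / 2) *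
            (hartley k (x : Circ) + hartley (-k) (x : Circ))
      rw [hartley_coe, h2, fourier_coe_re]
      field_simp; ring
  · ext x
    induction x using QuotientAddGroup.induction_on with
    | H x =>
      change (fourier k (x : Circ)).im = (√(2 * Real.pi) / 2) *
            (hartley k (x : Circ) - hartley (-k) (x : Circ))
      rw [hartley_coe, h2, fourier_coe_im]
      field_simp; ring

/-- Real and imaginary parts of complex trigonometric polynomials lie in the real span of the
Hartley functions, so uniform density over `ℂ` descends by taking real parts. -/
theorem dense_span_hartley : (Submodule.span ℝ (range hartley)).topologicalClosure = ⊤ := by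
  set V := Submodule.span ℝ (range hartley) with hV
  have hmem : ∀ k, hartley k ∈ V := fun k => Submodule.subset_span ⟨k, rfl⟩
  have key : ∀ p ∈ Submodule.span ℂ (range (fourier (T := 2 * Real.pi))),
      reC p ∈ V ∧ imC p ∈ V := by
    intro p hp
    induction hp using Submodule.span_induction with
    | mem p hp =>
      obtain ⟨k, rfl⟩ := hp
      rw [(fourier_re_im_eq k).1, (fourier_re_im_eq k).2]
      exact ⟨V.smul_mem _ (V.add_mem (hmem _) (hmem _)), V.smul_mem _ (V.sub_mem (hmem _) (hmem _))⟩
    | zero => simp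
    | add p q _ _ hp hq =>
      rw [map_add, map_add]
      exact ⟨V.add_mem hp.1 hq.1, V.add_mem hp.2 hq.2⟩
    | smul c p _ hp =>
      have h1 : reC (c • p) = c.re • reC p - c.im • imC p := by
        ext x; simp [reC, imC]
      have h2 : imC (c • p) = c.re • imC p + c.im • reC p := by
        ext x; simp [reC, imC]
      rw [h1, h2]
      exact ⟨V.sub_mem (V.smul_mem _ hp.1) (V.smul_mem _ hp.2),
        V.add_mem (V.smul_mem _ hp.2) (V.smul_mem _ hp.1)⟩
  rw [eq_top_iff]
  intro φ _
  let Φ : C(Circ, ℂ) := ⟨fun x => (φ x : ℂ), by fun_prop⟩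
  have hΦ : reC Φ = φ := by ext x; simp [reC, Φ]
  have hcl : Φ ∈ closure ((Submodule.span ℂ (range (fourier (T := 2 * Real.pi))) :
      Submodule ℂ _) : Set C(Circ, ℂ)) := by
    have := span_fourier_closure_eq_top (T := 2 * Real.pi)
    rw [← Submodule.topologicalClosure_coe, this]; trivial
  rw [← hΦ]
  exact map_mem_closure reC.continuous hcl fun p hp => (key p hp).1

/-- The Hilbert basis of `L²(S¹)` formed by the Hartley functions. -/
def hartleyBasis : HilbertBasis ℤ ℝ L2 :=
  HilbertBasis.mk orthonormal_hartley (by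
    have h := (ContinuousMap.toLp_denseRange ℝ (volume : Measure Circ) ℝ
      (p := 2) (by norm_num)).topologicalClosure_map_submodule dense_span_hartley
    rw [← h, Submodule.map_span, ← range_comp]
    rfl)

@[simp] theorem hartleyBasis_apply (k : ℤ) : hartleyBasis k = toL2 (hartley k) := by
  rw [hartleyBasis, HilbertBasis.coe_mk]

/-- The Hartley coefficients of an `L²` function. -/
def coef (k : ℤ) : L2 →L[ℝ] ℝ := innerSL ℝ (toL2 (hartley k))

theorem coef_eq_inner (k : ℤ) (f : L2) : coef k f = inner ℝ (toL2 (hartley k)) f := rfl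

theorem coef_eq_integral (k : ℤ) (f : L2) : coef k f = ∫ x, f x * hartley k x := by
  rw [coef_eq_inner, inner_toL2_left]

theorem hartleyBasis_repr (f : L2) (k : ℤ) : hartleyBasis.repr f k = coef k f := by
  rw [HilbertBasis.repr_apply_apply, hartleyBasis_apply]; rfl

theorem ext_coef {f g : L2} (h : ∀ k, coef k f = coef k g) : f = g := by
  apply hartleyBasis.repr.injective
  ext k
  rw [hartleyBasis_repr, hartleyBasis_repr, h]

theorem hasSum_coef (f : L2) : HasSum (fun k => coef k f • toL2 (hartley k)) f := by
  simpa only [hartleyBasis_repr, hartleyBasis_apply] using hartleyBasis.hasSum_repr f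

theorem hasSum_inner (f g : L2) : HasSum (fun k => coef k f * coef k g) (inner ℝ f g) := by
  have := hartleyBasis.hasSum_inner_mul_inner f g
  simpa only [hartleyBasis_apply, ← coef_eq_inner, real_inner_comm _ f] using this

theorem hasSum_coef_sq (f : L2) : HasSum (fun k => coef k f ^ 2) (‖f‖ ^ 2) := by
  have := hasSum_inner f f
  simpa only [real_inner_self_eq_norm_sq, ← pow_two] using this

theorem coef_hartley (j k : ℤ) : coef j (toL2 (hartley k)) = if j = k then 1 else 0 := by
  rw [coef_eq_inner]
  exact (orthonormal_iff_ite.1 orthonormal_hartley) j k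

theorem exists_coef_eq {s : ℤ → ℝ} (hs : Summable fun k => s k ^ 2) :
    ∃ f : L2, ∀ k, coef k f = s k := by
  have hm : Memℓp s 2 := by
    rw [memℓp_gen_iff (by norm_num)]
    simpa using hs
  refine ⟨hartleyBasis.repr.symm ⟨s, hm⟩, fun k => ?_⟩
  rw [← hartleyBasis_repr, LinearIsometryEquiv.apply_symm_apply]

/-! ### Fourier multipliers: Hilbert transform, antiderivative, projections -/

theorem summable_multiplier {c : ℤ → ℝ} {K : ℝ} (hc : ∀ k, |c k| ≤ K) (σ : ℤ ≃ ℤ) (f : L2) :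
    Summable fun k => (c k * coef (σ k) f) ^ 2 := by
  have h1 : Summable fun k => K ^ 2 * coef (σ k) f ^ 2 :=
    ((σ.summable_iff.2 (hasSum_coef_sq f).summable)).mul_left _
  refine h1.of_nonneg_of_le (fun k => sq_nonneg _) fun k => ?_
  rw [mul_pow]
  exact mul_le_mul_of_nonneg_right (sq_le_sq' (abs_le.1 (hc k)).1 (abs_le.1 (hc k)).2)
    (sq_nonneg _)

/-- The bounded operator on `L²(S¹)` which acts on Hartley coefficients by
`f ↦ (c k * f (σ k))ₖ`. -/
def multiplier (c : ℤ → ℝ) (σ : ℤ ≃ ℤ) (K : ℝ) (hc : ∀ k, |c k| ≤ K) : L2 →L[ℝ] L2 :=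
  LinearMap.mkContinuous
    { toFun := fun f => (exists_coef_eq (summable_multiplier hc σ f)).choose
      map_add' := fun f g => ext_coef fun k => by
        rw [map_add, (exists_coef_eq (summable_multiplier hc σ (f + g))).choose_spec,
          (exists_coef_eq (summable_multiplier hc σ f)).choose_spec,
          (exists_coef_eq (summable_multiplier hc σ g)).choose_spec, map_add, mul_add]
      map_smul' := fun r f => ext_coef fun k => by
        rw [map_smul, (exists_coef_eq (summable_multiplier hc σ (r • f))).choose_spec,
          (exists_coef_eq (summable_multiplier hc σ f)).choose_spec, map_smul]
        simp only [smul_eq_mul, RingHom.id_apply]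
        ring }
    K (fun f => by
      have hK : 0 ≤ K := (abs_nonneg _).trans (hc 0)
      have hs := (exists_coef_eq (summable_multiplier hc σ f)).choose_spec
      set g := (exists_coef_eq (summable_multiplier hc σ f)).choose
      change ‖g‖ ≤ K * ‖f‖
      refine le_of_sq_le_sq ?_ (by positivity)
      have h1 : HasSum (fun k => K ^ 2 * coef (σ k) f ^ 2) (K ^ 2 * ‖f‖ ^ 2) :=
        (σ.hasSum_iff.2 (hasSum_coef_sq f)).mul_left _
      rw [mul_pow]
      refine hasSum_le (fun k => ?_) (hasSum_coef_sq g) h1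
      rw [hs, mul_pow]
      exact mul_le_mul_of_nonneg_right (sq_le_sq' (abs_le.1 (hc k)).1 (abs_le.1 (hc k)).2)
        (sq_nonneg _))

theorem coef_multiplier (c : ℤ → ℝ) (σ : ℤ ≃ ℤ) (K : ℝ) (hc : ∀ k, |c k| ≤ K) (f : L2) (k : ℤ) :
    coef k (multiplier c σ K hc f) = c k * coef (σ k) f :=
  (exists_coef_eq (summable_multiplier hc σ f)).choose_spec k

theorem norm_multiplier_le (c : ℤ → ℝ) (σ : ℤ ≃ ℤ) (K : ℝ) (hc : ∀ k, |c k| ≤ K) (f : L2) :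
    ‖multiplier c σ K hc f‖ ≤ K * ‖f‖ :=
  (ContinuousLinearMap.le_of_opNorm_le _
    (LinearMap.mkContinuous_norm_le _ ((abs_nonneg _).trans (hc 0)) _) f)

/-- The Hilbert transform as a Fourier multiplier. -/
def hilbert : L2 →L[ℝ] L2 :=
  multiplier (fun k => (k.sign : ℝ)) (Equiv.neg ℤ) 1 fun k => by
    rcases lt_trichotomy k 0 with h | h | h <;> simp [h, Int.sign_eq_neg_one_of_neg,
      Int.sign_eq_one_of_pos]

theorem coef_hilbert (f : L2) (k : ℤ) : coef k (hilbert f) = k.sign * coef (-k) f :=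
  coef_multiplier _ _ _ _ _ _

theorem norm_hilbert_le (f : L2) : ‖hilbert f‖ ≤ ‖f‖ :=
  (norm_multiplier_le _ _ _ _ f).trans_eq (one_mul _)

/-- The mean-zero antiderivative of the mean-zero part of a function. -/
def antideriv : L2 →L[ℝ] L2 :=
  multiplier (fun k => (k : ℝ)⁻¹) (Equiv.neg ℤ) 1 fun k => by
    by_cases h : k = 0
    · simp [h]
    · rw [abs_inv]
      apply inv_le_one_of_one_le₀
      exact_mod_cast Int.one_le_abs h

theorem coef_antideriv (f : L2) (k : ℤ) : coef k (antideriv f) = (k : ℝ)⁻¹ * coef (-k) f :=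
  coef_multiplier _ _ _ _ _ _

/-- The orthogonal projection onto trigonometric polynomials of degree at most `n`. -/
def proj (n : ℕ) : L2 →L[ℝ] L2 :=
  multiplier (fun k => if |k| ≤ n then 1 else 0) (Equiv.refl ℤ) 1 fun k => by
    split_ifs <;> simp

theorem coef_proj (n : ℕ) (f : L2) (k : ℤ) :
    coef k (proj n f) = if |k| ≤ n then coef k f else 0 := by
  rw [proj, coef_multiplier]; split_ifs <;> simp

theorem norm_proj_le (n : ℕ) (f : L2) : ‖proj n f‖ ≤ ‖f‖ :=
  (norm_multiplier_le _ _ _ _ f).trans_eq (one_mul _)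

/-- The derivative of the projection onto trigonometric polynomials of degree at most `n`. -/
def derivProj (n : ℕ) : L2 →L[ℝ] L2 :=
  multiplier (fun k => if |k| ≤ n then -(k : ℝ) else 0) (Equiv.neg ℤ) n fun k => by
    split_ifs with h
    · rw [abs_neg]; exact_mod_cast h
    · simp

theorem coef_derivProj (n : ℕ) (f : L2) (k : ℤ) :
    coef k (derivProj n f) = if |k| ≤ n then -(k : ℝ) * coef (-k) f else 0 := by
  rw [derivProj, coef_multiplier]; split_ifs <;> simp

/-- Parseval, reindexed by `k ↦ -k`: the sign is odd. -/
theorem inner_hilbert (f g : L2) : inner ℝ (hilbert f) g = -inner ℝ f (hilbert g) := by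
  refine (hasSum_inner (hilbert f) g).unique ?_
  have := ((Equiv.neg ℤ).hasSum_iff.2 (hasSum_inner f (hilbert g))).neg
  refine this.congr_fun fun k => ?_
  simp only [Function.comp, Equiv.neg_apply, coef_hilbert, neg_neg, Int.sign_neg]
  push_cast; ring

/-- This cancellation keeps the mean of `v` out of the energy estimates. -/
theorem inner_hilbert_self (f : L2) : inner ℝ f (hilbert f) = 0 := by
  have := inner_hilbert f f
  rw [real_inner_comm] at this
  linarith

theorem inner_proj (n : ℕ) (f g : L2) : inner ℝ (proj n f) g = inner ℝ f (proj n g) := by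
  refine (hasSum_inner (proj n f) g).unique ?_
  refine (hasSum_inner f (proj n g)).congr_fun fun k => ?_
  simp only [coef_proj]; split_ifs <;> simp

theorem inner_derivProj (n : ℕ) (f g : L2) :
    inner ℝ (derivProj n f) g = -inner ℝ f (derivProj n g) := by
  refine (hasSum_inner (derivProj n f) g).unique ?_
  have := ((Equiv.neg ℤ).hasSum_iff.2 (hasSum_inner f (derivProj n g))).neg
  refine this.congr_fun fun k => ?_
  simp only [Function.comp, Equiv.neg_apply, coef_derivProj, neg_neg, abs_neg]
  split_ifs
  · push_cast; ring
  · simp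

theorem proj_proj (n : ℕ) (f : L2) : proj n (proj n f) = proj n f :=
  ext_coef fun k => by simp only [coef_proj]; split_ifs <;> rfl

theorem proj_derivProj (n : ℕ) (f : L2) : proj n (derivProj n f) = derivProj n f :=
  ext_coef fun k => by simp only [coef_proj, coef_derivProj]; split_ifs <;> rfl

theorem derivProj_proj (n : ℕ) (f : L2) : derivProj n (proj n f) = derivProj n f :=
  ext_coef fun k => by simp only [coef_proj, coef_derivProj, abs_neg]; split_ifs <;> rfl

/-! ### Antiderivatives as continuous functions -/

theorem summable_inv_sq : Summable fun k : ℤ => ((k : ℝ)⁻¹) ^ 2 := by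
  simpa using Real.summable_one_div_int_pow.2 (le_refl 2)

/-- The constant `(∑ k⁻²)^(1/2)`. -/
def sobolevConst : ℝ := √(∑' k : ℤ, ((k : ℝ)⁻¹) ^ 2)

theorem sobolevConst_nonneg : 0 ≤ sobolevConst := Real.sqrt_nonneg _

/-- Cauchy–Schwarz between `1/k` and the coefficients. Since `0⁻¹ = 0`, the mean drops out; this is
the Sobolev bound of a mean-zero function by its homogeneous norm. -/
theorem sum_antideriv_le (g : L2) (s : Finset ℤ) :
    ∑ k ∈ s, ‖((k : ℝ)⁻¹ * coef (-k) g) • hartley k‖ ≤ sobolevConst * ‖g‖ := by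
  calc ∑ k ∈ s, ‖((k : ℝ)⁻¹ * coef (-k) g) • hartley k‖
      ≤ ∑ k ∈ s, |(k : ℝ)⁻¹| * |coef (-k) g| := by
        refine Finset.sum_le_sum fun k _ => ?_
        rw [norm_smul, Real.norm_eq_abs, abs_mul]
        exact mul_le_of_le_one_right (by positivity) (norm_hartley_le k)
    _ ≤ √(∑ k ∈ s, |(k : ℝ)⁻¹| ^ 2) * √(∑ k ∈ s, |coef (-k) g| ^ 2) :=
        Real.sum_mul_le_sqrt_mul_sqrt _ _ _
    _ ≤ sobolevConst * ‖g‖ := by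
        simp only [sq_abs]
        refine mul_le_mul (Real.sqrt_le_sqrt ?_) (Real.sqrt_le_iff.2 ⟨norm_nonneg _, ?_⟩)
          (Real.sqrt_nonneg _) sobolevConst_nonneg
        · exact summable_inv_sq.sum_le_tsum _ fun _ _ => sq_nonneg _
        · exact sum_le_hasSum s (fun _ _ => sq_nonneg _)
            ((Equiv.neg ℤ).hasSum_iff.2 (hasSum_coef_sq g))

theorem summable_antideriv (g : L2) :
    Summable fun k : ℤ => ((k : ℝ)⁻¹ * coef (-k) g) • hartley k :=
  (summable_of_sum_le (fun _ => norm_nonneg _) (sum_antideriv_le g)).of_norm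

/-- The mean-zero antiderivative as a continuous function. -/
def antiderivC : L2 →L[ℝ] C(Circ, ℝ) :=
  LinearMap.mkContinuous
    { toFun := fun g => ∑' k : ℤ, ((k : ℝ)⁻¹ * coef (-k) g) • hartley k
      map_add' := fun f g => by
        rw [← (summable_antideriv f).tsum_add (summable_antideriv g)]
        simp only [map_add, mul_add, add_smul]
      map_smul' := fun r g => by
        rw [RingHom.id_apply, ← (summable_antideriv g).tsum_const_smul r]
        refine tsum_congr fun k => ?_
        rw [map_smul, smul_smul, smul_eq_mul]
        congr 1; ring }
    sobolevConst (fun g => by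
      have hs := summable_of_sum_le (fun _ => norm_nonneg _) (sum_antideriv_le g)
      exact (norm_tsum_le_tsum_norm hs).trans (hs.tsum_le_of_sum_le (sum_antideriv_le g)))

theorem hasSum_antiderivC (g : L2) :
    HasSum (fun k : ℤ => ((k : ℝ)⁻¹ * coef (-k) g) • hartley k) (antiderivC g) :=
  (summable_antideriv g).hasSum

theorem norm_antiderivC_le (g : L2) : ‖antiderivC g‖ ≤ sobolevConst * ‖g‖ :=
  (ContinuousLinearMap.le_of_opNorm_le _
    (LinearMap.mkContinuous_norm_le _ sobolevConst_nonneg _) g)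

theorem toL2_antiderivC (g : L2) : toL2 (antiderivC g) = antideriv g := by
  refine ext_coef fun k => ?_
  have h := ((coef k).comp toL2).hasSum (hasSum_antiderivC g)
  refine h.unique ?_
  rw [coef_antideriv]
  convert hasSum_ite_eq k ((k : ℝ)⁻¹ * coef (-k) g) using 2 with j
  simp only [ContinuousLinearMap.comp_apply, map_smul, coef_hartley, smul_eq_mul]
  by_cases h : j = k
  · subst h; simp
  · simp [h, Ne.symm h]

/-! ### The Sobolev space -/

/-- The derivative of `φ * hartley k` integrates to zero. -/
theorem coef_weakDeriv {φ φ' : C(Circ, ℝ)}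
    (h : ∀ x : ℝ, HasDerivAt (fun y : ℝ => φ (y : Circ)) (φ' (x : Circ)) x) (k : ℤ) :
    coef k (toL2 φ') = -(k : ℝ) * coef (-k) (toL2 φ) := by
  have h1 := integral_deriv_eq_zero (φ * hartley k)
    (φ' * hartley k + φ * ((k : ℝ) • hartley (-k)))
    (fun x => (h x).mul (hasDerivAt_hartley k x))
  have h2 : ∫ x, (φ' * hartley k + φ * ((k : ℝ) • hartley (-k))) x
      = (∫ x, (φ' * hartley k) x) + ∫ x, (φ * ((k : ℝ) • hartley (-k))) x :=
    integral_add (continuous_integrable _) (continuous_integrable _)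
  have h3 : ∫ x, (φ * ((k : ℝ) • hartley (-k))) x = k * ∫ x, φ x * hartley (-k) x := by
    rw [← integral_const_mul]
    refine integral_congr_ae (Eventually.of_forall fun x => ?_)
    simp
  rw [coef_eq_integral, coef_eq_integral, integral_toL2_mul, integral_toL2_mul]
  rw [h2, h3] at h1
  simp only [ContinuousMap.mul_apply] at h1
  linarith

/-- Hartley functions are admissible tests, which gives one direction; Parseval gives the other.
From here on weak derivatives are handled through coefficients. -/
theorem hasWeakDeriv_iff {f g : L2} :
    HasWeakDeriv f g ↔ ∀ k, coef k g = -(k : ℝ) * coef (-k) f := by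
  constructor
  · intro h k
    have := h (hartley k) ((k : ℝ) • hartley (-k)) (contDiff_hartley k) (hasDerivAt_hartley k)
    rw [← coef_eq_integral] at this
    have h2 : ∫ x, f x * ((k : ℝ) • hartley (-k)) x = k * ∫ x, f x * hartley (-k) x := by
      rw [← integral_const_mul]
      refine integral_congr_ae (Eventually.of_forall fun x => ?_)
      simp; ring
    rw [h2, ← coef_eq_integral] at this
    linarith
  · intro h φ φ' _ hd
    rw [← inner_toL2_right, ← inner_toL2_right]
    refine (hasSum_inner f (toL2 φ')).unique ?_
    have h1 := ((Equiv.neg ℤ).hasSum_iff.2 (hasSum_inner g (toL2 φ))).neg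
    refine h1.congr_fun fun k => ?_
    simp only [Function.comp, Equiv.neg_apply, h, coef_weakDeriv hd, neg_neg]
    push_cast; ring

theorem H1.coef_dx (u : H1) (k : ℤ) : coef k u.dx = -(k : ℝ) * coef (-k) u.fn :=
  hasWeakDeriv_iff.1 u.2 k

/-- The element of `H¹` with given function and derivative. -/
def H1.mk (f g : L2) (h : ∀ k, coef k g = -(k : ℝ) * coef (-k) f) : H1 :=
  ⟨WithLp.toLp 2 (f, g), hasWeakDeriv_iff.2 h⟩

@[simp] theorem H1.mk_fn (f g : L2) (h) : (H1.mk f g h).fn = f := rfl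
@[simp] theorem H1.mk_dx (f g : L2) (h) : (H1.mk f g h).dx = g := rfl

theorem H1.norm_sq (u : H1) : ‖u‖ ^ 2 = ‖u.fn‖ ^ 2 + ‖u.dx‖ ^ 2 :=
  WithLp.prod_norm_sq_eq_of_L2 _

theorem H1.norm_fn_le (u : H1) : ‖u.fn‖ ≤ ‖u‖ :=
  le_of_sq_le_sq (by rw [u.norm_sq]; nlinarith [sq_nonneg ‖u.dx‖]) (norm_nonneg _)

theorem H1.norm_dx_le (u : H1) : ‖u.dx‖ ≤ ‖u‖ :=
  le_of_sq_le_sq (by rw [u.norm_sq]; nlinarith [sq_nonneg ‖u.fn‖]) (norm_nonneg _)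

theorem H1.norm_le (u : H1) : ‖u‖ ≤ ‖u.fn‖ + ‖u.dx‖ :=
  le_of_sq_le_sq (by rw [u.norm_sq]; nlinarith [norm_nonneg u.fn, norm_nonneg u.dx])
    (by positivity)

theorem H1.ext_fn {u v : H1} (h : u.fn = v.fn) : u = v := by
  have h2 : u.dx = v.dx := ext_coef fun k => by rw [H1.coef_dx, H1.coef_dx, h]
  apply Subtype.ext
  apply WithLp.ofLp_injective
  exact Prod.ext h h2

/-- `u ↦ u` from `H¹` to `L²`. -/
def H1.fnL : H1 →L[ℝ] L2 :=
  LinearMap.mkContinuous { toFun := H1.fn, map_add' := fun _ _ => rfl, map_smul' := fun _ _ => rfl }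
    1 fun u => u.norm_fn_le.trans_eq (one_mul _).symm

/-- `u ↦ u_x` from `H¹` to `L²`. -/
def H1.dxL : H1 →L[ℝ] L2 :=
  LinearMap.mkContinuous { toFun := H1.dx, map_add' := fun _ _ => rfl, map_smul' := fun _ _ => rfl }
    1 fun u => u.norm_dx_le.trans_eq (one_mul _).symm

@[simp] theorem H1.fnL_apply (u : H1) : H1.fnL u = u.fn := rfl
@[simp] theorem H1.dxL_apply (u : H1) : H1.dxL u = u.dx := rfl
theorem H1.sub_fn (u v : H1) : (u - v).fn = u.fn - v.fn := rfl
theorem H1.sub_dx (u v : H1) : (u - v).dx = u.dx - v.dx := rfl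
theorem H1.neg_fn (u : H1) : (-u).fn = -u.fn := rfl
theorem H1.neg_dx (u : H1) : (-u).dx = -u.dx := rfl

/-- The continuous representative of an element of `H¹`. -/
def H1.toC : H1 →L[ℝ] C(Circ, ℝ) :=
  ((coef 0).comp H1.fnL).smulRight (hartley 0) + antiderivC.comp H1.dxL

theorem H1.toC_apply (u : H1) : u.toC = coef 0 u.fn • hartley 0 + antiderivC u.dx := rfl

theorem H1.toL2_toC (u : H1) : toL2 u.toC = u.fn := by
  refine ext_coef fun k => ?_
  rw [H1.toC_apply, map_add, map_add, toL2_antiderivC, coef_antideriv, map_smul, map_smul,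
    coef_hartley, H1.coef_dx]
  by_cases h : k = 0
  · simp [h]
  · have : (k : ℝ) ≠ 0 := by exact_mod_cast h
    simp [h]

/-- Truncation to trigonometric polynomials of degree at most `n`, with values in `H¹`. -/
def trunc (n : ℕ) : L2 →L[ℝ] H1 :=
  LinearMap.mkContinuous
    { toFun := fun f => H1.mk (proj n f) (derivProj n f) fun k => by
        rw [coef_derivProj, coef_proj, abs_neg]; split_ifs <;> simp
      map_add' := fun f g => H1.ext_fn (map_add (proj n) f g)
      map_smul' := fun r f => H1.ext_fn (map_smul (proj n) r f) }
    (1 + ‖derivProj n‖) fun f => by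
      refine (H1.norm_le _).trans ?_
      rw [add_mul, one_mul]
      exact add_le_add (norm_proj_le n f) ((derivProj n).le_opNorm f)

@[simp] theorem trunc_fn (n : ℕ) (f : L2) : (trunc n f).fn = proj n f := rfl
@[simp] theorem trunc_dx (n : ℕ) (f : L2) : (trunc n f).dx = derivProj n f := rfl

theorem trunc_proj (n : ℕ) (f : L2) : trunc n (proj n f) = trunc n f :=
  H1.ext_fn (proj_proj n f)

theorem derivProj_fn (n : ℕ) (u : H1) : derivProj n u.fn = proj n u.dx :=
  ext_coef fun k => by rw [coef_derivProj, coef_proj, H1.coef_dx]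

theorem proj_eq_sum (n : ℕ) (f : L2) :
    proj n f = ∑ k ∈ Finset.Icc (-(n : ℤ)) n, coef k f • toL2 (hartley k) := by
  refine ext_coef fun k => ?_
  rw [coef_proj, map_sum]
  simp only [map_smul, coef_hartley, smul_eq_mul, mul_ite, mul_one, mul_zero]
  rw [Finset.sum_ite_eq]
  simp [abs_le]

theorem proj_tendsto (f : L2) : Tendsto (fun n => proj n f) atTop (𝓝 f) := by
  simp only [proj_eq_sum]
  refine (hasSum_coef f).comp ?_
  refine Filter.tendsto_atTop_finset_of_monotone (fun m n hmn => ?_) fun k => ?_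
  · exact Finset.Icc_subset_Icc (by simpa using hmn) (by simpa using hmn)
  · exact ⟨k.natAbs, by simp [← abs_le]⟩

theorem trunc_tendsto (u : H1) : Tendsto (fun n => trunc n u.fn) atTop (𝓝 u) := by
  have h1 := proj_tendsto u.fn
  have h2 := proj_tendsto u.dx
  rw [tendsto_iff_norm_sub_tendsto_zero] at h1 h2 ⊢
  refine squeeze_zero (fun _ => norm_nonneg _) (fun n => H1.norm_le _) ?_
  simpa only [H1.sub_fn, H1.sub_dx, trunc_fn, trunc_dx, derivProj_fn, add_zero] using h1.add h2

/-! ### Products -/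

/-- Multiplication of an `L²` function by a continuous function. -/
def mulL : C(Circ, ℝ) →L[ℝ] L2 →L[ℝ] L2 :=
  ((ContinuousLinearMap.mul ℝ ℝ).holderL volume ⊤ 2 2).comp (ContinuousMap.toLp ⊤ volume ℝ)

theorem coeFn_mulL (φ : C(Circ, ℝ)) (f : L2) : mulL φ f =ᵐ[volume] fun x => φ x * f x := by
  have h : mulL φ f = (ContinuousLinearMap.mul ℝ ℝ).holder 2
    (ContinuousMap.toLp ⊤ volume ℝ φ : Lp ℝ ⊤ (volume : Measure Circ)) f := rfl
  rw [h]
  filter_upwards [ContinuousLinearMap.coeFn_holder (r := 2) (ContinuousLinearMap.mul ℝ ℝ)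
    (ContinuousMap.toLp ⊤ volume ℝ φ : Lp ℝ ⊤ (volume : Measure Circ)) f,
    ContinuousMap.coeFn_toLp (p := ⊤) (𝕜 := ℝ) (volume : Measure Circ) φ] with x h1 h2
  rw [h1, h2]; rfl

theorem norm_mulL_le (φ : C(Circ, ℝ)) (f : L2) : ‖mulL φ f‖ ≤ ‖φ‖ * ‖f‖ := by
  refine Lp.norm_le_mul_norm_of_ae_le_mul ?_
  filter_upwards [coeFn_mulL φ f] with x hx
  rw [hx, norm_mul]
  exact mul_le_mul_of_nonneg_right (φ.norm_coe_le_norm x) (norm_nonneg _)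

theorem mulL_toL2 (φ ψ : C(Circ, ℝ)) : mulL φ (toL2 ψ) = toL2 (φ * ψ) := by
  apply Lp.ext
  filter_upwards [coeFn_mulL φ (toL2 ψ), coeFn_toL2 ψ, coeFn_toL2 (φ * ψ)] with x h1 h2 h3
  rw [h1, h2, h3]; rfl

theorem mulL_toL2_comm (φ ψ : C(Circ, ℝ)) : mulL φ (toL2 ψ) = mulL ψ (toL2 φ) := by
  rw [mulL_toL2, mulL_toL2, mul_comm φ]

theorem inner_mulL (φ : C(Circ, ℝ)) (f g : L2) :
    inner ℝ (mulL φ f) g = inner ℝ f (mulL φ g) := by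
  rw [L2.inner_def, L2.inner_def]
  refine integral_congr_ae ?_
  filter_upwards [coeFn_mulL φ f, coeFn_mulL φ g] with x h1 h2
  rw [h1, h2]; simp; ring

theorem mulL_hartley_zero (f : L2) :
    mulL (hartley 0) f = (1 / √(2 * Real.pi)) • f := by
  apply Lp.ext
  filter_upwards [coeFn_mulL (hartley 0) f, Lp.coeFn_smul (1 / √(2 * Real.pi)) f] with x h1 h2
  rw [h1, h2]
  simp [hartley]

/-! ### The product rule -/

/-- The basis elements of `H¹(S¹)`. -/
def hartleyH1 (k : ℤ) : H1 :=
  H1.mk (toL2 (hartley k)) ((k : ℝ) • toL2 (hartley (-k))) fun j => by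
    rw [map_smul, coef_hartley, coef_hartley]
    by_cases h : j = -k
    · subst h; simp
    · have : ¬ -j = k := fun h' => h (by omega)
      simp [h, this]

theorem toC_hartleyH1 (k : ℤ) : (hartleyH1 k).toC = hartley k := by
  have h : Function.Injective (toL2 : C(Circ, ℝ) → L2) :=
    ContinuousMap.toLp_injective (𝕜 := ℝ) volume
  apply h
  rw [H1.toL2_toC]; rfl

/-- Truncations are finite combinations of the `hartleyH1 k` and converge in the norm of `H¹`. -/
theorem H1.clm_ext {A B : H1 →L[ℝ] ℝ} (h : ∀ k, A (hartleyH1 k) = B (hartleyH1 k)) : A = B := by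
  ext u
  have key : ∀ n, A (trunc n u.fn) = B (trunc n u.fn) := by
    intro n
    have : trunc n u.fn = ∑ k ∈ Finset.Icc (-(n : ℤ)) n, coef k u.fn • hartleyH1 k := by
      apply H1.ext_fn
      rw [← H1.fnL_apply (Finset.sum _ _), map_sum]
      refine ext_coef fun k => ?_
      rw [map_sum]
      simp only [H1.fnL_apply, map_smul, trunc_fn, hartleyH1, H1.mk_fn, coef_proj, coef_hartley,
        smul_eq_mul, mul_ite, mul_one, mul_zero]
      rw [Finset.sum_ite_eq]
      simp [abs_le]
    rw [this, map_sum, map_sum]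
    simp only [map_smul, h]
  exact tendsto_nhds_unique ((A.continuous.tendsto _).comp (trunc_tendsto u))
    (((B.continuous.tendsto _).comp (trunc_tendsto u)).congr fun n => (key n).symm)

/-- `∫ (u v w)_x`, written out by the product rule. -/
def leibniz (u v w : H1) : ℝ :=
  inner ℝ w.dx (mulL u.toC v.fn) + inner ℝ w.fn (mulL v.toC u.dx)
    + inner ℝ w.fn (mulL u.toC v.dx)

theorem mulL_toC_comm (u v : H1) : mulL u.toC v.fn = mulL v.toC u.fn := by
  rw [← H1.toL2_toC v, ← H1.toL2_toC u, mulL_toL2_comm]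

theorem leibniz_comm (u v w : H1) : leibniz u v w = leibniz v u w := by
  rw [leibniz, leibniz, mulL_toC_comm u v]; ring

/-- Multiplication operators are self-adjoint, so the three arguments play equal roles. Any of them
can thus be brought into the last slot, where continuity is available. -/
theorem leibniz_rotate (u v w : H1) : leibniz u v w = leibniz w v u := by
  have h1 : inner ℝ w.dx (mulL u.toC v.fn) = inner ℝ u.fn (mulL v.toC w.dx) := by
    rw [mulL_toC_comm, real_inner_comm, inner_mulL]
  have h2 : inner ℝ w.fn (mulL v.toC u.dx) = inner ℝ u.dx (mulL w.toC v.fn) := by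
    rw [← inner_mulL, ← mulL_toC_comm, real_inner_comm]
  have h3 : inner ℝ w.fn (mulL u.toC v.dx) = inner ℝ u.fn (mulL w.toC v.dx) := by
    rw [← inner_mulL, ← inner_mulL, mulL_toC_comm]
  rw [leibniz, leibniz, h1, h2, h3]; ring

/-- `leibniz` as a continuous linear form in its last argument. -/
def leibnizL (u v : H1) : H1 →L[ℝ] ℝ :=
  (innerSL ℝ (mulL u.toC v.fn)).comp H1.dxL
    + (innerSL ℝ (mulL v.toC u.dx + mulL u.toC v.dx)).comp H1.fnL

theorem leibnizL_apply (u v w : H1) : leibnizL u v w = leibniz u v w := by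
  simp only [leibnizL, leibniz, add_apply, ContinuousLinearMap.comp_apply,
    innerSL_apply_apply, H1.fnL_apply, H1.dxL_apply, inner_add_left]
  rw [real_inner_comm, real_inner_comm w.fn, real_inner_comm w.fn, add_assoc]

/-- For smooth factors this is the integral of the derivative of a triple product. -/
theorem leibniz_hartley (i j k : ℤ) :
    leibniz (hartleyH1 i) (hartleyH1 j) (hartleyH1 k) = 0 := by
  have h := integral_deriv_eq_zero ((hartley i * hartley j) * hartley k)
    ((((i : ℝ) • hartley (-i)) * hartley j + hartley i * ((j : ℝ) • hartley (-j))) * hartley k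
      + (hartley i * hartley j) * ((k : ℝ) • hartley (-k)))
    (fun x => ((hasDerivAt_hartley i x).mul (hasDerivAt_hartley j x)).mul (hasDerivAt_hartley k x))
  have hint : ∀ φ ψ : C(Circ, ℝ), inner ℝ (toL2 φ) (toL2 ψ) = ∫ x, (φ * ψ) x := by
    intro φ ψ
    rw [inner_toL2_right, integral_toL2_mul]; rfl
  rw [leibniz, toC_hartleyH1, toC_hartleyH1]
  simp only [hartleyH1, H1.mk_fn, H1.mk_dx]
  simp only [← map_smul]
  rw [mulL_toL2, mulL_toL2, mulL_toL2, hint, hint, hint]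
  have hadd : ∀ φ ψ : C(Circ, ℝ), (∫ x, φ x) + ∫ x, ψ x = ∫ x, (φ + ψ) x := fun φ ψ =>
    (integral_add (continuous_integrable φ) (continuous_integrable ψ)).symm
  rw [hadd, hadd, ← h]
  refine integral_congr_ae (Eventually.of_forall fun x => ?_)
  simp only [ContinuousMap.add_apply, ContinuousMap.mul_apply]
  ring

/-- The product rule and integration by parts for three functions in `H¹(S¹)`. -/
theorem leibniz_eq_zero (u v w : H1) : leibniz u v w = 0 := by
  -- Basis functions are replaced by arbitrary elements of `H¹` one argument at a time.
  have h1 : ∀ i j, leibnizL (hartleyH1 i) (hartleyH1 j) = 0 := fun i j =>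
    H1.clm_ext fun k => by rw [leibnizL_apply, leibniz_hartley]; rfl
  have h2 : ∀ i (w : H1), leibnizL w (hartleyH1 i) = 0 := fun i w =>
    H1.clm_ext fun k => by
      rw [leibnizL_apply, leibniz_rotate, ← leibnizL_apply, h1]; rfl
  have h3 : ∀ v w : H1, leibnizL v w = 0 := fun v w =>
    H1.clm_ext fun k => by
      rw [leibnizL_apply, leibniz_comm, leibniz_rotate, leibniz_comm, ← leibnizL_apply, h2]; rfl
  rw [← leibnizL_apply, h3]; rfl

/-! ### The principal value integral -/

theorem H1.hasSum_toC (u : H1) : HasSum (fun k => coef k u.fn • hartley k) u.toC := by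
  have h := (hasSum_ite_eq (0 : ℤ) (coef 0 u.fn • hartley 0)).add (hasSum_antiderivC u.dx)
  rw [H1.toC_apply]
  refine h.congr_fun fun k => ?_
  rw [H1.coef_dx]
  by_cases hk : k = 0
  · simp [hk]
  · have : (k : ℝ) ≠ 0 := by exact_mod_cast hk
    simp [hk]

/-- The Hilbert transform on `H¹`. -/
def hilbertH1 (u : H1) : H1 :=
  H1.mk (hilbert u.fn) (hilbert u.dx) fun k => by
    rw [coef_hilbert, coef_hilbert, H1.coef_dx, neg_neg, Int.sign_neg]
    push_cast; ring

@[simp] theorem hilbertH1_fn (u : H1) : (hilbertH1 u).fn = hilbert u.fn := rfl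
@[simp] theorem hilbertH1_dx (u : H1) : (hilbertH1 u).dx = hilbert u.dx := rfl

/-- The domain of integration of the truncated Hilbert transform. -/
abbrev truncDomain (ε : ℝ) : Set ℝ := Icc (-Real.pi) Real.pi \ Ioo (-ε) ε

theorem measurableSet_truncDomain (ε : ℝ) : MeasurableSet (truncDomain ε) :=
  measurableSet_Icc.diff measurableSet_Ioo

theorem sin_half_lower {y : ℝ} (hy : |y| ≤ Real.pi) : |y| / Real.pi ≤ |Real.sin (y / 2)| := by
  have h : |Real.sin (y / 2)| = Real.sin (|y| / 2) := by
    rcases abs_cases y with ⟨h1, h2⟩ | ⟨h1, h2⟩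
    · rw [h1] at hy ⊢
      exact abs_of_nonneg (Real.sin_nonneg_of_nonneg_of_le_pi (by linarith) (by linarith))
    · rw [h1] at hy ⊢
      rw [neg_div, Real.sin_neg, abs_of_nonpos]
      exact Real.sin_nonpos_of_nonpos_of_neg_pi_le (by linarith) (by linarith)
  rw [h]
  refine le_trans (le_of_eq ?_) (Real.mul_le_sin (x := |y| / 2) (by positivity) (by linarith))
  field_simp

theorem abs_cot_half_le {y : ℝ} (hy : |y| ≤ Real.pi) : |Real.cot (y / 2)| ≤ Real.pi / |y| := by
  by_cases h0 : y = 0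
  · simp [h0, Real.cot_eq_cos_div_sin]
  have hpos : 0 < |y| := abs_pos.2 h0
  rw [Real.cot_eq_cos_div_sin, abs_div]
  have h1 := sin_half_lower hy
  have h2 : 0 < |y| / Real.pi := by positivity
  calc |Real.cos (y / 2)| / |Real.sin (y / 2)| ≤ 1 / (|y| / Real.pi) :=
        div_le_div₀ zero_le_one (Real.abs_cos_le_one _) h2 h1
    _ = Real.pi / |y| := by field_simp

theorem measurable_cot_half : Measurable fun y : ℝ => Real.cot (y / 2) := by
  simp only [Real.cot_eq_cos_div_sin]
  fun_prop

theorem integrableOn_cot {ε : ℝ} (hε : 0 < ε) :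
    IntegrableOn (fun y : ℝ => Real.cot (y / 2)) (truncDomain ε) := by
  refine Measure.integrableOn_of_bounded (M := Real.pi / ε) ?_
    measurable_cot_half.aestronglyMeasurable ?_
  · exact ((measure_mono sdiff_subset).trans_lt measure_Icc_lt_top).ne
  · filter_upwards [ae_restrict_mem (measurableSet_truncDomain ε)] with y hy
    have h1 : |y| ≤ Real.pi := abs_le.2 hy.1
    have h2 : ε ≤ |y| := by
      by_contra h
      exact hy.2 (abs_lt.1 (not_le.1 h))
    exact (abs_cot_half_le h1).trans
      (div_le_div_of_nonneg_left Real.pi_pos.le hε h2)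

/-- The exponent has two tasks. Being positive, it makes `|y|^(1/4) / |y|` integrable at zero; being
below `1/2`, it keeps `∑ |c_k| |k|^(1/4)` finite for coefficients `c_k` of an `H¹` function. -/
theorem abs_sin_le_rpow (t : ℝ) : |Real.sin t| ≤ |t| ^ (1 / 4 : ℝ) := by
  by_cases h : |t| ≤ 1
  · refine (Real.abs_sin_le_abs).trans ?_
    by_cases h0 : t = 0
    · simp [h0]
    · have := Real.rpow_le_rpow_of_exponent_ge (abs_pos.2 h0) h (show (1 / 4 : ℝ) ≤ 1 by norm_num)
      simpa using this
  · exact (Real.abs_sin_le_one t).trans (Real.one_le_rpow (not_le.1 h).le (by norm_num))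

theorem integrableOn_abs_rpow :
    IntegrableOn (fun y : ℝ => |y| ^ (-(3 / 4) : ℝ)) (Icc (-Real.pi) Real.pi) := by
  rw [← intervalIntegrable_iff_integrableOn_Icc_of_le (by linarith [Real.pi_pos])]
  have h1 : IntervalIntegrable (fun y : ℝ => |y| ^ (-(3 / 4) : ℝ)) volume 0 Real.pi := by
    have := intervalIntegral.intervalIntegrable_rpow' (a := 0) (b := Real.pi)
      (show (-1 : ℝ) < -(3 / 4) by norm_num)
    refine this.congr ?_
    intro y hy
    rw [uIoc_of_le Real.pi_pos.le] at hy
    simp only [abs_of_pos hy.1]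
  have h2 : IntervalIntegrable (fun y : ℝ => |y| ^ (-(3 / 4) : ℝ)) volume (-Real.pi) 0 := by
    have := (IntervalIntegrable.iff_comp_neg (f := fun y : ℝ => |y| ^ (-(3 / 4) : ℝ))
      (a := 0) (b := Real.pi)).1 h1
    simpa using this.symm
  exact h2.trans h1

theorem abs_sin_mul_cot_le (k : ℤ) {y : ℝ} (hy : |y| ≤ Real.pi) :
    |Real.sin (k * y) * Real.cot (y / 2)|
      ≤ Real.pi * |(k : ℝ)| ^ (1 / 4 : ℝ) * |y| ^ (-(3 / 4) : ℝ) := by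
  by_cases h0 : y = 0
  · simp only [h0, mul_zero, Real.sin_zero, zero_mul, abs_zero]; positivity
  have hpos : 0 < |y| := abs_pos.2 h0
  rw [abs_mul]
  calc |Real.sin (k * y)| * |Real.cot (y / 2)|
      ≤ |(k : ℝ) * y| ^ (1 / 4 : ℝ) * (Real.pi / |y|) :=
        mul_le_mul (abs_sin_le_rpow _) (abs_cot_half_le hy) (abs_nonneg _) (by positivity)
    _ = _ := by
      rw [abs_mul, Real.mul_rpow (abs_nonneg _) (abs_nonneg _),
        show (-(3 / 4) : ℝ) = 1 / 4 - 1 by norm_num, Real.rpow_sub hpos, Real.rpow_one]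
      ring

theorem integrableOn_sin_mul_cot (k : ℤ) :
    IntegrableOn (fun y : ℝ => Real.sin (k * y) * Real.cot (y / 2)) (Icc (-Real.pi) Real.pi) := by
  refine (integrableOn_abs_rpow.const_mul (Real.pi * |(k : ℝ)| ^ (1 / 4 : ℝ))).mono' ?_ ?_
  · exact ((by fun_prop : Measurable fun y : ℝ => Real.sin (k * y)).mul
      measurable_cot_half).aestronglyMeasurable
  · filter_upwards [ae_restrict_mem measurableSet_Icc] with y hy
    exact abs_sin_mul_cot_le k (abs_le.2 hy)

/-- The truncated conjugate multiplier `(1/2π) ∫_{ε ≤ |y| ≤ π} sin(ky) cot(y/2) dy`. -/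
def truncSign (ε : ℝ) (k : ℤ) : ℝ :=
  (1 / (2 * Real.pi)) * ∫ y in truncDomain ε, Real.sin (k * y) * Real.cot (y / 2)

/-- The bound is uniform in `ε`, and its slow growth in `k` is affordable on `H¹`; it serves as
domination in `tendsto_truncHilbert`. -/
theorem exists_abs_truncSign_le :
    ∃ C : ℝ, ∀ (ε : ℝ) (k : ℤ), |truncSign ε k| ≤ C * |(k : ℝ)| ^ (1 / 4 : ℝ) := by
  refine ⟨(1 / (2 * Real.pi)) * (Real.pi *
    ∫ y in Icc (-Real.pi) Real.pi, |y| ^ (-(3 / 4) : ℝ)), fun ε k => ?_⟩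
  rw [truncSign, abs_mul, abs_of_pos (by positivity : (0 : ℝ) < 1 / (2 * Real.pi)), mul_assoc]
  refine mul_le_mul_of_nonneg_left ?_ (by positivity)
  calc |∫ y in truncDomain ε, Real.sin (k * y) * Real.cot (y / 2)|
      ≤ ∫ y in truncDomain ε, Real.pi * |(k : ℝ)| ^ (1 / 4 : ℝ) * |y| ^ (-(3 / 4) : ℝ) := by
        refine norm_integral_le_of_norm_le (G := ℝ)
          ((integrableOn_abs_rpow.mono_set sdiff_subset).const_mul _) ?_
        filter_upwards [ae_restrict_mem (measurableSet_truncDomain ε)] with y hy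
        exact abs_sin_mul_cot_le k (abs_le.2 hy.1)
    _ ≤ ∫ y in Icc (-Real.pi) Real.pi,
          Real.pi * |(k : ℝ)| ^ (1 / 4 : ℝ) * |y| ^ (-(3 / 4) : ℝ) := by
        refine setIntegral_mono_set (integrableOn_abs_rpow.const_mul _)
          (Eventually.of_forall fun y => ?_) (Eventually.of_forall sdiff_subset)
        simp only [Pi.zero_apply]; positivity
    _ = _ := by rw [integral_const_mul]; ring

/-- Induction by telescoping: `(sin((n+1)y) - sin(ny)) cot(y/2) = cos((n+1)y) + cos(ny)`, whose
integral is `2π` for `n = 0` and zero otherwise. -/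
theorem integral_sin_mul_cot_nat (n : ℕ) :
    ∫ y in Icc (-Real.pi) Real.pi, Real.sin ((n : ℤ) * y) * Real.cot (y / 2)
      = if n = 0 then 0 else 2 * Real.pi := by
  induction n with
  | zero => simp
  | succ n ih =>
    have hne : ∀ᵐ y ∂(volume : Measure ℝ), y ≠ 0 := by
      simp [ae_iff]
    have h1 : (∫ y in Icc (-Real.pi) Real.pi, Real.sin (((n + 1 : ℕ) : ℤ) * y) * Real.cot (y / 2))
        - (∫ y in Icc (-Real.pi) Real.pi, Real.sin ((n : ℤ) * y) * Real.cot (y / 2))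
        = ∫ y in Icc (-Real.pi) Real.pi,
          (Real.cos (((n + 1 : ℕ) : ℤ) * y) + Real.cos ((n : ℤ) * y)) := by
      rw [← integral_sub (integrableOn_sin_mul_cot _) (integrableOn_sin_mul_cot _)]
      refine integral_congr_ae ?_
      filter_upwards [ae_restrict_mem measurableSet_Icc, ae_restrict_of_ae hne] with y hy hy0
      have hs : Real.sin (y / 2) ≠ 0 := by
        have := sin_half_lower (abs_le.2 hy)
        have h2 : 0 < |y| / Real.pi := div_pos (abs_pos.2 hy0) Real.pi_pos
        exact abs_pos.1 (h2.trans_le this)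
      rw [← sub_mul, Real.sin_sub_sin, Real.cos_add_cos, Real.cot_eq_cos_div_sin]
      push_cast
      have e1 : (((n : ℝ) + 1) * y - n * y) / 2 = y / 2 := by ring
      rw [e1]
      field_simp
    rw [ih] at h1
    rw [integral_Icc_eq_integral_Ioc (f := fun y => Real.cos _ + Real.cos _),
      ← intervalIntegral.integral_of_le (by linarith [Real.pi_pos]),
      intervalIntegral.integral_add (Continuous.intervalIntegrable (by fun_prop) _ _)
        (Continuous.intervalIntegrable (by fun_prop) _ _),
      integral_cos_int (k := ((n + 1 : ℕ) : ℤ)) (by positivity)] at h1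
    by_cases hn : n = 0
    · subst hn
      simp at h1 ⊢
      linarith
    · rw [integral_cos_int (by exact_mod_cast hn), if_neg hn] at h1
      simp only [Nat.add_eq_zero_iff, one_ne_zero, and_false, if_false]
      linarith

theorem integral_sin_mul_cot (k : ℤ) :
    ∫ y in Icc (-Real.pi) Real.pi, Real.sin (k * y) * Real.cot (y / 2) = 2 * Real.pi * k.sign := by
  obtain ⟨n, rfl | rfl⟩ := k.eq_nat_or_neg
  · rw [integral_sin_mul_cot_nat]
    split_ifs with h
    · simp [h]
    · rw [Int.sign_natCast_of_ne_zero h]; simp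
  · have h : ∀ y : ℝ, Real.sin (((-(n : ℤ) : ℤ) : ℝ) * y) * Real.cot (y / 2)
        = -(Real.sin ((n : ℤ) * y) * Real.cot (y / 2)) := by
      intro y; push_cast; rw [neg_mul (n : ℝ), Real.sin_neg]; ring
    simp only [h]
    rw [integral_neg, integral_sin_mul_cot_nat]
    split_ifs with h
    · simp [h]
    · rw [Int.sign_neg, Int.sign_natCast_of_ne_zero h]; simp

theorem tendsto_truncSign (k : ℤ) :
    Tendsto (fun ε => truncSign ε k) (𝓝[>] 0) (𝓝 (k.sign : ℝ)) := by
  have h0 : (k.sign : ℝ) = (1 / (2 * Real.pi)) *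
      ∫ y in Icc (-Real.pi) Real.pi, Real.sin (k * y) * Real.cot (y / 2) := by
    rw [integral_sin_mul_cot]; field_simp
  rw [h0]
  refine Tendsto.const_mul _ ?_
  have h1 : ∀ ε, ∫ y in truncDomain ε, Real.sin (k * y) * Real.cot (y / 2)
      = ∫ y in Icc (-Real.pi) Real.pi,
        (Ioo (-ε) ε)ᶜ.indicator (fun y => Real.sin (k * y) * Real.cot (y / 2)) y := by
    intro ε
    rw [setIntegral_indicator measurableSet_Ioo.compl, ← sdiff_eq]
  simp only [h1]
  refine tendsto_integral_filter_of_dominated_convergence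
    (fun y => ‖Real.sin (k * y) * Real.cot (y / 2)‖) ?_ ?_ (integrableOn_sin_mul_cot k).norm ?_
  · exact Eventually.of_forall fun ε =>
      (integrableOn_sin_mul_cot k).aestronglyMeasurable.indicator measurableSet_Ioo.compl
  · exact Eventually.of_forall fun ε => Eventually.of_forall fun y => norm_indicator_le_norm_self _ _
  · have hne : ∀ᵐ y ∂(volume : Measure ℝ), y ≠ 0 := by
      simp [ae_iff]
    filter_upwards [ae_restrict_of_ae hne] with y hy
    refine tendsto_const_nhds.congr' ?_
    have : ∀ᶠ ε in 𝓝[>] (0 : ℝ), ε < |y| :=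
      nhdsWithin_le_nhds (eventually_lt_nhds (abs_pos.2 hy))
    filter_upwards [this] with ε hε
    rw [indicator_of_mem]
    intro hy'
    exact absurd (abs_lt.2 hy') (not_lt.2 hε.le)

/-- The integrand is odd and the domain symmetric; the reflection identity needs no integrability,
so no condition on `ε` appears. -/
theorem integral_cos_mul_cot (ε : ℝ) (k : ℤ) :
    ∫ y in truncDomain ε, Real.cos (k * y) * Real.cot (y / 2) = 0 := by
  rw [← integral_indicator (measurableSet_truncDomain ε)]
  have h := integral_neg_eq_self ((truncDomain ε).indicator
    fun y => Real.cos (k * y) * Real.cot (y / 2)) volume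
  have h2 : ∀ y, (truncDomain ε).indicator (fun y => Real.cos (k * y) * Real.cot (y / 2)) (-y)
      = -(truncDomain ε).indicator (fun y => Real.cos (k * y) * Real.cot (y / 2)) y := by
    intro y
    have hm : -y ∈ truncDomain ε ↔ y ∈ truncDomain ε := by
      simp only [truncDomain, Set.mem_sdiff, mem_Icc, mem_Ioo]
      constructor <;> rintro ⟨⟨h1, h2⟩, h3⟩ <;>
        exact ⟨⟨by linarith, by linarith⟩, fun h => h3 ⟨by linarith [h.2], by linarith [h.1]⟩⟩
    by_cases hy : y ∈ truncDomain ε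
    · rw [indicator_of_mem hy, indicator_of_mem (hm.2 hy), mul_neg, Real.cos_neg, neg_div,
        Real.cot_eq_cos_div_sin, Real.cot_eq_cos_div_sin, Real.cos_neg, Real.sin_neg]
      rw [div_neg, mul_neg]
    · rw [indicator_of_notMem hy, indicator_of_notMem (fun h => hy (hm.1 h)), neg_zero]
  simp only [h2] at h
  rw [integral_neg] at h
  linarith

/-- The truncated Hilbert transform at a point, as a functional on continuous functions. -/
def truncHilbertC {ε : ℝ} (hε : 0 < ε) (x : Circ) : C(Circ, ℝ) →L[ℝ] ℝ :=
  have hi : ∀ φ : C(Circ, ℝ),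
      IntegrableOn (fun y : ℝ => φ (x - (y : Circ)) * Real.cot (y / 2)) (truncDomain ε) := fun φ =>
    (integrableOn_cot hε).bdd_mul (c := ‖φ‖) (by
      apply Continuous.aestronglyMeasurable
      exact φ.continuous.comp (continuous_const.sub (AddCircle.continuous_mk' _)))
      (Eventually.of_forall fun y => φ.norm_coe_le_norm _)
  LinearMap.mkContinuous
    { toFun := fun φ => (1 / (2 * Real.pi)) *
        ∫ y in truncDomain ε, φ (x - (y : Circ)) * Real.cot (y / 2)
      map_add' := fun φ ψ => by
        rw [← mul_add, ← integral_add (hi φ) (hi ψ)]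
        simp only [ContinuousMap.add_apply, add_mul]
      map_smul' := fun r φ => by
        simp only [ContinuousMap.smul_apply, smul_eq_mul, RingHom.id_apply, mul_assoc]
        rw [integral_const_mul]; ring }
    ((1 / (2 * Real.pi)) * ∫ y in truncDomain ε, ‖Real.cot (y / 2)‖) fun φ => by
      rw [LinearMap.coe_mk, AddHom.coe_mk, norm_mul, mul_assoc,
        Real.norm_of_nonneg (by positivity : (0 : ℝ) ≤ 1 / (2 * Real.pi))]
      refine mul_le_mul_of_nonneg_left ?_ (by positivity)
      rw [← integral_mul_const]
      refine norm_integral_le_of_norm_le ((integrableOn_cot hε).norm.mul_const _)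
        (Eventually.of_forall fun y => ?_)
      rw [norm_mul, mul_comm]
      exact mul_le_mul_of_nonneg_left (φ.norm_coe_le_norm _) (norm_nonneg _)

theorem truncHilbertC_apply {ε : ℝ} (hε : 0 < ε) (x : Circ) (φ : C(Circ, ℝ)) :
    truncHilbertC hε x φ = (1 / (2 * Real.pi)) *
        ∫ y in truncDomain ε, φ (x - (y : Circ)) * Real.cot (y / 2) := rfl

/-- Since `y ↦ x - y` preserves null sets, the almost-everywhere representative may be replaced by
the continuous one at every point `x`. -/
theorem truncHilbert_toL2 {ε : ℝ} (hε : 0 < ε) (x : Circ) (φ : C(Circ, ℝ)) :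
    truncHilbert (toL2 φ) ε x = truncHilbertC hε x φ := by
  rw [truncHilbert, truncHilbertC_apply]
  congr 1
  refine integral_congr_ae ?_
  have hmp := AddCircle.measurePreserving_mk (2 * Real.pi) (-Real.pi)
  have hq := ((Measure.measurePreserving_sub_left (volume : Measure Circ) x).comp hmp).quasiMeasurePreserving
  have h := hq.ae (coeFn_toL2 φ)
  have e : -Real.pi + 2 * Real.pi = Real.pi := by ring
  rw [e, Measure.restrict_congr_set Ioc_ae_eq_Icc] at h
  filter_upwards [ae_restrict_of_ae_restrict_of_subset sdiff_subset h] with y hy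
  simp only [Function.comp] at hy
  rw [hy]

theorem hartley_sub (k : ℤ) (x : Circ) (y : ℝ) :
    hartley k (x - (y : Circ))
      = Real.cos (k * y) * hartley k x - Real.sin (k * y) * hartley (-k) x := by
  induction x using QuotientAddGroup.induction_on with
  | H x =>
    have h1 := hartley_coe k (x - y)
    have h2 := hartley_coe k x
    have h3 := hartley_coe (-k) x
    change hartley k ((x - y : ℝ) : Circ) = Real.cos (k * y) * hartley k (x : Circ)
      - Real.sin (k * y) * hartley (-k) (x : Circ)
    rw [h1, h2, h3]
    push_cast
    rw [neg_mul (k : ℝ), Real.cos_neg, Real.sin_neg, mul_sub, Real.cos_sub, Real.sin_sub]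
    ring

/-- By the addition formula, the part with `cos(ky)` vanishes by parity and the part with `sin(ky)`
is `truncSign`. -/
theorem truncHilbertC_hartley {ε : ℝ} (hε : 0 < ε) (x : Circ) (k : ℤ) :
    truncHilbertC hε x (hartley k) = -truncSign ε k * hartley (-k) x := by
  have hc : IntegrableOn (fun y : ℝ => Real.cos (k * y) * Real.cot (y / 2)) (truncDomain ε) :=
    (integrableOn_cot hε).bdd_mul (c := 1) (by
      apply Continuous.aestronglyMeasurable; fun_prop)
      (Eventually.of_forall fun y => Real.abs_cos_le_one _)
  have hs := (integrableOn_sin_mul_cot k).mono_set (sdiff_subset (t := Ioo (-ε) ε))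
  rw [truncHilbertC_apply, truncSign]
  have h : ∀ y : ℝ, hartley k (x - (y : Circ)) * Real.cot (y / 2)
      = hartley k x * (Real.cos (k * y) * Real.cot (y / 2))
        - hartley (-k) x * (Real.sin (k * y) * Real.cot (y / 2)) := by
    intro y; rw [hartley_sub]; ring
  simp only [h]
  rw [integral_sub (hc.const_mul _) (hs.const_mul _), integral_const_mul, integral_const_mul,
    integral_cos_mul_cot]
  ring

/-- Each term is `(|k| |c_k|) · |k|^(-3/4)`, a product of two square-summable sequences. -/
theorem summable_abs_coef_mul_rpow (u : H1) :
    Summable fun k : ℤ => |coef k u.fn| * |(k : ℝ)| ^ (1 / 4 : ℝ) := by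
  have h1 := (Equiv.neg ℤ).summable_iff.2 (hasSum_coef_sq u.dx).summable
  have h2 := Real.summable_abs_int_rpow (b := 3 / 2) (by norm_num)
  refine (h1.add h2).of_nonneg_of_le (fun k => by positivity) fun k => ?_
  simp only [Function.comp, Equiv.neg_apply, H1.coef_dx, neg_neg]
  by_cases hk : k = 0
  · subst hk
    simp only [Int.cast_zero, abs_zero]
    rw [Real.zero_rpow (by norm_num), Real.zero_rpow (by norm_num)]
    simp
  have hpos : 0 < |(k : ℝ)| := abs_pos.2 (by exact_mod_cast hk)
  have e1 : |(k : ℝ)| ^ (1 / 4 : ℝ) = |(k : ℝ)| * |(k : ℝ)| ^ (-(3 / 4) : ℝ) := by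
    rw [show (1 / 4 : ℝ) = 1 + -(3 / 4) by norm_num, Real.rpow_add hpos, Real.rpow_one]
  have e2 : |(k : ℝ)| ^ (-(3 / 2) : ℝ) = (|(k : ℝ)| ^ (-(3 / 4) : ℝ)) ^ 2 := by
    rw [← Real.rpow_natCast, ← Real.rpow_mul (abs_nonneg _)]; norm_num
  rw [e1, e2]
  push_cast
  have e3 : (-(-(k : ℝ)) * coef k u.fn) ^ 2 = (|(k : ℝ)| * |coef k u.fn|) ^ 2 := by
    rw [← abs_mul, sq_abs]; ring
  rw [e3]
  nlinarith [sq_nonneg (|(k : ℝ)| * |coef k u.fn| - |(k : ℝ)| ^ (-(3 / 4) : ℝ)),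
    sq_nonneg (|(k : ℝ)| * |coef k u.fn|), sq_nonneg (|(k : ℝ)| ^ (-(3 / 4) : ℝ))]

/-- The Hartley series of `u` converges uniformly, so the truncated transform may be applied
termwise. Dominated convergence of series then gives the limit at every point. -/
theorem tendsto_truncHilbert (u : H1) (x : Circ) :
    Tendsto (fun ε => truncHilbert u.fn ε x) (𝓝[>] 0) (𝓝 ((hilbertH1 u).toC x)) := by
  obtain ⟨C, hC⟩ := exists_abs_truncSign_le
  have h1 : ∀ᶠ ε in 𝓝[>] (0 : ℝ),
      ∑' k : ℤ, coef k u.fn * (-truncSign ε k * hartley (-k) x) = truncHilbert u.fn ε x := by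
    filter_upwards [self_mem_nhdsWithin] with ε hε'
    have hε : 0 < ε := hε'
    have h := (truncHilbertC hε x).hasSum u.hasSum_toC
    rw [← H1.toL2_toC u, truncHilbert_toL2 hε, H1.toL2_toC, ← h.tsum_eq]
    refine tsum_congr fun k => ?_
    rw [map_smul, truncHilbertC_hartley, smul_eq_mul]
  have h2 : ∑' k : ℤ, coef k u.fn * (-(k.sign : ℝ) * hartley (-k) x) = (hilbertH1 u).toC x := by
    have h := (hilbertH1 u).hasSum_toC
    have h' := (ContinuousMap.evalCLM ℝ x).hasSum h
    have h3 : HasSum (fun k : ℤ => coef k u.fn * (-(k.sign : ℝ) * hartley (-k) x))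
        ((hilbertH1 u).toC x) := by
      refine (((Equiv.neg ℤ).hasSum_iff.2 h')).congr_fun fun k => ?_
      simp only [Function.comp, Equiv.neg_apply, hilbertH1_fn, coef_hilbert, neg_neg, Int.sign_neg,
        map_smul, ContinuousMap.evalCLM_apply, smul_eq_mul]
      push_cast; ring
    exact h3.tsum_eq
  rw [← h2]
  refine Tendsto.congr' h1 ?_
  refine tendsto_tsum_of_dominated_convergence
    (bound := fun k : ℤ => C * (|coef k u.fn| * |(k : ℝ)| ^ (1 / 4 : ℝ)))
    ((summable_abs_coef_mul_rpow u).mul_left C) (fun k => ?_) (Eventually.of_forall fun ε k => ?_)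
  · exact ((tendsto_truncSign k).neg.mul_const _).const_mul _
  · rw [norm_mul, norm_mul, norm_neg, Real.norm_eq_abs, Real.norm_eq_abs]
    have h3 : ‖hartley (-k) x‖ ≤ 1 := ((hartley (-k)).norm_coe_le_norm x).trans (norm_hartley_le _)
    calc |coef k u.fn| * (|truncSign ε k| * ‖hartley (-k) x‖)
        ≤ |coef k u.fn| * ((C * |(k : ℝ)| ^ (1 / 4 : ℝ)) * 1) :=
          mul_le_mul_of_nonneg_left (mul_le_mul (hC ε k) h3 (norm_nonneg _)
            ((abs_nonneg _).trans (hC ε k))) (abs_nonneg _)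
      _ = _ := by ring

/-- On `H¹` the principal value integral is the Fourier multiplier. -/
theorem isHilbertTransform_iff (u : H1) (g : L2) :
    IsHilbertTransform u.fn g ↔ g = hilbert u.fn := by
  have h0 : (hilbert u.fn : Circ → ℝ) =ᵐ[volume] (hilbertH1 u).toC := by
    have := coeFn_toL2 (hilbertH1 u).toC
    rwa [H1.toL2_toC, hilbertH1_fn] at this
  constructor
  · intro h
    apply Lp.ext
    filter_upwards [h, h0] with x hx hx0
    rw [hx0]
    exact tendsto_nhds_unique hx (tendsto_truncHilbert u x)
  · rintro rfl
    rw [IsHilbertTransform]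
    filter_upwards [h0] with x hx0
    rw [hx0]
    exact tendsto_truncHilbert u x

/-- The mean-zero function with derivative the Hilbert transform of `f`. -/
def potential (f : L2) : H1 :=
  H1.mk (antideriv (hilbert f)) (hilbert f) fun k => by
    rw [coef_antideriv, neg_neg]
    by_cases h : k = 0
    · simp [h, coef_hilbert]
    · have : (k : ℝ) ≠ 0 := by exact_mod_cast h
      push_cast; field_simp

@[simp] theorem potential_fn (f : L2) : (potential f).fn = antideriv (hilbert f) := rfl
@[simp] theorem potential_dx (f : L2) : (potential f).dx = hilbert f := rfl

theorem integral_eq_zero_iff (f : L2) : ∫ x, f x = 0 ↔ coef 0 f = 0 := by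
  rw [coef_eq_integral]
  have h : ∀ x : Circ, hartley 0 x = 1 / √(2 * Real.pi) := fun x => by simp [hartley]
  simp only [h]
  rw [integral_mul_const, mul_eq_zero, or_iff_left (by positivity)]

/-- The derivative fixes all coefficients of nonzero index and the normalization fixes the remaining
one, so potentials can be eliminated from the system. -/
theorem isPotential_iff (p u : H1) : IsPotential p u.fn ↔ p = potential u.fn := by
  constructor
  · rintro ⟨h1, h2⟩
    rw [isHilbertTransform_iff] at h1
    rw [integral_eq_zero_iff] at h2
    apply H1.ext_fn
    refine ext_coef fun k => ?_
    rw [potential_fn, coef_antideriv, ← h1, H1.coef_dx, neg_neg]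
    by_cases h : k = 0
    · simp [h, h2]
    · have : (k : ℝ) ≠ 0 := by exact_mod_cast h
      push_cast; field_simp
  · rintro rfl
    refine ⟨(isHilbertTransform_iff _ _).2 rfl, ?_⟩
    rw [integral_eq_zero_iff, potential_fn, coef_antideriv]
    simp

theorem toC_potential (f : L2) : (potential f).toC = antiderivC (hilbert f) := by
  rw [H1.toC_apply, potential_fn, coef_antideriv]; simp

/-! ### The nonlinearity -/

/-- The right-hand side `-a m u_x + v H u` of the evolution equations, where `m_x = H v`. -/
def nonlin (a : ℝ) (u v : H1) : L2 :=
  -a • mulL (antiderivC (hilbert v.fn)) u.dx + mulL v.toC (hilbert u.fn)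

theorem nonlin_sub (a : ℝ) (u v u' v' : H1) :
    nonlin a u v - nonlin a u' v' = nonlin a (u - u') v + nonlin a u' (v - v') := by
  simp only [nonlin, H1.sub_fn, H1.sub_dx, map_sub, sub_apply, smul_sub]
  abel

/-- Quadratic homogeneity; it makes the system reversible in time. -/
theorem nonlin_neg_neg (a : ℝ) (u v : H1) : nonlin a (-u) (-v) = nonlin a u v := by
  simp only [nonlin, H1.neg_fn, H1.neg_dx, map_neg, neg_apply, neg_neg]

theorem nonlin_zero_left (a : ℝ) (v : H1) : nonlin a 0 v = 0 := by
  have h1 : (0 : H1).fn = 0 := rfl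
  have h2 : (0 : H1).dx = 0 := rfl
  simp [nonlin, h1, h2]

theorem continuous_nonlin (a : ℝ) : Continuous fun p : H1 × H1 => nonlin a p.1 p.2 := by
  have h1 : Continuous fun p : H1 × H1 =>
      mulL (antiderivC (hilbert (H1.fnL p.2))) (H1.dxL p.1) := by fun_prop
  have h2 : Continuous fun p : H1 × H1 =>
      mulL (H1.toC p.2) (hilbert (H1.fnL p.1)) := by fun_prop
  exact (h1.const_smul (-a)).add h2

/-- A constant in the bound for the nonlinearity. -/
def nonlinConst (a : ℝ) : ℝ := |a| * sobolevConst + ‖H1.toC‖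

theorem nonlinConst_nonneg (a : ℝ) : 0 ≤ nonlinConst a :=
  add_nonneg (mul_nonneg (abs_nonneg _) sobolevConst_nonneg) (ContinuousLinearMap.opNorm_nonneg _)

theorem norm_mulL_antiderivC_le (f g : L2) :
    ‖mulL (antiderivC f) g‖ ≤ sobolevConst * ‖f‖ * ‖g‖ :=
  (norm_mulL_le _ _).trans (mul_le_mul_of_nonneg_right (norm_antiderivC_le f) (norm_nonneg _))

theorem norm_nonlin_le (a : ℝ) (u v : H1) : ‖nonlin a u v‖ ≤ nonlinConst a * ‖u‖ * ‖v‖ := by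
  have hS := sobolevConst_nonneg
  have h1 : ‖mulL (antiderivC (hilbert v.fn)) u.dx‖ ≤ sobolevConst * ‖v‖ * ‖u‖ :=
    (norm_mulL_antiderivC_le _ _).trans
      (mul_le_mul (mul_le_mul_of_nonneg_left ((norm_hilbert_le _).trans v.norm_fn_le) hS)
        u.norm_dx_le (norm_nonneg _) (by positivity))
  have h2 : ‖mulL v.toC (hilbert u.fn)‖ ≤ ‖H1.toC‖ * ‖v‖ * ‖u‖ :=
    (norm_mulL_le _ _).trans (mul_le_mul (H1.toC.le_opNorm v)
      ((norm_hilbert_le _).trans u.norm_fn_le) (norm_nonneg _) (by positivity))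
  calc ‖nonlin a u v‖ ≤ ‖-a • mulL (antiderivC (hilbert v.fn)) u.dx‖
        + ‖mulL v.toC (hilbert u.fn)‖ := norm_add_le _ _
    _ ≤ |a| * (sobolevConst * ‖v‖ * ‖u‖) + ‖H1.toC‖ * ‖v‖ * ‖u‖ := by
        rw [norm_smul, Real.norm_eq_abs, abs_neg]
        exact add_le_add (mul_le_mul_of_nonneg_left h1 (abs_nonneg _)) h2
    _ = nonlinConst a * ‖u‖ * ‖v‖ := by rw [nonlinConst]; ring

/-- `H u` has mean zero, hence its sup norm is controlled by `‖u_x‖` without `‖u‖`. -/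
theorem toC_hilbertH1 (u : H1) : (hilbertH1 u).toC = antiderivC (hilbert u.dx) := by
  rw [H1.toC_apply, hilbertH1_fn, hilbertH1_dx, coef_hilbert]; simp

theorem norm_toC_hilbertH1_le (u : H1) : ‖(hilbertH1 u).toC‖ ≤ sobolevConst * ‖u.dx‖ := by
  rw [toC_hilbertH1]
  exact (norm_antiderivC_le _).trans
    (mul_le_mul_of_nonneg_left (norm_hilbert_le _) sobolevConst_nonneg)

/-! ### Energy estimates in homogeneous norms -/

/-- Integration by parts in the transport term. -/
theorem inner_transport (w v : H1) :
    inner ℝ w.fn (mulL (antiderivC (hilbert v.fn)) w.dx)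
      = -(1 / 2) * inner ℝ w.fn (mulL (hilbertH1 v).toC w.fn) := by
  -- This is `∫ (m w²)_x = 0` with `m_x = H v`.
  have h := leibniz_eq_zero (potential v.fn) w w
  rw [leibniz, toC_potential, potential_dx, ← hilbertH1_fn, ← mulL_toC_comm,
    real_inner_comm, inner_mulL] at h
  rw [← hilbertH1_fn]
  linarith

/-- The mean of `v` does not contribute to `∫ w v H w`. -/
theorem inner_mulL_hilbert (v : H1) (f : L2) :
    inner ℝ f (mulL v.toC (hilbert f)) = inner ℝ f (mulL (antiderivC v.dx) (hilbert f)) := by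
  rw [H1.toC_apply, map_add, map_smul, add_apply, smul_apply,
    mulL_hartley_zero, inner_add_right, inner_smul_right, inner_smul_right, inner_hilbert_self]
  ring

theorem abs_inner_mulL_hilbert_le (v : H1) (f : L2) :
    |inner ℝ f (mulL v.toC (hilbert f))| ≤ sobolevConst * ‖v.dx‖ * ‖f‖ ^ 2 := by
  rw [inner_mulL_hilbert]
  calc |inner ℝ f (mulL (antiderivC v.dx) (hilbert f))|
      ≤ ‖f‖ * ‖mulL (antiderivC v.dx) (hilbert f)‖ := abs_real_inner_le_norm _ _
    _ ≤ ‖f‖ * (sobolevConst * ‖v.dx‖ * ‖f‖) := by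
        refine mul_le_mul_of_nonneg_left ((norm_mulL_antiderivC_le _ _).trans ?_) (norm_nonneg _)
        exact mul_le_mul_of_nonneg_left (norm_hilbert_le _)
          (mul_nonneg sobolevConst_nonneg (norm_nonneg _))
    _ = _ := by ring

theorem abs_inner_mulL_hilbertH1_le (v : H1) (f g : L2) :
    |inner ℝ f (mulL (hilbertH1 v).toC g)| ≤ sobolevConst * ‖v.dx‖ * (‖f‖ * ‖g‖) := by
  calc |inner ℝ f (mulL (hilbertH1 v).toC g)|
      ≤ ‖f‖ * ‖mulL (hilbertH1 v).toC g‖ := abs_real_inner_le_norm _ _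
    _ ≤ ‖f‖ * (sobolevConst * ‖v.dx‖ * ‖g‖) :=
        mul_le_mul_of_nonneg_left ((norm_mulL_le _ _).trans
          (mul_le_mul_of_nonneg_right (norm_toC_hilbertH1_le v) (norm_nonneg _))) (norm_nonneg _)
    _ = _ := by ring

/-- The constant in the energy estimates. -/
def energyConst (a : ℝ) : ℝ := (|a| + 2) * sobolevConst + 1

theorem energyConst_pos (a : ℝ) : 0 < energyConst a := by
  have := sobolevConst_nonneg
  rw [energyConst]; positivity

/-- The energy estimate for `u_x`, where `w = u_x ∈ H¹`. -/
theorem abs_inner_dx_nonlin_le (a : ℝ) {u v w : H1} (hw : w.fn = u.dx) :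
    |inner ℝ w.dx (nonlin a u v)| ≤ energyConst a * (‖v.dx‖ * ‖u.dx‖ ^ 2) := by
  have hS := sobolevConst_nonneg
  have h1 : inner ℝ w.dx (mulL (antiderivC (hilbert v.fn)) u.dx)
      = -(1 / 2) * inner ℝ u.dx (mulL (hilbertH1 v).toC u.dx) := by
    rw [← hw, ← inner_transport, ← inner_mulL, real_inner_comm]
  -- From `∫ (v · H u · w)_x = 0` with `w = u_x`: the derivative leaves `w` and falls on `v` and on
  -- `H u`.
  have h2 : inner ℝ w.dx (mulL v.toC (hilbert u.fn))
      = -inner ℝ u.dx (mulL (hilbertH1 u).toC v.dx) - inner ℝ u.dx (mulL v.toC (hilbert u.dx)) := by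
    have h := leibniz_eq_zero v (hilbertH1 u) w
    rw [leibniz, hilbertH1_fn, hilbertH1_dx, hw] at h
    linarith
  have h3 := abs_inner_mulL_hilbertH1_le v u.dx u.dx
  have h4 := abs_inner_mulL_hilbertH1_le u u.dx v.dx
  have h5 := abs_inner_mulL_hilbert_le v u.dx
  rw [nonlin, inner_add_right, inner_smul_right, h1, h2]
  set A := inner ℝ u.dx (mulL (hilbertH1 v).toC u.dx)
  set B := inner ℝ u.dx (mulL (hilbertH1 u).toC v.dx)
  set D := inner ℝ u.dx (mulL v.toC (hilbert u.dx))
  have e : -a * (-(1 / 2) * A) + (-B - D) = a / 2 * A - B - D := by ring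
  rw [e]
  have h6 : |a / 2 * A| ≤ |a| * (sobolevConst * ‖v.dx‖ * (‖u.dx‖ * ‖u.dx‖)) := by
    rw [abs_mul, abs_div, abs_two]
    have := mul_le_mul_of_nonneg_left h3 (abs_nonneg a)
    nlinarith [mul_nonneg (abs_nonneg a) (abs_nonneg A)]
  have h7 : |a / 2 * A - B - D| ≤ |a / 2 * A| + |B| + |D| :=
    (abs_sub _ _).trans (add_le_add_left (abs_sub _ _) _)
  rw [energyConst]
  have h8 : 0 ≤ ‖v.dx‖ * ‖u.dx‖ ^ 2 := by positivity
  calc _ ≤ _ := h7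
    _ ≤ _ := add_le_add (add_le_add h6 h4) h5
    _ = (|a| + 2) * sobolevConst * (‖v.dx‖ * ‖u.dx‖ ^ 2) := by ring
    _ ≤ _ := mul_le_mul_of_nonneg_right (by linarith) h8

/-- The basic energy estimate for differences. -/
theorem inner_nonlin_sub_le (a : ℝ) (u v u' v' : H1) :
    |inner ℝ (u - u').fn (nonlin a u v - nonlin a u' v')|
      ≤ energyConst a * (‖v.dx‖ * ‖(u - u').fn‖ ^ 2
        + ‖u'.dx‖ * (‖(u - u').fn‖ * ‖(v - v').fn‖)) := by
  have hS := sobolevConst_nonneg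
  -- With this splitting the difference `w` is differentiated only in the transport by `v`, where
  -- integration by parts applies; the other derivative falls on `u'`, which is bounded in `H¹`.
  rw [nonlin_sub]
  set w := u - u'
  set z := v - v'
  have h1 := abs_inner_mulL_hilbertH1_le v w.fn w.fn
  have h2 := abs_inner_mulL_hilbert_le v w.fn
  have h3 := abs_inner_mulL_hilbertH1_le u' w.fn z.fn
  have h4 : |inner ℝ w.fn (mulL (antiderivC (hilbert z.fn)) u'.dx)|
      ≤ sobolevConst * ‖u'.dx‖ * (‖w.fn‖ * ‖z.fn‖) := by
    calc _ ≤ ‖w.fn‖ * ‖mulL (antiderivC (hilbert z.fn)) u'.dx‖ := abs_real_inner_le_norm _ _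
      _ ≤ ‖w.fn‖ * (sobolevConst * ‖z.fn‖ * ‖u'.dx‖) := by
        refine mul_le_mul_of_nonneg_left ((norm_mulL_antiderivC_le _ _).trans ?_) (norm_nonneg _)
        exact mul_le_mul_of_nonneg_right
          (mul_le_mul_of_nonneg_left (norm_hilbert_le _) hS) (norm_nonneg _)
      _ = _ := by ring
  rw [inner_add_right, nonlin, nonlin, inner_add_right, inner_add_right, inner_smul_right,
    inner_smul_right, inner_transport, ← hilbertH1_fn u', ← mulL_toC_comm (hilbertH1 u') z]
  set A := inner ℝ w.fn (mulL (hilbertH1 v).toC w.fn)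
  set B := inner ℝ w.fn (mulL v.toC (hilbert w.fn))
  set D := inner ℝ w.fn (mulL (antiderivC (hilbert z.fn)) u'.dx)
  set G := inner ℝ w.fn (mulL (hilbertH1 u').toC z.fn)
  have e : -a * (-(1 / 2) * A) + B + (-a * D + G) = a / 2 * A + B + (-a * D + G) := by ring
  rw [e]
  have h5 : |a / 2 * A| ≤ |a| * (sobolevConst * ‖v.dx‖ * (‖w.fn‖ * ‖w.fn‖)) := by
    rw [abs_mul, abs_div, abs_two]
    have := mul_le_mul_of_nonneg_left h1 (abs_nonneg a)
    nlinarith [mul_nonneg (abs_nonneg a) (abs_nonneg A)]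
  have h6 : |-a * D| ≤ |a| * (sobolevConst * ‖u'.dx‖ * (‖w.fn‖ * ‖z.fn‖)) := by
    rw [abs_mul, abs_neg]
    exact mul_le_mul_of_nonneg_left h4 (abs_nonneg a)
  have h7 : |a / 2 * A + B + (-a * D + G)| ≤ |a / 2 * A| + |B| + (|-a * D| + |G|) :=
    (abs_add_le _ _).trans (add_le_add (abs_add_le _ _) (abs_add_le _ _))
  have h8 : 0 ≤ ‖v.dx‖ * ‖w.fn‖ ^ 2 + ‖u'.dx‖ * (‖w.fn‖ * ‖z.fn‖) := by positivity
  rw [energyConst]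
  calc _ ≤ _ := h7
    _ ≤ _ := add_le_add (add_le_add h5 h2) (add_le_add h6 h3)
    _ = (|a| + 1) * sobolevConst
        * (‖v.dx‖ * ‖w.fn‖ ^ 2 + ‖u'.dx‖ * (‖w.fn‖ * ‖z.fn‖)) := by ring
    _ ≤ _ := mul_le_mul_of_nonneg_right (by nlinarith) h8

theorem inner_nonlin_le (a : ℝ) (u v : H1) :
    |inner ℝ u.fn (nonlin a u v)| ≤ energyConst a * (‖v.dx‖ * ‖u.fn‖ ^ 2) := by
  have h := inner_nonlin_sub_le a u v 0 v
  rw [nonlin_zero_left, sub_zero, sub_zero] at h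
  have h2 : (0 : H1).dx = 0 := rfl
  simpa [h2] using h

/-- The coefficients of the nonlinearity, written without derivatives of the unknowns. -/
def nonlinCoef (a : ℝ) (k : ℤ) (f g : L2) : ℝ :=
  a * (inner ℝ ((k : ℝ) • toL2 (hartley (-k))) (mulL (antiderivC (hilbert g)) f)
    + inner ℝ (mulL (hartley k) f) (hilbert g)) + inner ℝ (mulL (hartley k) g) (hilbert f)

theorem continuous_nonlinCoef (a : ℝ) (k : ℤ) :
    Continuous fun p : L2 × L2 => nonlinCoef a k p.1 p.2 := by
  unfold nonlinCoef
  fun_prop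

/-- The product rule moves the derivative from `u` onto the test function, so each coefficient
depends continuously on the pair in `L²` and survives limits taken there. -/
theorem coef_nonlin (a : ℝ) (k : ℤ) (u v : H1) :
    coef k (nonlin a u v) = nonlinCoef a k u.fn v.fn := by
  have h := leibniz_eq_zero (potential v.fn) u (hartleyH1 k)
  have e1 : (hartleyH1 k).fn = toL2 (hartley k) := rfl
  have e2 : (hartleyH1 k).dx = (k : ℝ) • toL2 (hartley (-k)) := rfl
  have e3 : ∀ (w : H1), mulL w.toC (toL2 (hartley k)) = mulL (hartley k) w.fn := fun w => by
    rw [mulL_toL2_comm, H1.toL2_toC]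
  rw [leibniz, toC_potential, potential_dx, e1, e2, ← inner_mulL u.toC, e3] at h
  rw [nonlin, map_add, map_smul, coef_eq_inner, coef_eq_inner, ← inner_mulL v.toC, e3, nonlinCoef,
    smul_eq_mul]
  linear_combination (-a) * h

/-! ### Approximate solutions and stability -/

/-- `(u, v)` is bounded by `R` in `H¹` on `[0,b]`, and its Hartley coefficients of index at most `n`
satisfy the evolution equations. -/
structure ApproxSol (a : ℝ) (n : ℕ) (b R : ℝ) (u v : ℝ → H1) : Prop where
  norm_fst : ∀ t ∈ Icc 0 b, ‖u t‖ ≤ R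
  norm_snd : ∀ t ∈ Icc 0 b, ‖v t‖ ≤ R
  deriv_fst : ∀ t ∈ Icc 0 b, ∀ k : ℤ, |k| ≤ n → HasDerivWithinAt (fun s => coef k (u s).fn)
    (coef k (nonlin a (u t) (v t))) (Icc 0 b) t
  deriv_snd : ∀ t ∈ Icc 0 b, ∀ k : ℤ, |k| ≤ n → HasDerivWithinAt (fun s => coef k (v s).fn)
    (coef k (nonlin a (v t) (u t))) (Icc 0 b) t

namespace ApproxSol

variable {a b R : ℝ} {n : ℕ} {u v : ℝ → H1}

/-- The system is invariant under exchange of its unknowns, so arguments need only be given for the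
first. -/
theorem symm (h : ApproxSol a n b R u v) : ApproxSol a n b R v u :=
  ⟨h.norm_snd, h.norm_fst, h.deriv_snd, h.deriv_fst⟩

theorem mono_level {m : ℕ} (h : ApproxSol a n b R u v) (hm : m ≤ n) : ApproxSol a m b R u v :=
  ⟨h.norm_fst, h.norm_snd,
    fun t ht k hk => h.deriv_fst t ht k (hk.trans (by exact_mod_cast hm)),
    fun t ht k hk => h.deriv_snd t ht k (hk.trans (by exact_mod_cast hm))⟩

theorem mono_bound {R' : ℝ} (h : ApproxSol a n b R u v) (hR : R ≤ R') :
    ApproxSol a n b R' u v :=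
  ⟨fun t ht => (h.norm_fst t ht).trans hR, fun t ht => (h.norm_snd t ht).trans hR,
    h.deriv_fst, h.deriv_snd⟩

theorem mono_time {b' : ℝ} (h : ApproxSol a n b R u v) (hb : b' ≤ b) :
    ApproxSol a n b' R u v :=
  have hs : Icc 0 b' ⊆ Icc 0 b := Icc_subset_Icc_right hb
  ⟨fun t ht => h.norm_fst t (hs ht), fun t ht => h.norm_snd t (hs ht),
    fun t ht k hk => (h.deriv_fst t (hs ht) k hk).mono hs,
    fun t ht k hk => (h.deriv_snd t (hs ht) k hk).mono hs⟩

/-- With `reverse`, this allows any time to serve as the initial one, in either direction. -/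
theorem shift (h : ApproxSol a n b R u v) {t₀ : ℝ} (h0 : 0 ≤ t₀) :
    ApproxSol a n (b - t₀) R (fun s => u (t₀ + s)) (fun s => v (t₀ + s)) := by
  have hm : MapsTo (fun s => t₀ + s) (Icc 0 (b - t₀)) (Icc 0 b) := fun s hs =>
    ⟨add_nonneg h0 hs.1, by linarith [hs.2]⟩
  refine ⟨fun t ht => h.norm_fst _ (hm ht), fun t ht => h.norm_snd _ (hm ht),
    fun t ht k hk => ?_, fun t ht k hk => ?_⟩
  · simpa [Function.comp_def] using (h.deriv_fst _ (hm ht) k hk).scomp t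
      ((hasDerivAt_id t).const_add t₀).hasDerivWithinAt hm
  · simpa [Function.comp_def] using (h.deriv_snd _ (hm ht) k hk).scomp t
      ((hasDerivAt_id t).const_add t₀).hasDerivWithinAt hm

/-- Time reversal. -/
theorem reverse (h : ApproxSol a n b R u v) {t₀ : ℝ} (h0 : t₀ ≤ b) :
    ApproxSol a n t₀ R (fun s => -u (t₀ - s)) (fun s => -v (t₀ - s)) := by
  have hm : MapsTo (fun s => t₀ - s) (Icc 0 t₀) (Icc 0 b) := fun s hs =>
    ⟨sub_nonneg.2 hs.2, by linarith [hs.1]⟩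
  refine ⟨fun t ht => (norm_neg _).trans_le (h.norm_fst _ (hm ht)),
    fun t ht => (norm_neg _).trans_le (h.norm_snd _ (hm ht)),
    fun t ht k hk => ?_, fun t ht k hk => ?_⟩
  · have := ((h.deriv_fst _ (hm ht) k hk).scomp t
      ((hasDerivAt_id t).const_sub t₀).hasDerivWithinAt hm).fun_neg
    simpa [Function.comp_def, H1.neg_fn, nonlin_neg_neg] using this
  · have := ((h.deriv_snd _ (hm ht) k hk).scomp t
      ((hasDerivAt_id t).const_sub t₀).hasDerivWithinAt hm).fun_neg
    simpa [Function.comp_def, H1.neg_fn, nonlin_neg_neg] using this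

end ApproxSol

theorem ApproxSol.hasDerivWithinAt_proj {a b R : ℝ} {n : ℕ} {u v : ℝ → H1}
    (h : ApproxSol a n b R u v) {t : ℝ} (ht : t ∈ Icc 0 b) :
    HasDerivWithinAt (fun s => proj n (u s).fn) (proj n (nonlin a (u t) (v t))) (Icc 0 b) t := by
  simp only [proj_eq_sum]
  refine HasDerivWithinAt.fun_sum fun k hk => ?_
  rw [Finset.mem_Icc, ← abs_le] at hk
  exact (h.deriv_fst t ht k hk).smul_const _

/-- Only indices with `|k| ≥ n + 1` remain, and there one derivative gains the factor `|k|`. -/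
theorem norm_sub_proj_le (n : ℕ) (u : H1) : ‖u.fn - proj n u.fn‖ ≤ ‖u.dx‖ / (n + 1) := by
  refine le_of_sq_le_sq ?_ (by positivity)
  have h1 := hasSum_coef_sq (u.fn - proj n u.fn)
  have h2 := ((Equiv.neg ℤ).hasSum_iff.2 (hasSum_coef_sq u.dx)).mul_left (((n : ℝ) + 1)⁻¹ ^ 2)
  refine (hasSum_le (fun k => ?_) h1 h2).trans_eq (by rw [div_eq_mul_inv]; ring)
  simp only [Function.comp, Equiv.neg_apply, H1.coef_dx, neg_neg, map_sub, coef_proj]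
  push_cast
  rw [← mul_pow, neg_neg, ← mul_assoc, mul_pow _ (coef k u.fn)]
  split_ifs with hk
  · rw [sub_self, zero_pow two_ne_zero]; positivity
  · rw [sub_zero]
    refine le_mul_of_one_le_left (sq_nonneg _) ?_
    have h3 : (n : ℝ) + 1 ≤ |(k : ℝ)| := by
      have : (n : ℤ) + 1 ≤ |k| := by omega
      exact_mod_cast this
    rw [← sq_abs, abs_mul, abs_inv, abs_of_pos (by positivity : (0 : ℝ) < n + 1)]
    refine one_le_pow₀ ?_
    rw [inv_mul_eq_div, one_le_div (by positivity)]
    exact h3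

theorem norm_sq_le_proj (n : ℕ) (u : H1) :
    ‖u.fn‖ ^ 2 ≤ ‖proj n u.fn‖ ^ 2 + (‖u.dx‖ / (n + 1)) ^ 2 := by
  have h0 : inner ℝ (proj n u.fn) (u.fn - proj n u.fn) = 0 := by
    rw [inner_proj, map_sub, proj_proj, sub_self, inner_zero_right]
  have h1 := norm_add_sq_real (proj n u.fn) (u.fn - proj n u.fn)
  rw [h0, add_sub_cancel] at h1
  have h2 := norm_sub_proj_le n u
  have h3 : ‖u.fn - proj n u.fn‖ ^ 2 ≤ (‖u.dx‖ / (n + 1)) ^ 2 :=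
    pow_le_pow_left₀ (norm_nonneg _) h2 2
  linarith

/-- Grönwall's inequality for a function differentiable on a compact interval. -/
theorem le_of_deriv_le_linear {y y' : ℝ → ℝ} {b L ε : ℝ} (hL : 1 ≤ L) (hε : 0 ≤ ε)
    (hy : ∀ t ∈ Icc 0 b, HasDerivWithinAt y (y' t) (Icc 0 b) t) (hy0 : 0 ≤ y 0)
    (hbound : ∀ t ∈ Icc 0 b, y' t ≤ L * y t + ε) :
    ∀ t ∈ Icc 0 b, y t ≤ (y 0 + ε) * Real.exp (L * b) := by
  intro t ht
  have h := le_gronwallBound_of_liminf_deriv_right_le (f := y) (f' := y') (δ := y 0) (K := L)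
    (ε := ε) (a := 0) (b := b) (fun s hs => (hy s hs).continuousWithinAt)
    (fun s hs r hr => by
      refine HasDerivWithinAt.liminf_right_slope_le ?_ hr
      exact (hy s (Ico_subset_Icc_self hs)).mono_of_mem_nhdsWithin (Icc_mem_nhdsGE_of_mem hs))
    le_rfl (fun s hs => hbound s (Ico_subset_Icc_self hs)) t ht
  refine h.trans ?_
  rw [sub_zero, gronwallBound_of_K_ne_0 (by positivity)]
  have h1 : Real.exp (L * t) ≤ Real.exp (L * b) :=
    Real.exp_le_exp.2 (mul_le_mul_of_nonneg_left ht.2 (by positivity))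
  have h2 : ε / L ≤ ε := div_le_self hε hL
  have h3 : 0 ≤ ε / L := by positivity
  have h4 : 1 ≤ Real.exp (L * t) := Real.one_le_exp (mul_nonneg (by positivity) ht.1)
  have h5 : ε / L * (Real.exp (L * t) - 1) ≤ ε * Real.exp (L * b) :=
    mul_le_mul h2 (by linarith) (by linarith) hε
  have h6 := mul_le_mul_of_nonneg_left h1 hy0
  linarith

/-- One half of the stability estimate. -/
theorem inner_proj_nonlin_sub_le {a R : ℝ} (n : ℕ) {u v u' v' : H1}
    (hu : ‖u‖ ≤ R) (hv : ‖v‖ ≤ R) (hu' : ‖u'‖ ≤ R) (hv' : ‖v'‖ ≤ R) :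
    inner ℝ (proj n (u - u').fn) (proj n (nonlin a u v) - proj n (nonlin a u' v'))
      ≤ energyConst a * R * (‖(u - u').fn‖ ^ 2 + ‖(u - u').fn‖ * ‖(v - v').fn‖)
        + 4 * nonlinConst a * R ^ 3 / (n + 1) := by
  have hR : 0 ≤ R := (norm_nonneg _).trans hu
  have hK := (energyConst_pos a).le
  have hC := nonlinConst_nonneg a
  -- One projection suffices in the pairing. Dropping it gives the energy estimate; the error pairs
  -- a tail of size `O(1/n)` with a bounded nonlinearity.
  rw [← map_sub, ← inner_proj, proj_proj]
  set w := u - u'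
  set Z := nonlin a u v - nonlin a u' v'
  have h1 : inner ℝ (proj n w.fn) Z = inner ℝ w.fn Z - inner ℝ (w.fn - proj n w.fn) Z := by
    rw [inner_sub_left]; ring
  have h2 : inner ℝ w.fn Z ≤ energyConst a * R * (‖w.fn‖ ^ 2 + ‖w.fn‖ * ‖(v - v').fn‖) := by
    refine (le_abs_self _).trans ((inner_nonlin_sub_le a u v u' v').trans ?_)
    rw [mul_assoc, mul_add R]
    refine mul_le_mul_of_nonneg_left (add_le_add ?_ ?_) hK
    · exact mul_le_mul_of_nonneg_right (v.norm_dx_le.trans hv) (by positivity)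
    · exact mul_le_mul_of_nonneg_right (u'.norm_dx_le.trans hu') (by positivity)
  have h3 : ‖Z‖ ≤ 2 * nonlinConst a * R ^ 2 := by
    have e : ∀ p q : H1, ‖p‖ ≤ R → ‖q‖ ≤ R → ‖nonlin a p q‖ ≤ nonlinConst a * R * R :=
      fun p q hp hq => (norm_nonlin_le a p q).trans
        (mul_le_mul (mul_le_mul_of_nonneg_left hp hC) hq (norm_nonneg _) (by positivity))
    calc ‖Z‖ ≤ ‖nonlin a u v‖ + ‖nonlin a u' v'‖ := norm_sub_le _ _
      _ ≤ nonlinConst a * R * R + nonlinConst a * R * R := add_le_add (e _ _ hu hv) (e _ _ hu' hv')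
      _ = _ := by ring
  have h4 : ‖w.fn - proj n w.fn‖ ≤ 2 * R / (n + 1) := by
    refine (norm_sub_proj_le n w).trans (div_le_div_of_nonneg_right ?_ (by positivity))
    exact w.norm_dx_le.trans ((norm_sub_le _ _).trans (by linarith))
  have h5 : |inner ℝ (w.fn - proj n w.fn) Z| ≤ 4 * nonlinConst a * R ^ 3 / (n + 1) := by
    refine (abs_real_inner_le_norm _ _).trans
      ((mul_le_mul h4 h3 (norm_nonneg _) (by positivity)).trans_eq (by ring))
  rw [h1]
  have := neg_abs_le (inner ℝ (w.fn - proj n w.fn) Z)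
  linarith

/-- Two approximate solutions of level `n` stay close in `L²`, up to an error `O(1/n)`. -/
theorem ApproxSol.stability (a b R : ℝ) : ∃ C : ℝ, 0 ≤ C ∧
    ∀ (n : ℕ) (u v u' v' : ℝ → H1), ApproxSol a n b R u v → ApproxSol a n b R u' v' →
    ∀ t ∈ Icc 0 b, ‖(u t).fn - (u' t).fn‖ ^ 2 + ‖(v t).fn - (v' t).fn‖ ^ 2
      ≤ C * (‖proj n ((u 0).fn - (u' 0).fn)‖ ^ 2 + ‖proj n ((v 0).fn - (v' 0).fn)‖ ^ 2
        + 1 / (n + 1)) := by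
  by_cases hR : 0 ≤ R
  swap
  · exact ⟨0, le_rfl, fun n u v u' v' h _ t ht =>
      absurd ((norm_nonneg _).trans (h.norm_fst t ht)) hR⟩
  have hK := (energyConst_pos a).le
  have hC := nonlinConst_nonneg a
  -- `4 K R` is twice the sum of the two halves, after `2PQ ≤ P² + Q²`; the `1` secures `1 ≤ L`. `M`
  -- collects `L` times the tail `8R²/(n+1)` and four remainders `4 C R³/(n+1)`, where `C` is
  -- `nonlinConst a`.
  set L : ℝ := 1 + 4 * energyConst a * R with hL
  set M : ℝ := L * (8 * R ^ 2) + 16 * nonlinConst a * R ^ 3 with hM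
  have hL1 : 1 ≤ L := le_add_of_nonneg_right (by positivity)
  have hM0 : 0 ≤ M := by positivity
  have hexp := Real.exp_pos (L * b)
  refine ⟨(1 + M) * Real.exp (L * b) + 8 * R ^ 2, by positivity, ?_⟩
  intro n u v u' v' h h' t ht
  have hn : (0 : ℝ) < n + 1 := by positivity
  have hn1 : (1 : ℝ) / (n + 1) ≤ 1 := by
    rw [div_le_one hn]; linarith [n.cast_nonneg (α := ℝ)]
  -- the low-frequency part of the distance
  set y : ℝ → ℝ := fun s => ‖proj n ((u s).fn - (u' s).fn)‖ ^ 2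
    + ‖proj n ((v s).fn - (v' s).fn)‖ ^ 2 with hy
  have hderiv : ∀ s ∈ Icc 0 b, HasDerivWithinAt y
      (2 * inner ℝ (proj n (u s - u' s).fn)
          (proj n (nonlin a (u s) (v s)) - proj n (nonlin a (u' s) (v' s)))
        + 2 * inner ℝ (proj n (v s - v' s).fn)
          (proj n (nonlin a (v s) (u s)) - proj n (nonlin a (v' s) (u' s)))) (Icc 0 b) s := by
    intro s hs
    have h1 := ((h.hasDerivWithinAt_proj hs).sub (h'.hasDerivWithinAt_proj hs)).norm_sq
    have h2 := ((h.symm.hasDerivWithinAt_proj hs).sub (h'.symm.hasDerivWithinAt_proj hs)).norm_sq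
    have := h1.fun_add h2
    simpa only [hy, H1.sub_fn, map_sub, Pi.sub_apply] using this
  have htail : ∀ s ∈ Icc 0 b, ∀ p q : H1, ‖p‖ ≤ R → ‖q‖ ≤ R →
      ‖(p - q).fn‖ ^ 2 ≤ ‖proj n (p.fn - q.fn)‖ ^ 2 + 4 * R ^ 2 * (1 / (n + 1)) := by
    intro s hs p q hp hq
    refine (norm_sq_le_proj n (p - q)).trans (add_le_add le_rfl ?_)
    have h1 : ‖(p - q).dx‖ ≤ 2 * R :=
      (p - q).norm_dx_le.trans ((norm_sub_le _ _).trans (by linarith))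
    calc (‖(p - q).dx‖ / (n + 1)) ^ 2 ≤ (2 * R / (n + 1)) ^ 2 := by gcongr
      _ = 4 * R ^ 2 * (1 / (n + 1)) * (1 / (n + 1)) := by ring
      _ ≤ 4 * R ^ 2 * (1 / (n + 1)) * 1 := mul_le_mul_of_nonneg_left hn1 (by positivity)
      _ = _ := mul_one _
  have hdist : ∀ s ∈ Icc 0 b, ‖(u s - u' s).fn‖ ^ 2 + ‖(v s - v' s).fn‖ ^ 2
      ≤ y s + 8 * R ^ 2 * (1 / (n + 1)) := by
    intro s hs
    have h1 := htail s hs _ _ (h.norm_fst s hs) (h'.norm_fst s hs)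
    have h2 := htail s hs _ _ (h.norm_snd s hs) (h'.norm_snd s hs)
    simp only [hy]
    linarith
  have hy0 : 0 ≤ y 0 := by positivity
  have hgron := le_of_deriv_le_linear hL1 (ε := M * (1 / (n + 1))) (by positivity) hderiv hy0
    (fun s hs => by
      have h1 := inner_proj_nonlin_sub_le (a := a) n (h.norm_fst s hs) (h.norm_snd s hs)
        (h'.norm_fst s hs) (h'.norm_snd s hs)
      have h2 := inner_proj_nonlin_sub_le (a := a) n (h.norm_snd s hs) (h.norm_fst s hs)
        (h'.norm_snd s hs) (h'.norm_fst s hs)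
      have h3 := hdist s hs
      set P := ‖(u s - u' s).fn‖
      set Q := ‖(v s - v' s).fn‖
      have h4 : energyConst a * R * (P ^ 2 + P * Q) + energyConst a * R * (Q ^ 2 + Q * P)
          ≤ 2 * energyConst a * R * (P ^ 2 + Q ^ 2) := by
        have := mul_nonneg (mul_nonneg hK hR) (sq_nonneg (P - Q))
        nlinarith
      have h5 : 4 * energyConst a * R * (P ^ 2 + Q ^ 2) ≤ L * (P ^ 2 + Q ^ 2) :=
        mul_le_mul_of_nonneg_right (by linarith) (by positivity)
      have h6 := mul_le_mul_of_nonneg_left h3 (zero_le_one.trans hL1)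
      have h7 : M * (1 / (n + 1)) = L * (8 * R ^ 2 * (1 / (n + 1)))
          + 4 * (4 * nonlinConst a * R ^ 3 / (n + 1)) := by rw [hM]; ring
      rw [h7]
      linarith) t ht
  have h1 := hdist t ht
  rw [H1.sub_fn, H1.sub_fn] at h1
  have h2 : (y 0 + M * (1 / (n + 1))) * Real.exp (L * b)
      ≤ (1 + M) * Real.exp (L * b) * (y 0 + 1 / (n + 1)) := by
    have e : y 0 + M * (1 / (n + 1)) ≤ (1 + M) * (y 0 + 1 / (n + 1)) := by
      have := mul_nonneg hM0 hy0
      have : 0 ≤ 1 / ((n : ℝ) + 1) := by positivity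
      nlinarith
    calc _ ≤ (1 + M) * (y 0 + 1 / (n + 1)) * Real.exp (L * b) :=
          mul_le_mul_of_nonneg_right e hexp.le
      _ = _ := by ring
  have h3 : 8 * R ^ 2 * (1 / (n + 1)) ≤ 8 * R ^ 2 * (y 0 + 1 / (n + 1)) :=
    mul_le_mul_of_nonneg_left (by linarith) (by positivity)
  rw [add_mul]
  linarith

/-- Bounded weak solutions are determined by their initial data. -/
theorem ApproxSol.unique {a b R : ℝ} {u v u' v' : ℝ → H1}
    (h : ∀ n, ApproxSol a n b R u v) (h' : ∀ n, ApproxSol a n b R u' v')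
    (hu : u 0 = u' 0) (hv : v 0 = v' 0) : ∀ t ∈ Icc 0 b, u t = u' t ∧ v t = v' t := by
  intro t ht
  obtain ⟨C, hC, hstab⟩ := ApproxSol.stability a b R
  -- Equal data leave only the error `1/(n+1)`, and `n` is arbitrary.
  have h1 : ∀ n : ℕ, ‖(u t).fn - (u' t).fn‖ ^ 2 + ‖(v t).fn - (v' t).fn‖ ^ 2
      ≤ C * (1 / ((n : ℝ) + 1)) := fun n => by
    simpa [hu, hv] using hstab n u v u' v' (h n) (h' n) t ht
  have h2 : ‖(u t).fn - (u' t).fn‖ ^ 2 + ‖(v t).fn - (v' t).fn‖ ^ 2 ≤ 0 := by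
    have := (tendsto_one_div_add_atTop_nhds_zero_nat (𝕜 := ℝ)).const_mul C
    rw [mul_zero] at this
    exact ge_of_tendsto' this h1
  have h3 : ‖(u t).fn - (u' t).fn‖ = 0 := by
    nlinarith [sq_nonneg ‖(u t).fn - (u' t).fn‖, sq_nonneg ‖(v t).fn - (v' t).fn‖]
  have h4 : ‖(v t).fn - (v' t).fn‖ = 0 := by
    nlinarith [sq_nonneg ‖(u t).fn - (u' t).fn‖, sq_nonneg ‖(v t).fn - (v' t).fn‖]
  exact ⟨H1.ext_fn (sub_eq_zero.1 (norm_eq_zero.1 h3)),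
    H1.ext_fn (sub_eq_zero.1 (norm_eq_zero.1 h4))⟩

/-! ### Galerkin approximations -/

/-- A continuous cutoff equal to `1` on `[0,R]` and to `0` beyond `2R`. -/
def cutoff (R s : ℝ) : ℝ := max 0 (min 1 (2 - s / R))

theorem cutoff_nonneg (R s : ℝ) : 0 ≤ cutoff R s := le_max_left _ _

theorem cutoff_le_one (R s : ℝ) : cutoff R s ≤ 1 := max_le zero_le_one (min_le_left _ _)

theorem cutoff_eq_one {R s : ℝ} (hR : 0 < R) (hs : s ≤ R) : cutoff R s = 1 := by
  have : s / R ≤ 1 := (div_le_one hR).2 hs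
  rw [cutoff, min_eq_left (by linarith), max_eq_right zero_le_one]

theorem cutoff_eq_zero {R s : ℝ} (hR : 0 < R) (hs : 2 * R ≤ s) : cutoff R s = 0 := by
  have : 2 ≤ s / R := (le_div_iff₀ hR).2 hs
  rw [cutoff, min_eq_right (by linarith), max_eq_left (by linarith)]

theorem abs_cutoff_sub_le {R : ℝ} (hR : 0 < R) (s t : ℝ) :
    |cutoff R s - cutoff R t| ≤ |s - t| / R := by
  have h1 : |cutoff R s - cutoff R t| ≤ |min 1 (2 - s / R) - min 1 (2 - t / R)| := by
    unfold cutoff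
    simpa using abs_max_sub_max_le_max 0 (min 1 (2 - s / R)) 0 (min 1 (2 - t / R))
  have h2 : |min 1 (2 - s / R) - min 1 (2 - t / R)| ≤ |(2 - s / R) - (2 - t / R)| := by
    simpa using abs_min_sub_min_le_max 1 (2 - s / R) 1 (2 - t / R)
  have h3 : (2 - s / R) - (2 - t / R) = -((s - t) / R) := by ring
  rw [h3, abs_neg, abs_div, abs_of_pos hR] at h2
  exact h1.trans h2

/-- Global solutions of an ordinary differential equation with cut-off right-hand side. -/
theorem exists_cutoff_solution {E : Type*} [NormedAddCommGroup E] [NormedSpace ℝ E]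
    [CompleteSpace E] (B : E → E)
    (hB : ∀ r : ℝ, ∃ K : ℝ, ∀ x y, ‖x‖ ≤ r → ‖y‖ ≤ r → ‖B x - B y‖ ≤ K * ‖x - y‖)
    (P : E →L[ℝ] E) (hP : ∀ x, ‖P x‖ ≤ ‖x‖) {R : ℝ} (hR : 0 < R) (x₀ : E) {b : ℝ} (hb : 0 ≤ b) :
    ∃ (x : ℝ → E) (c : ℝ → ℝ), x 0 = x₀ ∧ ∀ t ∈ Icc 0 b, 0 ≤ c t ∧ c t ≤ 1 ∧
      (‖P (x t)‖ ≤ R → c t = 1) ∧ HasDerivWithinAt x (c t • B (P (x t))) (Icc 0 b) t := by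
  have hbd : ∀ r : ℝ, ∃ M : ℝ, 0 ≤ M ∧ ∀ x, ‖x‖ ≤ r → ‖B x‖ ≤ M := by
    intro r
    obtain ⟨K, hK⟩ := hB (max r 0)
    refine ⟨|K| * |r| + ‖B 0‖, by positivity, fun x hx => ?_⟩
    have h1 := hK x 0 (hx.trans (le_max_left _ _)) (by simp)
    rw [sub_zero] at h1
    have h2 : ‖B x‖ ≤ ‖B x - B 0‖ + ‖B 0‖ := by
      simpa using norm_add_le (B x - B 0) (B 0)
    have h3 : K * ‖x‖ ≤ |K| * |r| :=
      mul_le_mul (le_abs_self _) (hx.trans (le_abs_self _)) (norm_nonneg _) (abs_nonneg _)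
    linarith
  set V : E → E := fun x => cutoff R ‖P x‖ • B (P x) with hV
  -- The cut-off field vanishes where `‖P x‖ ≥ 2R`, so it is bounded by `M` on the whole space
  -- although `x` itself may be large.
  obtain ⟨M, hM0, hM⟩ := hbd (2 * R)
  have hVbd : ∀ x, ‖V x‖ ≤ M := by
    intro x
    rw [hV]
    simp only [norm_smul, Real.norm_of_nonneg (cutoff_nonneg _ _)]
    by_cases h : ‖P x‖ ≤ 2 * R
    · exact (mul_le_of_le_one_left (norm_nonneg _) (cutoff_le_one _ _)).trans (hM _ h)
    · rw [cutoff_eq_zero hR (not_le.1 h).le, zero_mul]; exact hM0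
  have hVlip : ∀ r : ℝ, ∃ K : NNReal, LipschitzOnWith K V (Metric.closedBall x₀ r) := by
    intro r
    obtain ⟨K, hK⟩ := hB (‖x₀‖ + r)
    obtain ⟨M', hM'0, hM'⟩ := hbd (‖x₀‖ + r)
    refine ⟨Real.toNNReal (M' / R + |K|), LipschitzOnWith.of_dist_le_mul fun x hx y hy => ?_⟩
    have hball : ∀ z ∈ Metric.closedBall x₀ r, ‖P z‖ ≤ ‖x₀‖ + r := fun z hz =>
      (hP z).trans (norm_le_of_mem_closedBall hz)
    rw [Real.coe_toNNReal _ (by positivity), dist_eq_norm, dist_eq_norm]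
    have e : V x - V y = (cutoff R ‖P x‖ - cutoff R ‖P y‖) • B (P x)
        + cutoff R ‖P y‖ • (B (P x) - B (P y)) := by
      simp only [hV]; module
    have hxy : ‖P x - P y‖ ≤ ‖x - y‖ := by rw [← map_sub]; exact hP _
    have h1 : |cutoff R ‖P x‖ - cutoff R ‖P y‖| ≤ ‖x - y‖ / R :=
      (abs_cutoff_sub_le hR _ _).trans (div_le_div_of_nonneg_right
        ((abs_norm_sub_norm_le _ _).trans hxy) hR.le)
    have h2 : ‖B (P x) - B (P y)‖ ≤ |K| * ‖x - y‖ :=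
      (hK _ _ (hball x hx) (hball y hy)).trans
        (mul_le_mul (le_abs_self _) hxy (norm_nonneg _) (abs_nonneg _))
    rw [e]
    calc _ ≤ |cutoff R ‖P x‖ - cutoff R ‖P y‖| * ‖B (P x)‖
          + cutoff R ‖P y‖ * ‖B (P x) - B (P y)‖ := by
          refine (norm_add_le _ _).trans ?_
          rw [norm_smul, norm_smul, Real.norm_eq_abs, Real.norm_of_nonneg (cutoff_nonneg _ _)]
      _ ≤ ‖x - y‖ / R * M' + 1 * (|K| * ‖x - y‖) :=
          add_le_add (mul_le_mul h1 (hM' _ (hball x hx)) (norm_nonneg _) (by positivity))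
            (mul_le_mul (cutoff_le_one _ _) h2 (norm_nonneg _) zero_le_one)
      _ = _ := by ring
  -- At speed at most `M` a solution stays within distance `M b` of `x₀`; with this radius
  -- Picard–Lindelöf covers all of `[0,b]`.
  obtain ⟨K, hK⟩ := hVlip ((⟨M, hM0⟩ * ⟨b, hb⟩ : NNReal) : ℝ)
  have hpl : IsPicardLindelof (fun _ => V) (⟨0, left_mem_Icc.2 hb⟩ : Icc 0 b) x₀
      (⟨M, hM0⟩ * ⟨b, hb⟩) 0 ⟨M, hM0⟩ K :=
    IsPicardLindelof.of_time_independent (fun x _ => hVbd x) hK (by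
      change M * max (b - 0) (0 - 0) ≤ M * b - 0
      rw [sub_zero, sub_zero, sub_zero, max_eq_left hb])
  obtain ⟨x, hx0, hx⟩ := hpl.exists_eq_forall_mem_Icc_hasDerivWithinAt₀
  exact ⟨x, fun t => cutoff R ‖P (x t)‖, hx0, fun t ht =>
    ⟨cutoff_nonneg _ _, cutoff_le_one _ _, fun h => cutoff_eq_one hR h, hx t ht⟩⟩

/-! ### The comparison equation and the Galerkin system -/

/-- The solution at time `t` of `y' = 2 K y^(3/2)`, `y 0 = 1 + e`. -/
def lifeBound (K e t : ℝ) : ℝ := (((√(1 + e))⁻¹ - K * t) ^ 2)⁻¹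

theorem lifeBound_zero (K : ℝ) {e : ℝ} (he : 0 ≤ e) : lifeBound K e 0 = 1 + e := by
  rw [lifeBound, mul_zero, sub_zero, inv_pow, inv_inv, Real.sq_sqrt (by positivity)]

theorem continuousAt_lifeBound (K : ℝ) {e : ℝ} (he : 0 ≤ e) :
    ContinuousAt (lifeBound K e) 0 := by
  unfold lifeBound
  refine ContinuousAt.inv₀ (by fun_prop) ?_
  rw [mul_zero, sub_zero]
  positivity

theorem lifeBound_le {K e t b : ℝ} (hK : 0 ≤ K) (he : 0 ≤ e)
    (hb : K * b ≤ 1 / 2 * (√(1 + e))⁻¹) (ht : t ≤ b) : lifeBound K e t ≤ 4 * (1 + e) := by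
  have h0 : 0 < (√(1 + e))⁻¹ := by positivity
  have h1 : 1 / 2 * (√(1 + e))⁻¹ ≤ (√(1 + e))⁻¹ - K * t := by
    have := mul_le_mul_of_nonneg_left ht hK
    linarith
  have h2 : (1 / 2 * (√(1 + e))⁻¹) ^ 2 ≤ ((√(1 + e))⁻¹ - K * t) ^ 2 :=
    pow_le_pow_left₀ (by positivity) h1 2
  calc lifeBound K e t ≤ ((1 / 2 * (√(1 + e))⁻¹) ^ 2)⁻¹ := inv_anti₀ (by positivity) h2
    _ = 4 * (1 + e) := by
      rw [mul_pow, inv_pow, Real.sq_sqrt (by positivity)]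
      field_simp; norm_num

/-- Comparison for the differential inequality `y' ≤ 2 K y^(3/2)`. -/
theorem add_one_le_lifeBound {y y' : ℝ → ℝ} {b K e : ℝ} (hK : 0 ≤ K)
    (hb : K * b ≤ 1 / 2 * (√(1 + e))⁻¹)
    (hy : ∀ t ∈ Icc 0 b, HasDerivWithinAt y (y' t) (Icc 0 b) t) (hpos : ∀ t, 0 ≤ y t)
    (hy0 : y 0 ≤ e) (hbound : ∀ t ∈ Icc 0 b, y' t ≤ 2 * K * (y t * √(y t))) :
    ∀ t ∈ Icc 0 b, y t + 1 ≤ lifeBound K e t := by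
  have he : 0 ≤ e := (hpos 0).trans hy0
  have hz : ∀ t ∈ Icc 0 b, HasDerivWithinAt (fun s => (√(1 + y s))⁻¹ + K * s)
      (-(y' t / (2 * √(1 + y t))) / √(1 + y t) ^ 2 + K) (Icc 0 b) t := by
    intro t ht
    have h1 : 0 < 1 + y t := by linarith [hpos t]
    have h2 := (((hy t ht).const_add 1).sqrt h1.ne').fun_inv (Real.sqrt_pos.2 h1).ne'
    have h3 : HasDerivWithinAt (fun s => K * s) K (Icc 0 b) t := by
      simpa using ((hasDerivAt_id t).const_mul K).hasDerivWithinAt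
    exact h2.fun_add h3
  -- The power `-1/2` turns the inequality into a linear one: `(1 + y)^(-1/2)` decreases at rate at
  -- most `K`. Adding `1` keeps the root away from zero.
  have hmono : MonotoneOn (fun s => (√(1 + y s))⁻¹ + K * s) (Icc 0 b) := by
    refine monotoneOn_of_hasDerivWithinAt_nonneg (convex_Icc 0 b)
      (fun t ht => (hz t ht).continuousWithinAt)
      (fun t ht => (hz t (interior_subset ht)).mono interior_subset) fun t ht => ?_
    have ht' := interior_subset ht
    have h0 := hpos t
    set r := √(1 + y t) with hr
    have hr2 : r ^ 2 = 1 + y t := Real.sq_sqrt (by linarith)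
    have hr0 : 0 < r := Real.sqrt_pos.2 (by linarith)
    have h1 : y t * √(y t) ≤ r ^ 2 * r :=
      mul_le_mul (by linarith) (Real.sqrt_le_sqrt (by linarith)) (Real.sqrt_nonneg _) (by positivity)
    have h2 : y' t ≤ 2 * K * (r ^ 2 * r) :=
      (hbound t ht').trans (mul_le_mul_of_nonneg_left h1 (by positivity))
    have h3 : y' t / (2 * r) / r ^ 2 ≤ K := by
      rw [div_div, div_le_iff₀ (by positivity)]
      linarith
    rw [neg_div]
    linarith
  intro t ht
  have h0 : (0 : ℝ) ∈ Icc 0 b := ⟨le_rfl, ht.1.trans ht.2⟩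
  have h1 := hmono h0 ht ht.1
  simp only [mul_zero, add_zero] at h1
  have h2 : (√(1 + e))⁻¹ ≤ (√(1 + y 0))⁻¹ :=
    inv_anti₀ (Real.sqrt_pos.2 (by linarith [hpos 0])) (Real.sqrt_le_sqrt (by linarith))
  have h3 : 0 < (√(1 + e))⁻¹ - K * t := by
    have := mul_le_mul_of_nonneg_left ht.2 hK
    have : 0 < (√(1 + e))⁻¹ := by positivity
    linarith
  have h4 : (√(1 + e))⁻¹ - K * t ≤ (√(1 + y t))⁻¹ := by linarith
  have h5 := inv_anti₀ (by positivity) (pow_le_pow_left₀ h3.le h4 2)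
  rw [inv_pow (√(1 + y t)), inv_inv, Real.sq_sqrt (by linarith [hpos t])] at h5
  rw [lifeBound]
  linarith

/-- The Galerkin vector field. -/
def galerkinField (a : ℝ) (n : ℕ) (x : L2 × L2) : L2 × L2 :=
  (proj n (nonlin a (trunc n x.1) (trunc n x.2)), proj n (nonlin a (trunc n x.2) (trunc n x.1)))

theorem norm_nonlin_sub_le (a : ℝ) (u v u' v' : H1) :
    ‖nonlin a u v - nonlin a u' v'‖
      ≤ nonlinConst a * (‖u - u'‖ * ‖v‖ + ‖u'‖ * ‖v - v'‖) := by
  rw [nonlin_sub]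
  refine (norm_add_le _ _).trans
    ((add_le_add (norm_nonlin_le a _ _) (norm_nonlin_le a _ _)).trans_eq (by ring))

/-- At fixed `n`, truncation is bounded from `L²` to `H¹`, so the field is a bounded quadratic map;
the constant may depend on `n`. -/
theorem galerkinField_lipschitz (a : ℝ) (n : ℕ) (r : ℝ) :
    ∃ K : ℝ, ∀ x y : L2 × L2, ‖x‖ ≤ r → ‖y‖ ≤ r →
      ‖galerkinField a n x - galerkinField a n y‖ ≤ K * ‖x - y‖ := by
  have hC := nonlinConst_nonneg a
  set τ := ‖trunc n‖ with hτ
  have hτ0 : 0 ≤ τ := ContinuousLinearMap.opNorm_nonneg _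
  have key : ∀ f g f' g' : L2, ∀ d, ‖g‖ ≤ r → ‖f'‖ ≤ r → ‖f - f'‖ ≤ d → ‖g - g'‖ ≤ d →
      ‖proj n (nonlin a (trunc n f) (trunc n g)) - proj n (nonlin a (trunc n f') (trunc n g'))‖
        ≤ nonlinConst a * (2 * τ ^ 2 * r) * d := by
    intro f g f' g' d hg hf' h1 h2
    have hr : 0 ≤ r := (norm_nonneg _).trans hg
    have hd : 0 ≤ d := (norm_nonneg _).trans h1
    have ht : ∀ (p : L2) (c : ℝ), ‖p‖ ≤ c → ‖trunc n p‖ ≤ τ * c := fun p c hp =>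
      ((trunc n).le_opNorm p).trans (mul_le_mul_of_nonneg_left hp hτ0)
    rw [← map_sub]
    refine (norm_proj_le _ _).trans ((norm_nonlin_sub_le a _ _ _ _).trans ?_)
    rw [← map_sub, ← map_sub, mul_assoc]
    refine mul_le_mul_of_nonneg_left ?_ hC
    calc _ ≤ τ * d * (τ * r) + τ * r * (τ * d) :=
          add_le_add (mul_le_mul (ht _ _ h1) (ht _ _ hg) (norm_nonneg _) (by positivity))
            (mul_le_mul (ht _ _ hf') (ht _ _ h2) (norm_nonneg _) (by positivity))
      _ = _ := by ring
  refine ⟨nonlinConst a * (2 * τ ^ 2 * r), fun x y hx hy => ?_⟩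
  have h1 : ‖x.1 - y.1‖ ≤ ‖x - y‖ := norm_fst_le (x - y)
  have h2 : ‖x.2 - y.2‖ ≤ ‖x - y‖ := norm_snd_le (x - y)
  have hx1 := (norm_fst_le x).trans hx
  have hx2 := (norm_snd_le x).trans hx
  have hy1 := (norm_fst_le y).trans hy
  have hy2 := (norm_snd_le y).trans hy
  rw [Prod.norm_def]
  exact max_le (key x.1 x.2 y.1 y.2 _ hx2 hy1 h1 h2) (key x.2 x.1 y.2 y.1 _ hx1 hy2 h2 h1)

/-- `derivProj n` is skew-adjoint and maps into trigonometric polynomials of degree at most `n`.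
Hence the smooth energy estimate applies with `w = u_x` itself such a polynomial, and the projection
costs nothing. -/
theorem inner_derivProj_nonlin_le (a : ℝ) (n : ℕ) (f : L2) (v : H1) :
    |inner ℝ (derivProj n f) (derivProj n (nonlin a (trunc n f) v))|
      ≤ energyConst a * (‖v.dx‖ * ‖(trunc n f).dx‖ ^ 2) := by
  have h := abs_inner_dx_nonlin_le a (u := trunc n f) (v := v) (w := trunc n (derivProj n f))
    (proj_derivProj n f)
  rw [trunc_dx, inner_derivProj, abs_neg] at h
  exact h

set_option maxHeartbeats 1000000 in
/-- Galerkin approximations, bounded uniformly on a time interval whose length depends only on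
the homogeneous Sobolev norm of the data. -/
theorem exists_galerkin (a : ℝ) (u₀ v₀ : H1) {b : ℝ} (hb0 : 0 ≤ b)
    (hb : energyConst a * b ≤ 1 / 2 * (√(1 + (‖u₀.dx‖ ^ 2 + ‖v₀.dx‖ ^ 2)))⁻¹) :
    ∃ R : ℝ, ∀ n : ℕ, ∃ u v : ℝ → H1, ApproxSol a n b R u v ∧
      u 0 = trunc n u₀.fn ∧ v 0 = trunc n v₀.fn ∧
      ContinuousOn (fun t => (u t).fn) (Icc 0 b) ∧ ContinuousOn (fun t => (v t).fn) (Icc 0 b) ∧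
      ∀ t ∈ Icc 0 b, ‖(u t).dx‖ ^ 2 + ‖(v t).dx‖ ^ 2 + 1
        ≤ lifeBound (energyConst a) (‖u₀.dx‖ ^ 2 + ‖v₀.dx‖ ^ 2) t := by
  have hK := (energyConst_pos a).le
  set K := energyConst a with hKdef
  set e := ‖u₀.dx‖ ^ 2 + ‖v₀.dx‖ ^ 2 with he
  have he0 : 0 ≤ e := by positivity
  -- `E₁` bounds the homogeneous energy on `[0,b]` and `Y` is the resulting Grönwall bound in `L²`;
  -- `R` dominates the full `H¹` norm and is independent of `n`.
  set E₁ := 4 * (1 + e) with hE₁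
  have hE₁0 : 0 ≤ E₁ := by positivity
  set L := 1 + 2 * K * √E₁ with hL
  have hL1 : 1 ≤ L := le_add_of_nonneg_right (by positivity)
  set Y := (‖u₀.fn‖ ^ 2 + ‖v₀.fn‖ ^ 2) * Real.exp (L * b) with hY
  have hY0 : 0 ≤ Y := by positivity
  set R := √(Y + E₁) + 1 with hR
  have hR0 : 0 < R := by positivity
  have hR2 : Y + E₁ ≤ R ^ 2 := by
    have := Real.sq_sqrt (add_nonneg hY0 hE₁0)
    nlinarith [Real.sqrt_nonneg (Y + E₁)]
  refine ⟨R, fun n => ?_⟩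
  obtain ⟨x, c, hx0, hx⟩ := exists_cutoff_solution (galerkinField a n)
    (galerkinField_lipschitz a n) ((proj n).prodMap (proj n))
    (fun x => max_le_max (norm_proj_le n x.1) (norm_proj_le n x.2)) hR0 (u₀.fn, v₀.fn) hb0
  set f : ℝ → L2 := fun t => (x t).1 with hf
  set g : ℝ → L2 := fun t => (x t).2 with hg
  set u : ℝ → H1 := fun t => trunc n (f t) with hu
  set v : ℝ → H1 := fun t => trunc n (g t) with hv
  have hfd : ∀ t ∈ Icc 0 b, HasDerivWithinAt f (c t • proj n (nonlin a (u t) (v t)))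
      (Icc 0 b) t := by
    intro t ht
    have h := (ContinuousLinearMap.fst ℝ L2 L2).hasFDerivAt.comp_hasDerivWithinAt t (hx t ht).2.2.2
    simpa [galerkinField, trunc_proj, Function.comp_def] using h
  have hgd : ∀ t ∈ Icc 0 b, HasDerivWithinAt g (c t • proj n (nonlin a (v t) (u t)))
      (Icc 0 b) t := by
    intro t ht
    have h := (ContinuousLinearMap.snd ℝ L2 L2).hasFDerivAt.comp_hasDerivWithinAt t (hx t ht).2.2.2
    simpa [galerkinField, trunc_proj, Function.comp_def] using h
  have hclm : ∀ (A : L2 →L[ℝ] L2) (p q : ℝ → L2), (∀ t ∈ Icc 0 b, HasDerivWithinAt p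
      (c t • proj n (q t)) (Icc 0 b) t) → ∀ t ∈ Icc 0 b,
      HasDerivWithinAt (fun s => ‖A (p s)‖ ^ 2) (2 * (c t * inner ℝ (A (p t)) (A (proj n (q t)))))
        (Icc 0 b) t := by
    intro A p q h t ht
    have h1 := (A.hasFDerivAt.comp_hasDerivWithinAt t (h t ht)).norm_sq
    simpa only [Function.comp_def, map_smul, inner_smul_right] using h1
  -- the homogeneous energy
  have hen : ∀ t ∈ Icc 0 b, ‖(u t).dx‖ ^ 2 + ‖(v t).dx‖ ^ 2 + 1 ≤ lifeBound K e t := by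
    refine add_one_le_lifeBound (y := fun t => ‖(u t).dx‖ ^ 2 + ‖(v t).dx‖ ^ 2) hK hb
      (fun t ht => (hclm (derivProj n) f _ hfd t ht).fun_add (hclm (derivProj n) g _ hgd t ht))
      (fun t => by positivity) ?_ fun t ht => ?_
    · have h1 : ∀ w : H1, ‖(trunc n w.fn).dx‖ ^ 2 ≤ ‖w.dx‖ ^ 2 := fun w => by
        rw [trunc_dx, derivProj_fn]
        exact pow_le_pow_left₀ (norm_nonneg _) (norm_proj_le n _) 2
      simp only [hu, hv, hf, hg, hx0]
      exact add_le_add (h1 u₀) (h1 v₀)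
    · rw [derivProj_proj, derivProj_proj]
      have hA := inner_derivProj_nonlin_le a n (f t) (v t)
      have hB := inner_derivProj_nonlin_le a n (g t) (u t)
      have hc0 := (hx t ht).1
      have hc1 := (hx t ht).2.1
      set p := ‖(u t).dx‖ with hp
      set q := ‖(v t).dx‖ with hq
      have hp0 : 0 ≤ p := norm_nonneg _
      have hq0 : 0 ≤ q := norm_nonneg _
      -- The cutoff factor lies in `[0,1]` and the estimates control absolute values, so they hold
      -- whether or not the cutoff acts.
      have hmul : ∀ X Z : ℝ, |X| ≤ Z → c t * X ≤ Z := fun X Z h =>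
        (mul_le_mul_of_nonneg_left (le_abs_self X) hc0).trans
          ((mul_le_of_le_one_left (abs_nonneg X) hc1).trans h)
      have h1 := hmul _ _ hA
      have h2 := hmul _ _ hB
      have hps : p ≤ √(p ^ 2 + q ^ 2) := Real.le_sqrt_of_sq_le (by nlinarith)
      have hqs : q ≤ √(p ^ 2 + q ^ 2) := Real.le_sqrt_of_sq_le (by nlinarith)
      have h3 : q * p ^ 2 + p * q ^ 2 ≤ (p ^ 2 + q ^ 2) * √(p ^ 2 + q ^ 2) := by
        have := mul_le_mul_of_nonneg_right hqs (sq_nonneg p)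
        have := mul_le_mul_of_nonneg_right hps (sq_nonneg q)
        linarith
      have h4 := mul_le_mul_of_nonneg_left h3 hK
      linarith
  have hE : ∀ t ∈ Icc 0 b, ‖(u t).dx‖ ^ 2 + ‖(v t).dx‖ ^ 2 ≤ E₁ := fun t ht => by
    have h1 := hen t ht
    have h2 := lifeBound_le hK he0 hb ht.2
    linarith
  -- the `L²` norm
  have hL2 : ∀ t ∈ Icc 0 b, ‖(u t).fn‖ ^ 2 + ‖(v t).fn‖ ^ 2 ≤ Y := by
    intro t ht
    have h := le_of_deriv_le_linear (y := fun t => ‖(u t).fn‖ ^ 2 + ‖(v t).fn‖ ^ 2) hL1 le_rfl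
      (fun t ht => (hclm (proj n) f _ hfd t ht).fun_add (hclm (proj n) g _ hgd t ht))
      (by positivity) (fun t ht => ?_) t ht
    · refine h.trans ?_
      rw [add_zero]
      refine mul_le_mul_of_nonneg_right ?_ (Real.exp_pos _).le
      have h1 : ∀ w : H1, ‖(trunc n w.fn).fn‖ ^ 2 ≤ ‖w.fn‖ ^ 2 := fun w =>
        pow_le_pow_left₀ (norm_nonneg _) (norm_proj_le n _) 2
      simp only [hu, hv, hf, hg, hx0]
      exact add_le_add (h1 u₀) (h1 v₀)
    · have e1 : ∀ p q : L2, inner ℝ (proj n p) (proj n (proj n q)) = inner ℝ (proj n p) q := by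
        intro p q; rw [← inner_proj, ← inner_proj, proj_proj, proj_proj]
      rw [e1, e1]
      have hA := inner_nonlin_le a (u t) (v t)
      have hB := inner_nonlin_le a (v t) (u t)
      have hc0 := (hx t ht).1
      have hc1 := (hx t ht).2.1
      have hmul : ∀ X Z : ℝ, |X| ≤ Z → c t * X ≤ Z := fun X Z h =>
        (mul_le_mul_of_nonneg_left (le_abs_self X) hc0).trans
          ((mul_le_of_le_one_left (abs_nonneg X) hc1).trans h)
      have h1 := hmul _ _ hA
      have h2 := hmul _ _ hB
      have hps : ‖(u t).dx‖ ≤ √E₁ :=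
        Real.le_sqrt_of_sq_le (by nlinarith [hE t ht, sq_nonneg ‖(v t).dx‖])
      have hqs : ‖(v t).dx‖ ≤ √E₁ :=
        Real.le_sqrt_of_sq_le (by nlinarith [hE t ht, sq_nonneg ‖(u t).dx‖])
      have h3 := mul_le_mul_of_nonneg_left
        (mul_le_mul_of_nonneg_right hqs (sq_nonneg ‖(u t).fn‖)) hK
      have h4 := mul_le_mul_of_nonneg_left
        (mul_le_mul_of_nonneg_right hps (sq_nonneg ‖(v t).fn‖)) hK
      change 2 * (c t * inner ℝ (u t).fn (nonlin a (u t) (v t)))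
        + 2 * (c t * inner ℝ (v t).fn (nonlin a (v t) (u t)))
        ≤ L * (‖(u t).fn‖ ^ 2 + ‖(v t).fn‖ ^ 2) + 0
      rw [hL]
      nlinarith [sq_nonneg ‖(u t).fn‖, sq_nonneg ‖(v t).fn‖]
  have hnu : ∀ t ∈ Icc 0 b, ‖u t‖ ≤ R := fun t ht =>
    le_of_sq_le_sq (by
      rw [H1.norm_sq]
      linarith [hE t ht, hL2 t ht, sq_nonneg ‖(v t).fn‖, sq_nonneg ‖(v t).dx‖]) hR0.le
  have hnv : ∀ t ∈ Icc 0 b, ‖v t‖ ≤ R := fun t ht =>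
    le_of_sq_le_sq (by
      rw [H1.norm_sq]
      linarith [hE t ht, hL2 t ht, sq_nonneg ‖(u t).fn‖, sq_nonneg ‖(u t).dx‖]) hR0.le
  -- The a priori bounds show that the cutoff is never active, so the uncut Galerkin system is
  -- solved.
  have hc : ∀ t ∈ Icc 0 b, c t = 1 := fun t ht => (hx t ht).2.2.1
    (max_le ((H1.norm_fn_le (u t)).trans (hnu t ht)) ((H1.norm_fn_le (v t)).trans (hnv t ht)))
  have hcoef : ∀ (p q : ℝ → L2), (∀ t ∈ Icc 0 b, HasDerivWithinAt p
      (c t • proj n (q t)) (Icc 0 b) t) → ∀ t ∈ Icc 0 b, ∀ k : ℤ, |k| ≤ n →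
      HasDerivWithinAt (fun s => coef k (trunc n (p s)).fn) (coef k (q t)) (Icc 0 b) t := by
    intro p q h t ht k hk
    have h1 := (coef k).hasFDerivAt.comp_hasDerivWithinAt t (h t ht)
    rw [hc t ht, one_smul] at h1
    simpa only [trunc_fn, coef_proj, if_pos hk, Function.comp_def] using h1
  refine ⟨u, v, ⟨hnu, hnv, hcoef f _ hfd, hcoef g _ hgd⟩, ?_, ?_, ?_, ?_, hen⟩
  · simp only [hu, hf, hx0]
  · simp only [hv, hg, hx0]
  · exact (proj n).continuous.comp_continuousOn fun t ht => (hfd t ht).continuousWithinAt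
  · exact (proj n).continuous.comp_continuousOn fun t ht => (hgd t ht).continuousWithinAt

/-! ### Passage to the limit -/

/-- Weak lower semicontinuity of the homogeneous Sobolev norm. -/
theorem H1.exists_of_tendsto {p q : ℕ → H1} {f g : L2}
    (hp : Tendsto (fun n => (p n).fn) atTop (𝓝 f)) (hq : Tendsto (fun n => (q n).fn) atTop (𝓝 g))
    {M : ℝ} (hM : ∀ n, ‖(p n).dx‖ ^ 2 + ‖(q n).dx‖ ^ 2 ≤ M) :
    ∃ u v : H1, u.fn = f ∧ v.fn = g ∧ ‖u.dx‖ ^ 2 + ‖v.dx‖ ^ 2 ≤ M := by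
  set F : ℤ → ℝ := fun k => -(k : ℝ) * coef (-k) f with hF
  set G : ℤ → ℝ := fun k => -(k : ℝ) * coef (-k) g with hG
  have hlim : ∀ (k : ℤ) {r : ℕ → H1} {h : L2}, Tendsto (fun n => (r n).fn) atTop (𝓝 h) →
      Tendsto (fun n => coef k (r n).dx) atTop (𝓝 (-(k : ℝ) * coef (-k) h)) := by
    intro k r h hr
    simp only [H1.coef_dx]
    exact (((coef (-k)).continuous.tendsto _).comp hr).const_mul _
  -- Only the sum of the two energies is bounded, so finite partial sums of both pass to the limit
  -- together.
  have hsum : ∀ s : Finset ℤ, ∑ k ∈ s, (F k ^ 2 + G k ^ 2) ≤ M := by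
    intro s
    refine le_of_tendsto' (tendsto_finsetSum s fun k _ =>
      ((hlim k hp).pow 2).add ((hlim k hq).pow 2)) fun n => ?_
    exact (sum_le_hasSum s (fun k _ => by positivity)
      ((hasSum_coef_sq (p n).dx).add (hasSum_coef_sq (q n).dx))).trans (hM n)
  have hFG : Summable fun k => F k ^ 2 + G k ^ 2 :=
    summable_of_sum_le (fun k => by positivity) hsum
  obtain ⟨f', hf'⟩ := exists_coef_eq (hFG.of_nonneg_of_le (fun k => sq_nonneg (F k))
    fun k => le_add_of_nonneg_right (sq_nonneg _))
  obtain ⟨g', hg'⟩ := exists_coef_eq (hFG.of_nonneg_of_le (fun k => sq_nonneg (G k))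
    fun k => le_add_of_nonneg_left (sq_nonneg _))
  refine ⟨H1.mk f f' hf', H1.mk g g' hg', rfl, rfl, ?_⟩
  refine hasSum_le_of_sum_le ((hasSum_coef_sq f').add (hasSum_coef_sq g')) fun s => ?_
  simpa only [hf', hg'] using hsum s

/-- The integrand is extended by its end values to a continuous function on `ℝ`, where the
fundamental theorem of calculus applies at the endpoints too. -/
theorem hasDerivWithinAt_of_eq_integral {E : Type*} [NormedAddCommGroup E] [NormedSpace ℝ E]
    [CompleteSpace E] {φ ψ : ℝ → E} {b : ℝ} (hψ : ContinuousOn ψ (Icc 0 b))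
    (h : ∀ t ∈ Icc 0 b, φ t = φ 0 + ∫ s in (0)..t, ψ s) :
    ∀ t ∈ Icc 0 b, HasDerivWithinAt φ (ψ t) (Icc 0 b) t := by
  intro t ht
  have hb : 0 ≤ b := ht.1.trans ht.2
  set Ψ : ℝ → E := IccExtend hb ((Icc 0 b).domRestrict ψ) with hΨ
  have hΨc : Continuous Ψ := (continuousOn_iff_continuous_domRestrict.1 hψ).Icc_extend'
  have hΨeq : ∀ s ∈ Icc 0 b, Ψ s = ψ s := fun s hs => IccExtend_of_mem hb _ hs
  have h1 : HasDerivAt (fun r => φ 0 + ∫ s in (0)..r, Ψ s) (Ψ t) t :=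
    ((hΨc.integral_hasStrictDerivAt 0 t).hasDerivAt).const_add _
  rw [← hΨeq t ht]
  have heq : ∀ r ∈ Icc 0 b, φ r = φ 0 + ∫ s in (0)..r, Ψ s := by
    intro r hr
    rw [h r hr]
    congr 1
    refine intervalIntegral.integral_congr fun s hs => ?_
    rw [uIcc_of_le hr.1] at hs
    exact (hΨeq s ⟨hs.1, hs.2.trans hr.2⟩).symm
  exact h1.hasDerivWithinAt.congr heq (heq t ht)

theorem eq_integral_of_hasDerivWithinAt {φ ψ : ℝ → ℝ} {b : ℝ} (hψ : ContinuousOn ψ (Icc 0 b))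
    (h : ∀ t ∈ Icc 0 b, HasDerivWithinAt φ (ψ t) (Icc 0 b) t) :
    ∀ t ∈ Icc 0 b, φ t = φ 0 + ∫ s in (0)..t, ψ s := by
  intro t ht
  have hs : Icc 0 t ⊆ Icc 0 b := Icc_subset_Icc_right ht.2
  rw [intervalIntegral.integral_eq_sub_of_hasDerivAt_of_le ht.1
    (fun s hs' => ((h s (hs hs')).continuousWithinAt).mono hs)
    (fun s hs' => (h s (hs (Ioo_subset_Icc_self hs'))).hasDerivAt
      (Icc_mem_nhds hs'.1 (hs'.2.trans_le ht.2)))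
    ((hψ.mono hs).intervalIntegrable_of_Icc ht.1)]
  ring

/-- Pointwise limits of differentiable functions with bounded, pointwise convergent
derivatives. -/
theorem hasDerivWithinAt_of_tendsto {φ ψ : ℕ → ℝ → ℝ} {φ' ψ' : ℝ → ℝ} {b M : ℝ}
    (hd : ∀ n, ∀ t ∈ Icc 0 b, HasDerivWithinAt (φ n) (ψ n t) (Icc 0 b) t)
    (hc : ∀ n, ContinuousOn (ψ n) (Icc 0 b)) (hM : ∀ n, ∀ t ∈ Icc 0 b, |ψ n t| ≤ M)
    (hφ : ∀ t ∈ Icc 0 b, Tendsto (fun n => φ n t) atTop (𝓝 (φ' t)))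
    (hψ : ∀ t ∈ Icc 0 b, Tendsto (fun n => ψ n t) atTop (𝓝 (ψ' t)))
    (hc' : ContinuousOn ψ' (Icc 0 b)) :
    ∀ t ∈ Icc 0 b, HasDerivWithinAt φ' (ψ' t) (Icc 0 b) t := by
  refine hasDerivWithinAt_of_eq_integral hc' fun t ht => ?_
  have h0 : (0 : ℝ) ∈ Icc 0 b := ⟨le_rfl, ht.1.trans ht.2⟩
  have hs : uIoc 0 t ⊆ Icc 0 b := by
    rw [uIoc_of_le ht.1]
    exact fun s hs => ⟨hs.1.le, hs.2.trans ht.2⟩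
  have h1 : Tendsto (fun n => ∫ s in (0)..t, ψ n s) atTop (𝓝 (∫ s in (0)..t, ψ' s)) := by
    refine intervalIntegral.tendsto_integral_filter_of_dominated_convergence (fun _ => M)
      (Eventually.of_forall fun n => ?_) (Eventually.of_forall fun n => ?_)
      intervalIntegrable_const ?_
    · exact ((hc n).mono hs).aestronglyMeasurable measurableSet_uIoc
    · exact Eventually.of_forall fun s hs' => hM n s (hs hs')
    · exact Eventually.of_forall fun s hs' => hψ s (hs hs')
  have h2 : Tendsto (fun n => φ n t) atTop (𝓝 (φ' 0 + ∫ s in (0)..t, ψ' s)) :=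
    ((hφ 0 h0).add h1).congr fun n => (eq_integral_of_hasDerivWithinAt (hc n) (hd n) t ht).symm
  exact tendsto_nhds_unique (hφ t ht) h2

theorem proj_proj_of_le {n m : ℕ} (h : n ≤ m) (f : L2) : proj n (proj m f) = proj n f :=
  ext_coef fun k => by
    simp only [coef_proj]
    split_ifs with h1 h2
    · rfl
    · exact absurd (h1.trans (by exact_mod_cast h)) h2
    · rfl

theorem abs_coef_le (k : ℤ) (f : L2) : |coef k f| ≤ ‖f‖ := by
  have := abs_real_inner_le_norm (toL2 (hartley k)) f
  rwa [orthonormal_hartley.norm_eq_one, one_mul] at this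

/-- The `n`-th Galerkin solutions converge uniformly in `L²`. -/
theorem ApproxSol.exists_limit {a b R : ℝ} {U V : ℕ → ℝ → H1} {u₀ v₀ : H1}
    (h : ∀ n, ApproxSol a n b R (U n) (V n)) (hU : ∀ n, U n 0 = trunc n u₀.fn)
    (hV : ∀ n, V n 0 = trunc n v₀.fn)
    (hc : ∀ n, ContinuousOn (fun t => (U n t).fn) (Icc 0 b)) :
    ∃ f : ℝ → L2, ContinuousOn f (Icc 0 b) ∧
      ∀ t ∈ Icc 0 b, Tendsto (fun n => (U n t).fn) atTop (𝓝 (f t)) := by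
  obtain ⟨C, hC, hstab⟩ := ApproxSol.stability a b R
  have hdist : ∀ t ∈ Icc 0 b, ∀ n m N : ℕ, N ≤ n → N ≤ m →
      dist (U n t).fn (U m t).fn ≤ √(C * (1 / ((N : ℝ) + 1))) := by
    intro t ht n m N hn hm
    -- Solutions of levels `n, m ≥ N` are both approximate at level `N`, and their data agree there;
    -- only the error `1/(N+1)` remains.
    have hz : ∀ w : H1, proj N ((trunc n w.fn).fn - (trunc m w.fn).fn) = 0 := fun w => by
      rw [trunc_fn, trunc_fn, map_sub, proj_proj_of_le hn, proj_proj_of_le hm, sub_self]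
    have h1 := hstab N _ _ _ _ ((h n).mono_level hn) ((h m).mono_level hm) t ht
    rw [hU, hU, hV, hV, hz, hz, norm_zero, zero_pow two_ne_zero, add_zero, zero_add] at h1
    rw [dist_eq_norm]
    exact Real.le_sqrt_of_sq_le (by nlinarith [sq_nonneg ‖(V n t).fn - (V m t).fn‖])
  have hlim : Tendsto (fun N : ℕ => √(C * (1 / ((N : ℝ) + 1)))) atTop (𝓝 0) := by
    have h1 := (tendsto_one_div_add_atTop_nhds_zero_nat (𝕜 := ℝ)).const_mul C
    rw [mul_zero] at h1
    simpa using h1.sqrt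
  have hcauchy : ∀ t, ∃ x : L2, t ∈ Icc 0 b → Tendsto (fun n => (U n t).fn) atTop (𝓝 x) := by
    intro t
    by_cases ht : t ∈ Icc 0 b
    · obtain ⟨x, hx⟩ := cauchySeq_tendsto_of_complete
        (cauchySeq_of_le_tendsto_0 _ (fun n m N => hdist t ht n m N) hlim)
      exact ⟨x, fun _ => hx⟩
    · exact ⟨0, fun h => absurd h ht⟩
  choose f hf using hcauchy
  refine ⟨f, ?_, hf⟩
  have hunif : TendstoUniformlyOn (fun n t => (U n t).fn) f atTop (Icc 0 b) := by
    rw [Metric.tendstoUniformlyOn_iff]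
    intro ε hε
    filter_upwards [hlim.eventually_lt_const hε] with N hN t ht
    refine lt_of_le_of_lt ?_ hN
    refine le_of_tendsto ((hf t ht).dist tendsto_const_nhds) ?_
    filter_upwards [eventually_ge_atTop N] with n hn
    exact hdist t ht n N N hn le_rfl
  exact hunif.continuousOn (Eventually.of_forall hc).frequently

theorem continuousOn_comp_two {X Y Z : Type*} [TopologicalSpace X] [TopologicalSpace Y]
    [TopologicalSpace Z] {F : X → Y → Z} (hF : Continuous fun p : X × Y => F p.1 p.2) {f : ℝ → X}
    {g : ℝ → Y} {s : Set ℝ} (hf : ContinuousOn f s) (hg : ContinuousOn g s) :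
    ContinuousOn (fun t => F (f t) (g t)) s :=
  hF.comp_continuousOn (hf.prodMk hg)

theorem tendsto_comp_two {ι X Y Z : Type*} [TopologicalSpace X] [TopologicalSpace Y]
    [TopologicalSpace Z] {F : X → Y → Z} (hF : Continuous fun p : X × Y => F p.1 p.2) {f : ι → X}
    {g : ι → Y} {l : Filter ι} {x : X} {y : Y} (hf : Tendsto f l (𝓝 x)) (hg : Tendsto g l (𝓝 y)) :
    Tendsto (fun i => F (f i) (g i)) l (𝓝 (F x y)) :=
  (hF.tendsto (x, y)).comp (hf.prodMk_nhds hg)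

/-- Limits of approximate solutions satisfy the equations for all coefficients. -/
theorem ApproxSol.hasDerivWithinAt_limit {a b R : ℝ} {P Q : ℕ → ℝ → H1} {p q : ℝ → H1}
    (hPQ : ∀ n, ApproxSol a n b R (P n) (Q n))
    (hPc : ∀ n, ContinuousOn (fun t => (P n t).fn) (Icc 0 b))
    (hQc : ∀ n, ContinuousOn (fun t => (Q n t).fn) (Icc 0 b))
    (hP : ∀ t ∈ Icc 0 b, Tendsto (fun n => (P n t).fn) atTop (𝓝 (p t).fn))
    (hQ : ∀ t ∈ Icc 0 b, Tendsto (fun n => (Q n t).fn) atTop (𝓝 (q t).fn))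
    (hpc : ContinuousOn (fun t => (p t).fn) (Icc 0 b))
    (hqc : ContinuousOn (fun t => (q t).fn) (Icc 0 b)) (k : ℤ) :
    ∀ t ∈ Icc 0 b, HasDerivWithinAt (fun s => coef k (p s).fn)
      (coef k (nonlin a (p t) (q t))) (Icc 0 b) t := by
  intro t ht
  have hR0 : 0 ≤ R := (norm_nonneg _).trans ((hPQ 0).norm_fst t ht)
  -- The `k`-th equation holds only from level `|k|` on, so the sequence is shifted.
  have hshift : Tendsto (fun n : ℕ => n + k.natAbs) atTop atTop := tendsto_add_atTop_nat _
  have hcont : ∀ {f g : ℝ → L2}, ContinuousOn f (Icc 0 b) → ContinuousOn g (Icc 0 b) →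
      ContinuousOn (fun s => nonlinCoef a k (f s) (g s)) (Icc 0 b) := fun hf hg =>
    continuousOn_comp_two (F := nonlinCoef a k) (continuous_nonlinCoef a k) hf hg
  rw [coef_nonlin]
  have hbd : ∀ n, ∀ s ∈ Icc 0 b,
      |nonlinCoef a k (P (n + k.natAbs) s).fn (Q (n + k.natAbs) s).fn| ≤ nonlinConst a * R * R := by
    intro n s hs
    rw [← coef_nonlin]
    refine (abs_coef_le _ _).trans ((norm_nonlin_le a _ _).trans ?_)
    exact mul_le_mul (mul_le_mul_of_nonneg_left ((hPQ _).norm_fst s hs) (nonlinConst_nonneg a))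
      ((hPQ _).norm_snd s hs) (norm_nonneg _) (mul_nonneg (nonlinConst_nonneg a) hR0)
  have hd : ∀ n, ∀ s ∈ Icc 0 b, HasDerivWithinAt (fun s => coef k (P (n + k.natAbs) s).fn)
      (nonlinCoef a k (P (n + k.natAbs) s).fn (Q (n + k.natAbs) s).fn) (Icc 0 b) s := by
    intro n s hs
    rw [← coef_nonlin]
    exact (hPQ _).deriv_fst s hs k (by rw [Int.abs_eq_natAbs]; push_cast; omega)
  have hφ : ∀ s ∈ Icc 0 b, Tendsto (fun n => coef k (P (n + k.natAbs) s).fn) atTop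
      (𝓝 (coef k (p s).fn)) := fun s hs =>
    ((coef k).continuous.tendsto _).comp ((hP s hs).comp hshift)
  have hψ : ∀ s ∈ Icc 0 b, Tendsto
      (fun n => nonlinCoef a k (P (n + k.natAbs) s).fn (Q (n + k.natAbs) s).fn) atTop
      (𝓝 (nonlinCoef a k (p s).fn (q s).fn)) := by
    intro s hs
    exact tendsto_comp_two (F := nonlinCoef a k) (continuous_nonlinCoef a k)
      ((hP s hs).comp hshift) ((hQ s hs).comp hshift)
  exact hasDerivWithinAt_of_tendsto hd (fun n => hcont (hPc _) (hQc _)) hbd hφ hψ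
    (hcont hpc hqc) t ht

set_option maxHeartbeats 400000 in
/-- Existence of weak solutions bounded in `H¹`. -/
theorem exists_weak (a : ℝ) (u₀ v₀ : H1) {b : ℝ} (hb0 : 0 ≤ b)
    (hb : energyConst a * b ≤ 1 / 2 * (√(1 + (‖u₀.dx‖ ^ 2 + ‖v₀.dx‖ ^ 2)))⁻¹) :
    ∃ (R : ℝ) (u v : ℝ → H1), (∀ n, ApproxSol a n b R u v) ∧ u 0 = u₀ ∧ v 0 = v₀ ∧
      ∀ t ∈ Icc 0 b, ‖(u t).dx‖ ^ 2 + ‖(v t).dx‖ ^ 2 + 1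
        ≤ lifeBound (energyConst a) (‖u₀.dx‖ ^ 2 + ‖v₀.dx‖ ^ 2) t := by
  have hK := (energyConst_pos a).le
  obtain ⟨R, hR⟩ := exists_galerkin a u₀ v₀ hb0 hb
  choose U V hsol hU hV hUc hVc hen using hR
  set e := ‖u₀.dx‖ ^ 2 + ‖v₀.dx‖ ^ 2 with he
  have he0 : 0 ≤ e := by positivity
  obtain ⟨f, hfc, hf⟩ := ApproxSol.exists_limit hsol hU hV hUc
  obtain ⟨g, hgc, hg⟩ := ApproxSol.exists_limit (fun n => (hsol n).symm) hV hU hVc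
  have hex : ∀ t, ∃ u v : H1, t ∈ Icc 0 b → u.fn = f t ∧ v.fn = g t ∧
      ‖u.dx‖ ^ 2 + ‖v.dx‖ ^ 2 ≤ lifeBound (energyConst a) e t - 1 := by
    intro t
    by_cases ht : t ∈ Icc 0 b
    · obtain ⟨u, v, h⟩ := H1.exists_of_tendsto (hf t ht) (hg t ht)
        (M := lifeBound (energyConst a) e t - 1) fun n => by linarith [hen n t ht]
      exact ⟨u, v, fun _ => h⟩
    · exact ⟨0, 0, fun h => absurd h ht⟩
  choose u v huv using hex
  have h0 : (0 : ℝ) ∈ Icc 0 b := ⟨le_rfl, hb0⟩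
  have hE : ∀ t ∈ Icc 0 b, ‖(u t).dx‖ ^ 2 + ‖(v t).dx‖ ^ 2 ≤ 4 * (1 + e) := fun t ht => by
    linarith [(huv t ht).2.2, lifeBound_le hK he0 hb ht.2]
  have hR0 : 0 ≤ R := (norm_nonneg _).trans ((hsol 0).norm_fst 0 h0)
  have huf : ∀ t ∈ Icc 0 b, Tendsto (fun n => (U n t).fn) atTop (𝓝 (u t).fn) := fun t ht => by
    rw [(huv t ht).1]; exact hf t ht
  have hvg : ∀ t ∈ Icc 0 b, Tendsto (fun n => (V n t).fn) atTop (𝓝 (v t).fn) := fun t ht => by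
    rw [(huv t ht).2.1]; exact hg t ht
  have huc : ContinuousOn (fun t => (u t).fn) (Icc 0 b) := hfc.congr fun t ht => (huv t ht).1
  have hvc : ContinuousOn (fun t => (v t).fn) (Icc 0 b) := hgc.congr fun t ht => (huv t ht).2.1
  have hnorm : ∀ {P : ℕ → H1} {p : H1}, (∀ n, ‖P n‖ ≤ R) →
      Tendsto (fun n => (P n).fn) atTop (𝓝 p.fn) → ‖p.dx‖ ^ 2 ≤ 4 * (1 + e) →
      ‖p‖ ≤ R + √(4 * (1 + e)) := by
    intro P p hP hlim hd
    refine p.norm_le.trans (add_le_add ?_ (Real.le_sqrt_of_sq_le hd))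
    exact le_of_tendsto' hlim.norm fun n => (P n).norm_fn_le.trans (hP n)
  refine ⟨R + √(4 * (1 + e)), u, v, fun n => ⟨fun t ht => ?_, fun t ht => ?_, fun t ht k _ => ?_,
    fun t ht k _ => ?_⟩, ?_, ?_, fun t ht => by linarith [(huv t ht).2.2]⟩
  · exact hnorm (fun n => (hsol n).norm_fst t ht) (huf t ht)
      (by linarith [hE t ht, sq_nonneg ‖(v t).dx‖])
  · exact hnorm (fun n => (hsol n).norm_snd t ht) (hvg t ht)
      (by linarith [hE t ht, sq_nonneg ‖(u t).dx‖])
  · exact ApproxSol.hasDerivWithinAt_limit hsol hUc hVc huf hvg huc hvc k t ht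
  · exact ApproxSol.hasDerivWithinAt_limit (fun n => (hsol n).symm) hVc hUc hvg huf hvc huc k t ht
  · refine H1.ext_fn (tendsto_nhds_unique (huf 0 h0) ?_)
    simp only [hU, trunc_fn]
    exact proj_tendsto _
  · refine H1.ext_fn (tendsto_nhds_unique (hvg 0 h0) ?_)
    simp only [hV, trunc_fn]
    exact proj_tendsto _

/-! ### Energy bound for all weak solutions and strong continuity in time -/

/-- The energy estimate for bounded weak solutions. -/
theorem ApproxSol.energy_le {a b R : ℝ} {u v : ℝ → H1} (h : ∀ n, ApproxSol a n b R u v) {s : ℝ}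
    (hs : s ∈ Icc 0 b)
    (hK : energyConst a * s ≤ 1 / 2 * (√(1 + (‖(u 0).dx‖ ^ 2 + ‖(v 0).dx‖ ^ 2)))⁻¹) :
    ‖(u s).dx‖ ^ 2 + ‖(v s).dx‖ ^ 2 + 1
      ≤ lifeBound (energyConst a) (‖(u 0).dx‖ ^ 2 + ‖(v 0).dx‖ ^ 2) s := by
  -- A weak solution is too rough for a direct energy computation. The bound is inherited from the
  -- constructed solution with the same data, which coincides with it by uniqueness.
  obtain ⟨R', u', v', h', hu', hv', hen⟩ := exists_weak a (u 0) (v 0) hs.1 hK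
  obtain ⟨h1, h2⟩ := ApproxSol.unique (R := max R R')
    (fun n => ((h n).mono_time hs.2).mono_bound (le_max_left _ _))
    (fun n => (h' n).mono_bound (le_max_right _ _)) hu'.symm hv'.symm s ⟨hs.1, le_rfl⟩
  rw [h1, h2]
  exact hen s ⟨hs.1, le_rfl⟩

/-- Weak convergence from boundedness and convergence on the basis: `h` is approximated by `proj N
h`, uniformly in the index `i`. -/
theorem tendsto_inner_of_tendsto_coef {ι : Type*} {l : Filter ι} {f : ι → L2} {f₀ : L2} {R : ℝ}
    (hb : ∀ᶠ i in l, ‖f i‖ ≤ R)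
    (hc : ∀ k, Tendsto (fun i => coef k (f i)) l (𝓝 (coef k f₀))) (h : L2) :
    Tendsto (fun i => inner ℝ (f i) h) l (𝓝 (inner ℝ f₀ h)) := by
  rw [Metric.tendsto_nhds]
  intro ε hε
  have h1 : Tendsto (fun N => (|R| + ‖f₀‖) * ‖h - proj N h‖) atTop (𝓝 0) := by
    have := ((tendsto_const_nhds (x := h)).sub (proj_tendsto h)).norm.const_mul (|R| + ‖f₀‖)
    simpa using this
  obtain ⟨N, hN⟩ := (h1.eventually_lt_const (half_pos hε)).exists
  have h2 : Tendsto (fun i => inner ℝ (f i) (proj N h)) l (𝓝 (inner ℝ f₀ (proj N h))) := by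
    have e : ∀ g : L2, inner ℝ g (proj N h)
        = ∑ k ∈ Finset.Icc (-(N : ℤ)) N, coef k h * coef k g := by
      intro g
      rw [proj_eq_sum, inner_sum]
      refine Finset.sum_congr rfl fun k _ => ?_
      rw [inner_smul_right, real_inner_comm]; rfl
    simp only [e]
    exact tendsto_finsetSum _ fun k _ => (hc k).const_mul _
  filter_upwards [hb, (Metric.tendsto_nhds.1 h2) _ (half_pos hε)] with i hi1 hi2
  rw [Real.dist_eq] at hi2 ⊢
  have e : inner ℝ (f i) h - inner ℝ f₀ h
      = (inner ℝ (f i) (proj N h) - inner ℝ f₀ (proj N h))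
        + inner ℝ (f i - f₀) (h - proj N h) := by
    rw [inner_sub_left, inner_sub_right, inner_sub_right]; ring
  have h3 : |inner ℝ (f i - f₀) (h - proj N h)| ≤ (|R| + ‖f₀‖) * ‖h - proj N h‖ :=
    (abs_real_inner_le_norm _ _).trans (mul_le_mul_of_nonneg_right
      ((norm_sub_le _ _).trans (add_le_add_left (hi1.trans (le_abs_self R)) _)) (norm_nonneg _))
  rw [e]
  refine (abs_add_le _ _).trans_lt ?_
  linarith

/-- The energy of a bounded weak solution is upper semicontinuous in time. -/
theorem ApproxSol.eventually_energy_le {a b R : ℝ} {u v : ℝ → H1}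
    (h : ∀ n, ApproxSol a n b R u v) {t₀ : ℝ} (ht₀ : t₀ ∈ Icc 0 b) :
    ∀ᶠ t in 𝓝[Icc 0 b] t₀, ‖(u t).dx‖ ^ 2 + ‖(v t).dx‖ ^ 2 + 1
      ≤ lifeBound (energyConst a) (‖(u t₀).dx‖ ^ 2 + ‖(v t₀).dx‖ ^ 2) |t - t₀| := by
  have h0 : Tendsto (fun t => energyConst a * |t - t₀|) (𝓝[Icc 0 b] t₀) (𝓝 0) := by
    have : Continuous fun t => energyConst a * |t - t₀| := by fun_prop
    have h1 := this.tendsto t₀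
    simp only [sub_self, abs_zero, mul_zero] at h1
    exact h1.mono_left nhdsWithin_le_nhds
  have h1 : (0 : ℝ) < 1 / 2 * (√(1 + (‖(u t₀).dx‖ ^ 2 + ‖(v t₀).dx‖ ^ 2)))⁻¹ := by positivity
  filter_upwards [h0.eventually_le_const h1, self_mem_nhdsWithin] with t ht htb
  -- Later times restart the solution at `t₀`; earlier times restart the time-reversed solution
  -- there.
  rcases le_total t₀ t with htt | htt
  · rw [abs_of_nonneg (sub_nonneg.2 htt)] at ht ⊢
    have := ApproxSol.energy_le (fun n => (h n).shift ht₀.1) (s := t - t₀)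
      ⟨sub_nonneg.2 htt, by linarith [htb.2]⟩ (by simpa only [add_zero] using ht)
    simpa only [add_zero, add_sub_cancel] using this
  · rw [abs_of_nonpos (sub_nonpos.2 htt), neg_sub] at ht ⊢
    have := ApproxSol.energy_le (fun n => (h n).reverse ht₀.2) (s := t₀ - t)
      ⟨sub_nonneg.2 htt, by linarith [htb.1]⟩
      (by simpa only [sub_zero, H1.neg_dx, norm_neg] using ht)
    simpa only [sub_zero, sub_sub_cancel, H1.neg_dx, norm_neg] using this

/-- Bounded weak solutions are strongly continuous in `H¹`. -/
theorem ApproxSol.continuousOn {a b R : ℝ} {u v : ℝ → H1}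
    (h : ∀ n, ApproxSol a n b R u v) : ContinuousOn u (Icc 0 b) := by
  intro t₀ ht₀
  have hcu : ∀ k, Tendsto (fun t => coef k (u t).fn) (𝓝[Icc 0 b] t₀) (𝓝 (coef k (u t₀).fn)) :=
    fun k => ((h k.natAbs).deriv_fst t₀ ht₀ k (by rw [Int.abs_eq_natAbs])).continuousWithinAt
  have hcv : ∀ k, Tendsto (fun t => coef k (v t).fn) (𝓝[Icc 0 b] t₀) (𝓝 (coef k (v t₀).fn)) :=
    fun k => ((h k.natAbs).deriv_snd t₀ ht₀ k (by rw [Int.abs_eq_natAbs])).continuousWithinAt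
  have hmem : ∀ᶠ t in 𝓝[Icc 0 b] t₀, t ∈ Icc 0 b := self_mem_nhdsWithin
  have hwu : Tendsto (fun t => inner ℝ (u t).dx (u t₀).dx) (𝓝[Icc 0 b] t₀)
      (𝓝 (inner ℝ (u t₀).dx (u t₀).dx)) := by
    refine tendsto_inner_of_tendsto_coef (R := R) ?_ (fun k => ?_) _
    · filter_upwards [hmem] with t ht using (u t).norm_dx_le.trans ((h 0).norm_fst t ht)
    · simp only [H1.coef_dx]; exact (hcu _).const_mul _
  have hwv : Tendsto (fun t => inner ℝ (v t).dx (v t₀).dx) (𝓝[Icc 0 b] t₀)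
      (𝓝 (inner ℝ (v t₀).dx (v t₀).dx)) := by
    refine tendsto_inner_of_tendsto_coef (R := R) ?_ (fun k => ?_) _
    · filter_upwards [hmem] with t ht using (v t).norm_dx_le.trans ((h 0).norm_snd t ht)
    · simp only [H1.coef_dx]; exact (hcv _).const_mul _
  rw [real_inner_self_eq_norm_sq] at hwu hwv
  set e := ‖(u t₀).dx‖ ^ 2 + ‖(v t₀).dx‖ ^ 2 with he
  have he0 : 0 ≤ e := by positivity
  have hlife : Tendsto (fun t => lifeBound (energyConst a) e |t - t₀|) (𝓝[Icc 0 b] t₀)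
      (𝓝 (1 + e)) := by
    rw [← lifeBound_zero (energyConst a) he0]
    refine (continuousAt_lifeBound (energyConst a) he0).tendsto.comp ?_
    have : Continuous fun t => |t - t₀| := by fun_prop
    have h1 := this.tendsto t₀
    simp only [sub_self, abs_zero] at h1
    exact h1.mono_left nhdsWithin_le_nhds
  -- Weak convergence without increase of norm in the limit is strong convergence. Only the joint
  -- energy of `u` and `v` is controlled, so both squares are expanded and the one for `v` is
  -- dropped.
  have hsq : Tendsto (fun t => ‖(u t).dx - (u t₀).dx‖ ^ 2) (𝓝[Icc 0 b] t₀) (𝓝 0) := by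
    have hup : Tendsto (fun t => lifeBound (energyConst a) e |t - t₀| - 1 + e
        - 2 * (inner ℝ (u t).dx (u t₀).dx + inner ℝ (v t).dx (v t₀).dx)) (𝓝[Icc 0 b] t₀)
        (𝓝 0) := by
      have := ((hlife.sub_const 1).add_const e).sub ((hwu.add hwv).const_mul 2)
      have e1 : 1 + e - 1 + e - 2 * (‖(u t₀).dx‖ ^ 2 + ‖(v t₀).dx‖ ^ 2) = 0 := by
        rw [he]; ring
      rwa [e1] at this
    refine squeeze_zero' (Eventually.of_forall fun t => sq_nonneg _) ?_ hup
    filter_upwards [ApproxSol.eventually_energy_le h ht₀] with t ht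
    have h1 := norm_sub_sq_real (u t).dx (u t₀).dx
    have h2 := norm_sub_sq_real (v t).dx (v t₀).dx
    have h3 := sq_nonneg ‖(v t).dx - (v t₀).dx‖
    linarith
  have hdx : Tendsto (fun t => (u t).dx) (𝓝[Icc 0 b] t₀) (𝓝 (u t₀).dx) := by
    rw [tendsto_iff_norm_sub_tendsto_zero]
    simpa using hsq.sqrt
  -- A function is its mean plus the antiderivative of its derivative, and both are already
  -- continuous in time.
  have hfn : Tendsto (fun t => (u t).fn) (𝓝[Icc 0 b] t₀) (𝓝 (u t₀).fn) := by
    have e1 : ∀ w : H1, w.fn = coef 0 w.fn • toL2 (hartley 0) + antideriv w.dx := fun w => by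
      rw [← toL2_antiderivC, ← map_smul, ← map_add, ← H1.toC_apply, H1.toL2_toC]
    rw [e1 (u t₀)]
    refine Tendsto.congr (fun t => (e1 (u t)).symm) ?_
    exact ((hcu 0).smul_const _).add ((antideriv.continuous.tendsto _).comp hdx)
  rw [tendsto_iff_norm_sub_tendsto_zero] at hdx hfn
  rw [ContinuousWithinAt, tendsto_iff_norm_sub_tendsto_zero]
  refine squeeze_zero (fun _ => norm_nonneg _) (fun t => (u t - u t₀).norm_le) ?_
  simpa only [H1.sub_fn, H1.sub_dx, add_zero] using hfn.add hdx

/-- Bounded weak solutions satisfy the equation in `L²`. -/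
theorem ApproxSol.hasDerivWithinAt_fn {a b R : ℝ} {u v : ℝ → H1}
    (h : ∀ n, ApproxSol a n b R u v) : ∀ t ∈ Icc 0 b,
    HasDerivWithinAt (fun s => (u s).fn) (nonlin a (u t) (v t)) (Icc 0 b) t := by
  -- Strong continuity in `H¹` makes the right-hand side continuous into `L²`, so the coefficient
  -- equations integrate to one identity in `L²`.
  have hc : ContinuousOn (fun s => nonlin a (u s) (v s)) (Icc 0 b) :=
    continuousOn_comp_two (F := nonlin a) (continuous_nonlin a) (ApproxSol.continuousOn h)
      (ApproxSol.continuousOn fun n => (h n).symm)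
  have key : ∀ t ∈ Icc 0 b, (u t).fn = (u 0).fn + ∫ s in (0)..t, nonlin a (u s) (v s) := by
    intro t ht
    refine ext_coef fun k => ?_
    have hk : |k| ≤ (k.natAbs : ℤ) := (Int.abs_eq_natAbs k).le
    have h2 : ∫ s in (0)..t, coef k (nonlin a (u s) (v s))
        = coef k (∫ s in (0)..t, nonlin a (u s) (v s)) :=
      ContinuousLinearMap.intervalIntegral_comp_comm _
        ((hc.mono (Icc_subset_Icc_right ht.2)).intervalIntegrable_of_Icc ht.1)
    rw [map_add, ← h2]
    exact eq_integral_of_hasDerivWithinAt (φ := fun s => coef k (u s).fn)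
      (ψ := fun s => coef k (nonlin a (u s) (v s))) (b := b)
      ((coef k).continuous.comp_continuousOn hc)
      (fun s hs => (h k.natAbs).deriv_fst s hs k hk) t ht
  exact hasDerivWithinAt_of_eq_integral (E := L2) (φ := fun s => (u s).fn)
    (ψ := fun s => nonlin a (u s) (v s)) hc key

/-! ### Local well-posedness -/

theorem evolution_iff (a : ℝ) (D : L2) (u v : H1) :
    (∀ᵐ x : Circ, D x + a * (potential v.fn).fn x * u.dx x
      - v.fn x * (potential u.fn).dx x = 0) ↔ D = nonlin a u v := by
  have h1 : (fun x => (potential v.fn).toC x) =ᵐ[volume] (potential v.fn).fn := by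
    have := coeFn_toL2 (potential v.fn).toC
    rw [H1.toL2_toC] at this
    exact this.symm
  have h2 : (fun x => v.toC x) =ᵐ[volume] v.fn := by
    have := coeFn_toL2 v.toC
    rw [H1.toL2_toC] at this
    exact this.symm
  have h3 : nonlin a u v =ᵐ[volume] fun x => -a * ((potential v.fn).fn x * u.dx x)
      + v.fn x * (potential u.fn).dx x := by
    rw [nonlin, ← toC_potential, ← potential_dx]
    filter_upwards [h1, h2, coeFn_mulL (potential v.fn).toC u.dx,
      coeFn_mulL v.toC (potential u.fn).dx,
      Lp.coeFn_smul (-a) (mulL (potential v.fn).toC u.dx),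
      Lp.coeFn_add (-a • mulL (potential v.fn).toC u.dx) (mulL v.toC (potential u.fn).dx)]
      with x h1 h2 h3 h4 h5 h6
    rw [h6, Pi.add_apply, h5, Pi.smul_apply, h3, h4, smul_eq_mul, ← h1, ← h2]
  rw [Lp.ext_iff]
  constructor
  · intro h
    filter_upwards [h, h3] with x hx hx3
    rw [hx3]; linear_combination hx
  · intro h
    filter_upwards [h, h3] with x hx hx3
    rw [hx, hx3]; ring

/-- The equations in terms of the nonlinearity. -/
theorem exists_potentials_iff (a : ℝ) (D E : L2) (u v : H1) :
    (∃ p m : H1, IsPotential p u.fn ∧ IsPotential m v.fn ∧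
      (∀ᵐ x : Circ, D x + a * m.fn x * u.dx x - v.fn x * p.dx x = 0) ∧
      (∀ᵐ x : Circ, E x + a * p.fn x * v.dx x - u.fn x * m.dx x = 0)) ↔
    D = nonlin a u v ∧ E = nonlin a v u := by
  simp only [isPotential_iff, ← evolution_iff]
  constructor
  · rintro ⟨p, m, rfl, rfl, h⟩
    exact h
  · exact fun h => ⟨_, _, rfl, rfl, h⟩

/-- The time of existence. -/
def lifespan (a r s : ℝ) : ℝ := (2 * energyConst a * √(1 + (r ^ 2 + s ^ 2)))⁻¹

theorem lifespan_pos (a r s : ℝ) : 0 < lifespan a r s := by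
  have := energyConst_pos a
  unfold lifespan
  positivity

/-- The time chosen is half the blow-up time of `lifeBound`. -/
theorem energyConst_mul_lifespan (a r s : ℝ) :
    energyConst a * lifespan a r s = 1 / 2 * (√(1 + (r ^ 2 + s ^ 2)))⁻¹ := by
  have h := (energyConst_pos a).ne'
  have h' : √(1 + (r ^ 2 + s ^ 2)) ≠ 0 := by positivity
  unfold lifespan
  field_simp

theorem ApproxSol.contDiffOn {a b R : ℝ} {u v : ℝ → H1} (h : ∀ n, ApproxSol a n b R u v) :
    ContDiffOn ℝ 1 (fun t => (u t).fn) (Ico 0 b) ∧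
    ∀ t ∈ Ico 0 b, derivWithin (fun s => (u s).fn) (Ico 0 b) t = nonlin a (u t) (v t) := by
  have hs : Ico 0 b ⊆ Icc 0 b := Ico_subset_Icc_self
  have hd : ∀ t ∈ Ico 0 b,
      HasDerivWithinAt (fun s => (u s).fn) (nonlin a (u t) (v t)) (Ico 0 b) t :=
    fun t ht => (ApproxSol.hasDerivWithinAt_fn h t (hs ht)).mono hs
  have hu : UniqueDiffOn ℝ (Ico 0 b) := uniqueDiffOn_Ico 0 b
  have he : ∀ t ∈ Ico 0 b, derivWithin (fun s => (u s).fn) (Ico 0 b) t = nonlin a (u t) (v t) :=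
    fun t ht => (hd t ht).derivWithin (hu t ht)
  refine ⟨(contDiffOn_one_iff_derivWithin hu).2
    ⟨fun t ht => (hd t ht).differentiableWithinAt, ?_⟩, he⟩
  exact (continuousOn_comp_two (F := nonlin a) (continuous_nonlin a)
    ((ApproxSol.continuousOn h).mono hs)
    ((ApproxSol.continuousOn fun n => (h n).symm).mono hs)).congr he

/-- A solution on `[0,T)` may be unbounded near `T`, so the bound comes from compactness of `[0,t]`
with `t < T`. -/
theorem IsSolution.exists_approxSol {a T : ℝ} {Ω₀ ω₀ : H1} {Ω ω : ℝ → H1}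
    (h : IsSolution a T Ω₀ ω₀ Ω ω) {t : ℝ} (ht : t ∈ Ico 0 T) :
    ∃ R, ∀ n, ApproxSol a n t R Ω ω := by
  have hs : Icc 0 t ⊆ Ico 0 T := fun s hs => ⟨hs.1, hs.2.trans_lt ht.2⟩
  obtain ⟨R₁, h1⟩ := isCompact_Icc.exists_bound_of_continuousOn (h.cont_Ω.mono hs)
  obtain ⟨R₂, h2⟩ := isCompact_Icc.exists_bound_of_continuousOn (h.cont_ω.mono hs)
  have hd : ∀ {w : ℝ → L2}, ContDiffOn ℝ 1 w (Ico 0 T) → ∀ s ∈ Icc 0 t,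
      HasDerivWithinAt w (derivWithin w (Ico 0 T) s) (Icc 0 t) s := fun hw s hst =>
    (((hw.differentiableOn one_ne_zero) s (hs hst)).hasDerivWithinAt).mono hs
  have he := fun s hst => (exists_potentials_iff a _ _ _ _).1 (h.equation s (hs hst))
  refine ⟨max R₁ R₂, fun n => ⟨fun s hst => (h1 s hst).trans (le_max_left _ _),
    fun s hst => (h2 s hst).trans (le_max_right _ _), fun s hst k _ => ?_, fun s hst k _ => ?_⟩⟩
  · have := hd h.contDiff_Ω s hst
    rw [(he s hst).1] at this
    exact (coef k).hasFDerivAt.comp_hasDerivWithinAt s this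
  · have := hd h.contDiff_ω s hst
    rw [(he s hst).2] at this
    exact (coef k).hasFDerivAt.comp_hasDerivWithinAt s this

end MHD1D

end

theorem mainTheorem1 (a : ℝ) :
    ∃ T : ℝ → ℝ → ℝ, (∀ r s : ℝ, 0 < T r s) ∧
      ∀ Ω₀ ω₀ : MHD1D.H1,
        ∃ Ω ω : ℝ → MHD1D.H1,
          MHD1D.IsSolution a (T ‖Ω₀.dx‖ ‖ω₀.dx‖) Ω₀ ω₀ Ω ω ∧
          ∀ Ω' ω' : ℝ → MHD1D.H1,
            MHD1D.IsSolution a (T ‖Ω₀.dx‖ ‖ω₀.dx‖) Ω₀ ω₀ Ω' ω' →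
            ∀ t ∈ Set.Ico 0 (T ‖Ω₀.dx‖ ‖ω₀.dx‖), Ω' t = Ω t ∧ ω' t = ω t := by
  refine ⟨MHD1D.lifespan a, MHD1D.lifespan_pos a, fun Ω₀ ω₀ => ?_⟩
  set T := MHD1D.lifespan a ‖Ω₀.dx‖ ‖ω₀.dx‖ with hT
  obtain ⟨R, Ω, ω, h, hΩ, hω, -⟩ := MHD1D.exists_weak a Ω₀ ω₀ (MHD1D.lifespan_pos a _ _).le
    (MHD1D.energyConst_mul_lifespan a ‖Ω₀.dx‖ ‖ω₀.dx‖).le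
  have h' := fun n => (h n).symm
  have hs : Set.Ico 0 T ⊆ Set.Icc 0 T := Set.Ico_subset_Icc_self
  obtain ⟨hΩ1, hΩ2⟩ := MHD1D.ApproxSol.contDiffOn h
  obtain ⟨hω1, hω2⟩ := MHD1D.ApproxSol.contDiffOn h'
  refine ⟨Ω, ω, ⟨hΩ, hω, (MHD1D.ApproxSol.continuousOn h).mono hs,
    (MHD1D.ApproxSol.continuousOn h').mono hs, hΩ1, hω1, fun t ht =>
    (MHD1D.exists_potentials_iff a _ _ _ _).2 ⟨hΩ2 t ht, hω2 t ht⟩⟩, ?_⟩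
  intro Ω' ω' hsol t ht
  obtain ⟨R', hR'⟩ := hsol.exists_approxSol ht
  -- The two solutions are compared on `[0,t]` only, with a common bound there.
  exact MHD1D.ApproxSol.unique (R := max R R')
    (fun n => (hR' n).mono_bound (le_max_right _ _))
    (fun n => ((h n).mono_time ht.2.le).mono_bound (le_max_left _ _))
    (hsol.init_Ω.trans hΩ.symm) (hsol.init_ω.trans hω.symm) t ⟨ht.1, le_rfl⟩
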